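/- **Notation.** Let $\tau,\hbar\in\mathbb C$ with $\operatorname{Im}\tau>0$, $\hbar\neq 0$ and $\hbar\mathbb Z\cap(\mathbb Z+\mathbb Z\tau)=\{0\}$, and let $$\theta(z)=-\sum_{j\in\mathbb Z}\exp\left(i\pi(j+\tfrac12)^2\tau+2i\pi(j+\tfrac12)(z+\tfrac12)\right).$$ Let $\mathbb M$ be the field of meromorphic functions $g(x)$ on $\mathbb C$. For $\ell\in\mathbb C$ let $\mathcal W^\ell=\bigoplus_{j\ge 0}\mathbb M w_j$ with $w_j$ of weight $\ell-2j$ be the asymptotic representation of the elliptic quantum group of $\mathfrak{sl}_2$: the $\mathbb C$-linear operators $L_{ik}(z)$ ($i,k\in\{\pm1\}$) on $\mathcal W^\ell$ satisfy $L_{ik}(z)(g(x)v)=g(x+k\hbar)L_{ik}(z)v$ for $g\in\mathbb M$, and $$L_{++}(z)w_j=\frac{\theta(z+(\ell-j+1)\hbar)\,\theta(x+(\ell-j+1)\hbar)\,\theta(x-j\hbar)}{\theta(x)\,\theta(x+(\ell-2j+1)\hbar)}w_j,\qquad L_{+-}(z)w_j=\frac{\theta(z+x+(\ell-j)\hbar)\,\theta((\ell-j)\hbar)}{\theta(x+(\ell-2j-1)\hbar)}w_{j+1},$$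 $$L_{-+}(z)w_j=-\frac{\theta(z-x+j\hbar)\,\theta(j\hbar)}{\theta(x)}w_{j-1}\ (j\ge1),\qquad L_{-+}(z)w_0=0,\qquad L_{--}(z)w_j=\theta(z+(j+1)\hbar)w_j .$$ Fix $n\ge 1$, $L=2n$ and $a_1,\dots,a_L\in\mathbb C\setminus(\mathbb Z+\mathbb Z\tau)$. Let $\mathbb V_L$ be the $\mathbb M$-vector space with basis $v_{\underline i}$, $\underline i\in\{\pm1\}^L$, $\sum_l i_l=0$; let $E_{\underline i\underline j}\in\operatorname{End}_{\mathbb M}(\mathbb V_L)$ be the elementary matrices ($v_{\underline k}\mapsto\delta_{\underline j\underline k}v_{\underline i}$), and let $T_\alpha$ ($\alpha\in\mathbb C$) be the operator $T_\alpha(g(x)v_{\underline i})=g(x-\alpha\hbar)v_{\underline i}$ on $\mathbb V_L$. Let $\mathcal R$ be the algebra of formal sums $\sum_\alpha p^\alpha T_\alpha A_\alpha$ with $A_\alpha\in\operatorname{End}_{\mathbb M}(\mathbb V_L)$ and $\alpha$ in a finite union of sets $s-2\mathbb Z_{\ge0}$, where the formal variables $p^\alpha$ are central and $p^\alpha p^\beta=p^{\alpha+\beta}$.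 The transfer matrix of $\mathcal W^\ell$ is $$t_{\mathcal W^\ell}(z;p)=\sum_{\alpha}p^\alpha T_\alpha\sum_{\underline i,\underline j}E_{\underline i\underline j}\operatorname{Tr}_{\mathcal W^\ell[\alpha]}\left(L_{i_1j_1}(z+a_1-\hbar)\cdots L_{i_Lj_L}(z+a_L-\hbar)\right)\in\mathcal R,$$ where $\alpha$ runs over the weights of $\mathcal W^\ell$ and $\mathcal W^\ell[\alpha]$ is the weight space. Put $Q(z;p):=t_{\mathcal W^{z/\hbar}}(0;p)$ and $\widetilde Q(z;p):=p^{-z/\hbar}\,T_{-z/\hbar}\,Q(z;p)$. **Theorem.** (i) For all $\ell,z\in\mathbb C$, $t_{\mathcal W^\ell}(z;p)$ commutes with $t_{\mathcal W^0}(z;p)$, $Q(z+\ell\hbar;p)$ commutes with $Q(z;p)$, and $$t_{\mathcal W^\ell}(z;p)\,Q(z;p)=Q(z+\ell\hbar;p)\,t_{\mathcal W^0}(z;p).$$ If moreover $z+a_l\notin\mathbb Z+\mathbb Z\tau$ for all $l$, then $t_{\mathcal W^0}(z;p)$ and $Q(z;p)$ are invertible in $\mathcal R$ and $$\frac{t_{\mathcal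 W^\ell}(z;p)}{t_{\mathcal W^0}(z;p)}=\frac{Q(z+\ell\hbar;p)}{Q(z;p)}.$$ (ii) If $a_1=\cdots=a_L=a$, then for all $z\in\mathbb C$ $$\widetilde Q(z+1;p)=(-1)^n\,\widetilde Q(z;p),\qquad \widetilde Q(z+\tau;p)=(-1)^n e^{-n\pi i(\tau+2z+2a)}\,\widetilde Q(z;p).$$ -/

import Mathlib

open Filter
open scoped UpperHalfPlane

noncomputable section

namespace EllipticSl2

/-- Meromorphic functions on `ℂ`, two functions being identified when they agree off a closed
discrete set. -/
def meroSubring : Subring (Germ (codiscrete ℂ) ℂ) where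
  carrier := {φ | ∃ f : ℂ → ℂ, Meromorphic f ∧ φ = (f : Germ (codiscrete ℂ) ℂ)}
  mul_mem' := by
    rintro _ _ ⟨f, hf, rfl⟩ ⟨g, hg, rfl⟩
    exact ⟨f * g, hf.mul hg, rfl⟩
  one_mem' := ⟨fun _ => 1, Meromorphic.const 1, rfl⟩
  add_mem' := by
    rintro _ _ ⟨f, hf, rfl⟩ ⟨g, hg, rfl⟩
    exact ⟨f + g, hf.add hg, rfl⟩
  zero_mem' := ⟨fun _ => 0, Meromorphic.const 0, rfl⟩
  neg_mem' := by
    rintro _ ⟨f, hf, rfl⟩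
    exact ⟨-f, hf.neg, rfl⟩

/-- A meromorphic function is either zero or nonzero off a closed discrete set. -/
theorem meromorphic_zero_or {f : ℂ → ℂ} (hf : Meromorphic f) :
    (∀ᶠ x in codiscrete ℂ, f x = 0) ∨ ∀ᶠ x in codiscrete ℂ, f x ≠ 0 := by
  by_cases h : ∃ u : (Set.univ : Set ℂ), meromorphicOrderAt f u ≠ ⊤
  · right
    have h2 := (MeromorphicOn.exists_meromorphicOrderAt_ne_top_iff_forall
      (hf.meromorphicOn (s := Set.univ)) isConnected_univ).1 h
    exact MeromorphicOn.eventually_codiscreteWithin_apply_ne_zero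
      (hf.meromorphicOn (s := Set.univ)) (fun x hx => h2 ⟨x, hx⟩)
  · left
    push Not at h
    rw [eventually_iff, mem_codiscrete]
    intro x
    rw [disjoint_principal_right, compl_compl]
    exact meromorphicOrderAt_eq_top_iff.1 (h ⟨x, trivial⟩)

instance : NeBot (codiscrete ℂ) := by
  rw [neBot_iff]
  intro h
  have : (∅ : Set ℂ) ∈ codiscrete ℂ := by rw [h]; trivial
  rw [mem_codiscrete] at this
  have := this 0
  simp only [Set.compl_empty, principal_univ, disjoint_top] at this
  exact (NormedField.nhdsNE_neBot (0 : ℂ)).ne this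

/-- The field of meromorphic functions on `ℂ`. -/
def Mero : Type := meroSubring

namespace Mero

instance : CommRing Mero := inferInstanceAs (CommRing meroSubring)

instance : Nontrivial Mero := inferInstanceAs (Nontrivial meroSubring)

/-- The class of a meromorphic function. -/
def mk (f : ℂ → ℂ) (hf : Meromorphic f) : Mero := ⟨(f : Germ (codiscrete ℂ) ℂ), f, hf, rfl⟩

theorem exists_mk (g : Mero) : ∃ (f : ℂ → ℂ) (hf : Meromorphic f), g = mk f hf := by
  obtain ⟨_, f, hf, rfl⟩ := g
  exact ⟨f, hf, rfl⟩

theorem mk_eq_iff {f g : ℂ → ℂ} {hf : Meromorphic f} {hg : Meromorphic g} :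
    mk f hf = mk g hg ↔ ∀ᶠ x in codiscrete ℂ, f x = g x :=
  Subtype.ext_iff.trans Germ.coe_eq

instance : Inv Mero :=
  ⟨fun g => ⟨g.1⁻¹, by
    obtain ⟨_, f, hf, rfl⟩ := g
    exact ⟨f⁻¹, hf.inv, rfl⟩⟩⟩

theorem inv_mk (f : ℂ → ℂ) (hf : Meromorphic f) : (mk f hf)⁻¹ = mk f⁻¹ hf.inv := rfl

theorem mul_inv_cancel (g : Mero) (hg : g ≠ 0) : g * g⁻¹ = 1 := by
  obtain ⟨f, hm, rfl⟩ := g.exists_mk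
  change mk (f * f⁻¹) (hm.mul hm.inv) = mk (fun _ => 1) (Meromorphic.const 1)
  rw [mk_eq_iff]
  rcases meromorphic_zero_or hm with h0 | h0
  · exact absurd (mk_eq_iff (hg := Meromorphic.const 0).2 h0) hg
  · filter_upwards [h0] with x hx
    simp [hx]

theorem inv_zero : (0 : Mero)⁻¹ = 0 := by
  change mk (fun _ => 0)⁻¹ (Meromorphic.const 0).inv = mk (fun _ => 0) (Meromorphic.const 0)
  rw [mk_eq_iff]
  filter_upwards with x
  simp

instance : Field Mero where
  mul_inv_cancel := mul_inv_cancel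
  inv_zero := inv_zero
  nnqsmul := _
  nnqsmul_def := fun _ _ => rfl
  qsmul := _
  qsmul_def := fun _ _ => rfl

/-- Constant functions. -/
def const : ℂ →+* Mero where
  toFun c := mk (fun _ => c) (Meromorphic.const c)
  map_one' := rfl
  map_mul' _ _ := rfl
  map_zero' := rfl
  map_add' _ _ := rfl

instance : Algebra ℂ Mero := const.toAlgebra

theorem tendsto_add_codiscrete (c : ℂ) :
    Tendsto (fun x : ℂ => x + c) (codiscrete ℂ) (codiscrete ℂ) := by
  intro s hs
  rw [mem_map, mem_codiscrete]
  rw [mem_codiscrete] at hs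
  intro x
  have := hs (x + c)
  rw [disjoint_principal_right, compl_compl] at this ⊢
  have h2 : Tendsto (fun x : ℂ => x + c) (nhdsWithin x {x}ᶜ) (nhdsWithin (x + c) {x + c}ᶜ) := by
    refine tendsto_nhdsWithin_iff.2 ⟨?_, ?_⟩
    · exact ((continuous_add_const c).tendsto x).mono_left nhdsWithin_le_nhds
    · filter_upwards [self_mem_nhdsWithin] with y hy
      simpa using hy
  exact h2 this

/-- `shift c` sends `g(x)` to `g(x + c)`. -/
def shift (c : ℂ) : Mero →ₐ[ℂ] Mero where
  toFun g := ⟨g.1.compTendsto (fun x => x + c) (tendsto_add_codiscrete c), by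
    obtain ⟨_, f, hf, rfl⟩ := g
    exact ⟨f ∘ (fun x => x + c), Meromorphic.meromorphic_fun_comp_add_const_iff_meromorphic.2 hf, rfl⟩⟩
  map_one' := rfl
  map_mul' := by
    rintro ⟨_, f, hf, rfl⟩ ⟨_, g, hg, rfl⟩
    rfl
  map_zero' := rfl
  map_add' := by
    rintro ⟨_, f, hf, rfl⟩ ⟨_, g, hg, rfl⟩
    rfl
  commutes' _ := rfl

theorem shift_mk (c : ℂ) (f : ℂ → ℂ) (hf : Meromorphic f) :
    shift c (mk f hf) =
      mk (fun x => f (x + c)) (Meromorphic.meromorphic_fun_comp_add_const_iff_meromorphic.2 hf) :=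
  rfl

theorem shift_shift (c d : ℂ) (g : Mero) : shift c (shift d g) = shift (c + d) g := by
  obtain ⟨f, hf, rfl⟩ := g.exists_mk
  simp only [shift_mk, add_assoc]

theorem shift_zero (g : Mero) : shift 0 g = g := by
  obtain ⟨f, hf, rfl⟩ := g.exists_mk
  simp only [shift_mk, add_zero]

end Mero

/-- The Jacobi theta function `θ(z)` with modular parameter `τ`. -/
def theta (τ : ℍ) (z : ℂ) : ℂ :=
  -∑' j : ℤ, Complex.exp (Complex.I * Real.pi * ((j : ℂ) + 1 / 2) ^ 2 * τ
    + 2 * Complex.I * Real.pi * ((j : ℂ) + 1 / 2) * (z + 1 / 2))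

theorem theta_eq (τ : ℍ) (z : ℂ) :
    theta τ z = -(Complex.exp (Complex.I * Real.pi * (τ / 4 + z + 1 / 2)) *
      jacobiTheta₂ (z + 1 / 2 + τ / 2) τ) := by
  rw [theta, jacobiTheta₂, ← tsum_mul_left]
  congr 2
  ext j
  rw [jacobiTheta₂_term, ← Complex.exp_add]
  congr 1
  ring

theorem differentiable_theta (τ : ℍ) : Differentiable ℂ (theta τ) := by
  have : theta τ = fun z => -(Complex.exp (Complex.I * Real.pi * (τ / 4 + z + 1 / 2)) *
      jacobiTheta₂ (z + 1 / 2 + τ / 2) τ) := funext (theta_eq τ)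
  rw [this]
  intro z
  have h := differentiableAt_jacobiTheta₂_fst (z + 1 / 2 + τ / 2) τ.im_pos
  have h2 : DifferentiableAt ℂ (fun z : ℂ => jacobiTheta₂ (z + 1 / 2 + τ / 2) τ) z :=
    DifferentiableAt.comp (g := fun w : ℂ => jacobiTheta₂ w τ) z h
      (by fun_prop : DifferentiableAt ℂ (fun z : ℂ => z + 1 / 2 + τ / 2) z)
  exact ((by fun_prop : DifferentiableAt ℂ (fun z : ℂ =>
    Complex.exp (Complex.I * Real.pi * (τ / 4 + z + 1 / 2))) z).mul h2).neg

theorem meromorphic_theta_comp (τ : ℍ) {f : ℂ → ℂ} (hf : Differentiable ℂ f) :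
    Meromorphic (fun x => theta τ (f x)) := fun x =>
  (((differentiable_theta τ).comp hf).analyticAt x).meromorphicAt

/-! ### Difference operators and representations -/

/-- `Φ` belongs to the component of bidegree `(α, β)` of the algebra of difference operators on
the graded vector space `X = ⊕ wt γ`: it maps weight `γ` to weight `γ + β - α`, and
`Φ (g(x) v) = g(x + β ħ) Φ(v)`. -/
def IsDiffOp (ħ : ℂ) {X : Type} [AddCommGroup X] [Module ℂ X] [Module Mero X]
    (wt : ℂ → Submodule Mero X) (α β : ℂ) (Φ : Module.End ℂ X) : Prop :=
  (∀ γ, ∀ v ∈ wt γ, Φ v ∈ wt (γ + β - α)) ∧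
    ∀ (g : Mero) (v : X), Φ (g • v) = Mero.shift (β * ħ) g • Φ v

section IsDiffOp

variable {ħ : ℂ} {X : Type} [AddCommGroup X] [Module ℂ X] [Module Mero X]
  {wt : ℂ → Submodule Mero X}

theorem IsDiffOp.one : IsDiffOp ħ wt 0 0 1 :=
  ⟨fun γ v hv => by simpa using hv, fun g v => by simp [Mero.shift_zero]⟩

theorem IsDiffOp.mul {α β α' β' : ℂ} {Φ Ψ : Module.End ℂ X} (hΦ : IsDiffOp ħ wt α β Φ)
    (hΨ : IsDiffOp ħ wt α' β' Ψ) : IsDiffOp ħ wt (α + α') (β + β') (Φ * Ψ) := by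
  refine ⟨fun γ v hv => ?_, fun g v => ?_⟩
  · have := hΦ.1 _ _ (hΨ.1 _ _ hv)
    rwa [show γ + β' - α' + β - α = γ + (β + β') - (α + α') by ring] at this
  · simp only [Module.End.mul_apply]
    rw [hΨ.2, hΦ.2, Mero.shift_shift, add_mul]

theorem IsDiffOp.prod_ofFn {m : ℕ} (α β : Fin m → ℂ) (Φ : Fin m → Module.End ℂ X)
    (h : ∀ l, IsDiffOp ħ wt (α l) (β l) (Φ l)) :
    IsDiffOp ħ wt (∑ l, α l) (∑ l, β l) (List.ofFn Φ).prod := by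
  induction m with
  | zero => simpa using IsDiffOp.one
  | succ m ih =>
    rw [List.ofFn_succ, List.prod_cons, Fin.sum_univ_succ, Fin.sum_univ_succ]
    exact (h 0).mul (ih _ _ _ fun l => h l.succ)

/-- The restriction to the weight space `X[γ]` of an operator of bidegree `(0, 0)`; it is linear
over the field of meromorphic functions. -/
def IsDiffOp.restrict {Φ : Module.End ℂ X} (h : IsDiffOp ħ wt 0 0 Φ) (γ : ℂ) :
    Module.End Mero (wt γ) where
  toFun v := ⟨Φ v, by simpa using h.1 γ v v.2⟩
  map_add' v w := by ext; simp
  map_smul' g v := by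
    ext
    simp [h.2, Mero.shift_zero]

end IsDiffOp

/-- A graded vector space `X = ⊕ X[α]` over the field of meromorphic functions, together with
operators `L_{ij}(z)` of bidegree `(i, j)` for `i, j ∈ {±1}`, such that the weight spaces are
finite-dimensional and the weights lie in a finite union of sets `s - 2ℕ`. These are the data
of a representation of the elliptic quantum group that enter its transfer matrix. -/
structure LModule (ħ : ℂ) where
  carrier : Type
  [addCommGroup : AddCommGroup carrier]
  [moduleComplex : Module ℂ carrier]
  [moduleMero : Module Mero carrier]
  [tower : IsScalarTower ℂ Mero carrier]
  wt : ℂ → Submodule Mero carrier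
  internal : DirectSum.IsInternal wt
  finite : ∀ α, Module.Finite Mero (wt α)
  bounded : ∃ S : Finset ℂ, ∀ α, wt α ≠ ⊥ → ∃ s ∈ S, ∃ k : ℕ, α = s - 2 * k
  L : ℤˣ → ℤˣ → ℂ → Module.End ℂ carrier
  L_mem : ∀ (i j : ℤˣ) (z : ℂ), IsDiffOp ħ wt ((i : ℤ) : ℂ) ((j : ℤ) : ℂ) (L i j z)

attribute [instance] LModule.addCommGroup LModule.moduleComplex LModule.moduleMero LModule.tower

/-! ### The asymptotic representations -/

section Asymptotic

variable (τ : ℍ) (ħ ℓ z : ℂ)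

/-- Coefficient of `w_j` in `L_{++}(z) w_j`. -/
def coeffPP (j : ℕ) : Mero :=
  Mero.mk (fun x => theta τ (z + (ℓ - j + 1) * ħ) * theta τ (x + (ℓ - j + 1) * ħ) *
      theta τ (x - j * ħ) / (theta τ x * theta τ (x + (ℓ - 2 * j + 1) * ħ)))
    ((((Meromorphic.const _).mul (meromorphic_theta_comp τ (by fun_prop))).mul
      (meromorphic_theta_comp τ (by fun_prop))).div
      ((meromorphic_theta_comp τ (by fun_prop)).mul (meromorphic_theta_comp τ (by fun_prop))))

/-- Coefficient of `w_{j+1}` in `L_{+-}(z) w_j`. -/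
def coeffPM (j : ℕ) : Mero :=
  Mero.mk (fun x => theta τ (z + x + (ℓ - j) * ħ) * theta τ ((ℓ - j) * ħ) /
      theta τ (x + (ℓ - 2 * j - 1) * ħ))
    (((meromorphic_theta_comp τ (by fun_prop)).mul (Meromorphic.const _)).div
      (meromorphic_theta_comp τ (by fun_prop)))

/-- Coefficient of `w_{j-1}` in `L_{-+}(z) w_j`, for `j ≥ 1`. -/
def coeffMP (j : ℕ) : Mero :=
  Mero.mk (fun x => -(theta τ (z - x + j * ħ) * theta τ (j * ħ) / theta τ x))
    (((meromorphic_theta_comp τ (by fun_prop)).mul (Meromorphic.const _)).div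
      (meromorphic_theta_comp τ (by fun_prop))).neg

/-- Coefficient of `w_j` in `L_{--}(z) w_j`. -/
def coeffMM (j : ℕ) : Mero :=
  Mero.mk (fun _ => theta τ (z + (j + 1) * ħ)) (Meromorphic.const _)

/-- The vector `L_{ik}(z) w_j`, where `(w_j)` is the standard basis of `ℕ →₀ Mero`. -/
def asymVec (i k : ℤˣ) (j : ℕ) : ℕ →₀ Mero :=
  if i = 1 then
    if k = 1 then Finsupp.single j (coeffPP τ ħ ℓ z j)
    else Finsupp.single (j + 1) (coeffPM τ ħ ℓ z j)
  else
    if k = 1 then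
      match j with
      | 0 => 0
      | j + 1 => Finsupp.single j (coeffMP τ ħ z (j + 1))
    else Finsupp.single j (coeffMM τ ħ z j)

/-- The operator `L_{ik}(z)`, sending `∑ g_j(x) w_j` to `∑ g_j(x + k ħ) L_{ik}(z) w_j`. -/
def asymL (i k : ℤˣ) : Module.End ℂ (ℕ →₀ Mero) :=
  Finsupp.lsum ℂ fun j =>
    ((LinearMap.toSpanSingleton Mero _ (asymVec τ ħ ℓ z i k j)).restrictScalars ℂ) ∘ₗ
      (Mero.shift (((k : ℤ) : ℂ) * ħ)).toLinearMap

theorem asymL_apply (i k : ℤˣ) (v : ℕ →₀ Mero) :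
    asymL τ ħ ℓ z i k v =
      v.sum fun j g => Mero.shift (((k : ℤ) : ℂ) * ħ) g • asymVec τ ħ ℓ z i k j := by
  simp only [asymL, Finsupp.lsum_apply]
  rfl

/-- The weight space of weight `α`, spanned by the `w_j` with `ℓ - 2j = α`. -/
def asymWt (α : ℂ) : Submodule Mero (ℕ →₀ Mero) :=
  Finsupp.supported Mero Mero {j : ℕ | ℓ - 2 * j = α}

theorem asymVec_mem (i k : ℤˣ) (j : ℕ) :
    asymVec τ ħ ℓ z i k j ∈ asymWt ℓ (ℓ - 2 * j + ((k : ℤ) : ℂ) - ((i : ℤ) : ℂ)) := by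
  rcases Int.units_eq_one_or i with rfl | rfl <;> rcases Int.units_eq_one_or k with rfl | rfl
  · simp only [asymVec, if_true]
    exact Finsupp.single_mem_supported _ _ (by simp)
  · simp only [asymVec, if_true, if_neg (by decide : ¬((-1 : ℤˣ) = 1))]
    exact Finsupp.single_mem_supported _ _ (by simp; ring)
  · simp only [asymVec, if_true, if_neg (by decide : ¬((-1 : ℤˣ) = 1))]
    cases j with
    | zero => exact Submodule.zero_mem _
    | succ j => exact Finsupp.single_mem_supported _ _ (by simp; ring)
  · simp only [asymVec, if_neg (by decide : ¬((-1 : ℤˣ) = 1))]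
    exact Finsupp.single_mem_supported _ _ (by simp)

theorem asymL_isDiffOp (i k : ℤˣ) :
    IsDiffOp ħ (asymWt ℓ) ((i : ℤ) : ℂ) ((k : ℤ) : ℂ) (asymL τ ħ ℓ z i k) := by
  refine ⟨fun γ v hv => ?_, fun g v => ?_⟩
  · rw [asymL_apply]
    refine Submodule.sum_mem _ fun j hj => Submodule.smul_mem _ _ ?_
    have hγ : ℓ - 2 * j = γ := (Finsupp.mem_supported _ _).1 hv hj
    rw [← hγ]
    exact asymVec_mem τ ħ ℓ z i k j
  · rw [asymL_apply, asymL_apply, Finsupp.sum_smul_index (by simp), Finsupp.smul_sum]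
    refine Finsupp.sum_congr fun j _ => ?_
    rw [map_mul, mul_smul]

theorem asymWt_internal : DirectSum.IsInternal (asymWt ℓ) := by
  refine DirectSum.isInternal_submodule_of_iSupIndep_of_iSup_eq_top ?_ ?_
  · intro α
    have h : (⨆ β, ⨆ (_ : β ≠ α), asymWt ℓ β) ≤
        Finsupp.supported Mero Mero {j : ℕ | ℓ - 2 * j ≠ α} :=
      iSup₂_le fun β hβ => Finsupp.supported_mono fun j (hj : ℓ - 2 * j = β) h => hβ (hj ▸ h)
    exact (Finsupp.disjoint_supported_supported
      (Set.disjoint_left.2 fun (j : ℕ) (hj : ℓ - 2 * j = α) (hj' : ℓ - 2 * j ≠ α) =>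
        hj' hj)).mono_right h
  · rw [eq_top_iff]
    rintro v -
    induction v using Finsupp.induction_linear with
    | zero => exact Submodule.zero_mem _
    | add v w hv hw => exact Submodule.add_mem _ hv hw
    | single j g =>
      exact Submodule.mem_iSup_of_mem (ℓ - 2 * (j : ℂ))
        (Finsupp.single_mem_supported _ _ (by simp))

theorem asymWt_finite (α : ℂ) : Module.Finite Mero (asymWt ℓ α) := by
  have hs : {j : ℕ | ℓ - 2 * j = α}.Subsingleton := by
    intro j hj k hk
    have : (j : ℂ) = k := by
      have h : ℓ - 2 * (j : ℂ) = ℓ - 2 * (k : ℂ) := hj.trans hk.symm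
      linear_combination (-1 / 2 : ℂ) * h
    exact_mod_cast this
  have := hs.finite.to_subtype
  exact Module.Finite.equiv (Finsupp.supportedEquivFinsupp {j : ℕ | ℓ - 2 * j = α}).symm

/-- The asymptotic representation of spin parameter `ℓ` (and spectral parameter `0`). -/
def asymptoticRep : LModule ħ where
  carrier := ℕ →₀ Mero
  wt := asymWt ℓ
  internal := asymWt_internal ℓ
  finite := asymWt_finite ℓ
  bounded := by
    refine ⟨{ℓ}, fun α hα => ⟨ℓ, by simp, ?_⟩⟩
    by_contra! h
    refine hα ?_
    rw [asymWt, Set.eq_empty_of_forall_notMem (s := {j : ℕ | ℓ - 2 * j = α})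
      fun j hj => h j hj.symm, Finsupp.supported_empty]
  L i k z := asymL τ ħ ℓ z i k
  L_mem i k z := asymL_isDiffOp τ ħ ℓ z i k

end Asymptotic

/-! ### The ring of formal difference operators -/

/-- The sequences of `N` signs whose sum is zero. -/
abbrev BalancedSigns (N : ℕ) : Type := {i : Fin N → ℤˣ // ∑ l, ((i l : ℤˣ) : ℤ) = 0}

/-- The zero weight space of the `N`-th tensor power of the two-dimensional graded space with
basis `v_+, v_-`: the basis vectors are `v_i = v_{i_1} ⊗ ⋯ ⊗ v_{i_N}` with `i_1 + ⋯ + i_N = 0`. -/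
abbrev SpinSpace (N : ℕ) : Type := BalancedSigns N → Mero

/-- The difference operator `T_α`, with `T_α (g(x) v_i) = g(x - α ħ) v_i`. -/
def shiftOp (ħ : ℂ) (N : ℕ) (α : ℂ) : Module.End ℂ (SpinSpace N) :=
  LinearMap.pi fun i => (Mero.shift (-α * ħ)).toLinearMap ∘ₗ LinearMap.proj i

section Series

open scoped ComplexOrder

/-- The weights occurring in a formal series: finite unions of sets `s - 2ℕ`. -/
def weightCone (S : Finset ℂ) : Set ℂ := {α | ∃ s ∈ S, ∃ k : ℕ, α = s - 2 * k}

/-- The algebra of formal sums `∑_α p^α B_α`, where `α` runs over a finite union of sets `s - 2ℕ`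
and `B_α = T_α A_α` with `A_α` linear over the field of meromorphic functions; equivalently,
`B_α` is a difference operator with `B_α (g(x) v) = g(x - α ħ) B_α(v)`. The formal variables
commute with the operators and `p^α p^β = p^{α+β}`.
It is realised inside the algebra of Hahn series in the exponent `α`. The order dual of `ℂ` is
used because real parts of exponents are bounded above, not below. -/
def DynSeries (ħ : ℂ) (N : ℕ) : Subalgebra ℂ (HahnSeries ℂᵒᵈ (Module.End ℂ (SpinSpace N))) where
  carrier := {f |
    (∃ S : Finset ℂ, ∀ α, f.coeff (OrderDual.toDual α) ≠ 0 → α ∈ weightCone S) ∧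
      ∀ (α : ℂ) (g : Mero) (v : SpinSpace N), f.coeff (OrderDual.toDual α) (g • v) =
        Mero.shift (-α * ħ) g • f.coeff (OrderDual.toDual α) v}
  mul_mem' := by
    rintro f g ⟨⟨S, hS⟩, hf⟩ ⟨⟨S', hS'⟩, hg⟩
    refine ⟨⟨Finset.image₂ (· + ·) S S', fun α hα => ?_⟩, fun α c v => ?_⟩
    · rw [HahnSeries.coeff_mul] at hα
      obtain ⟨⟨β, γ⟩, hβγ, -⟩ := Finset.exists_ne_zero_of_sum_ne_zero hα
      rw [Finset.mem_antidiagonal] at hβγ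
      obtain ⟨h1, h2, h3⟩ := hβγ
      obtain ⟨s, hs, k, hk⟩ := hS (OrderDual.ofDual β) h1
      obtain ⟨s', hs', k', hk'⟩ := hS' (OrderDual.ofDual γ) h2
      have h4 : OrderDual.ofDual β + OrderDual.ofDual γ = α := h3
      refine ⟨s + s', Finset.mem_image₂_of_mem hs hs', k + k', ?_⟩
      rw [← h4, hk, hk']
      push_cast
      ring
    · rw [HahnSeries.coeff_mul, LinearMap.sum_apply, LinearMap.sum_apply, Finset.smul_sum]
      refine Finset.sum_congr rfl fun βγ h => ?_
      obtain ⟨β, γ⟩ := βγ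
      rw [Finset.mem_antidiagonal] at h
      have h4 : OrderDual.ofDual β + OrderDual.ofDual γ = α := h.2.2
      simp only [Module.End.mul_apply]
      have hg' := hg (OrderDual.ofDual γ) c v
      have hf' := hf (OrderDual.ofDual β) (Mero.shift (-OrderDual.ofDual γ * ħ) c)
        (g.coeff γ v)
      simp only [OrderDual.toDual_ofDual] at hg' hf'
      rw [hg', hf', Mero.shift_shift, ← h4]
      congr 3
      ring
  add_mem' := by
    rintro f g ⟨⟨S, hS⟩, hf⟩ ⟨⟨S', hS'⟩, hg⟩
    classical
    refine ⟨⟨S ∪ S', fun α hα => ?_⟩, fun α c v => ?_⟩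
    · by_cases h : f.coeff (OrderDual.toDual α) = 0
      · have h' : g.coeff (OrderDual.toDual α) ≠ 0 := by simpa [h] using hα
        obtain ⟨s, hs, k⟩ := hS' α h'
        exact ⟨s, Finset.mem_union_right _ hs, k⟩
      · obtain ⟨s, hs, k⟩ := hS α h
        exact ⟨s, Finset.mem_union_left _ hs, k⟩
    · simp only [HahnSeries.coeff_add, LinearMap.add_apply, hf, hg, smul_add]
  algebraMap_mem' r := by
    have hc : ∀ α : ℂ, (algebraMap ℂ (HahnSeries ℂᵒᵈ (Module.End ℂ (SpinSpace N))) r).coeff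
        (OrderDual.toDual α) = if α = 0 then algebraMap ℂ _ r else 0 := by
      intro α
      rw [HahnSeries.algebraMap_apply, HahnSeries.C_apply, HahnSeries.coeff_single]
      rfl
    refine ⟨⟨{0}, fun α hα => ⟨0, by simp, 0, ?_⟩⟩, fun α c v => ?_⟩
    · rw [hc] at hα
      have := (ite_ne_right_iff.1 hα).1
      simpa using this
    · rw [hc]
      split_ifs with h
      · simp [h, Mero.shift_zero, Module.algebraMap_end_apply, smul_comm r c v]
      · simp

theorem weightCone_isPWO (S : Finset ℂ) :
    {α : ℂᵒᵈ | OrderDual.ofDual α ∈ weightCone S}.IsPWO := by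
  have : {α : ℂᵒᵈ | OrderDual.ofDual α ∈ weightCone S} =
      ⋃ s ∈ S, Set.range fun k : ℕ => OrderDual.toDual (s - 2 * (k : ℂ)) := by
    ext α
    simp only [weightCone, Set.mem_ofPred_eq, Set.mem_iUnion, Set.mem_range]
    constructor
    · rintro ⟨s, hs, k, hk⟩
      exact ⟨s, hs, k, congrArg OrderDual.toDual hk.symm⟩
    · rintro ⟨s, hs, k, hk⟩
      exact ⟨s, hs, k, congrArg OrderDual.ofDual hk.symm⟩
  rw [this]
  refine S.isPWO_bUnion.2 fun s _ => ?_
  rw [← Set.image_univ]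
  refine Set.IsPWO.image_of_monotone ?_ ?_
  · exact Set.IsPWO.of_linearOrder _
  · intro k l hkl
    have : (k : ℝ) ≤ l := by exact_mod_cast hkl
    refine OrderDual.toDual_le_toDual.2 ?_
    rw [Complex.le_def]
    simp
    linarith

/-- The formal series with given coefficients. -/
def DynSeries.mk {ħ : ℂ} {N : ℕ} (B : ℂ → Module.End ℂ (SpinSpace N))
    (hB : ∃ S : Finset ℂ, ∀ α, B α ≠ 0 → α ∈ weightCone S)
    (hB' : ∀ (α : ℂ) (g : Mero) (v : SpinSpace N),
      B α (g • v) = Mero.shift (-α * ħ) g • B α v) : DynSeries ħ N :=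
  ⟨{ coeff := fun α => B (OrderDual.ofDual α)
     isPWO_support' := by
      obtain ⟨S, hS⟩ := hB
      exact (weightCone_isPWO S).mono fun α hα => hS _ hα }, hB, hB'⟩

theorem shiftOp_smul (ħ : ℂ) (N : ℕ) (α : ℂ) (g : Mero) (v : SpinSpace N) :
    shiftOp ħ N α (g • v) = Mero.shift (-α * ħ) g • shiftOp ħ N α v := by
  ext i
  simp [shiftOp]

/-- The element `p^α T_α`. -/
def pT (ħ : ℂ) (N : ℕ) (α : ℂ) : DynSeries ħ N :=
  DynSeries.mk (fun β => if β = α then shiftOp ħ N α else 0)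
    ⟨{α}, fun β hβ => ⟨α, by simp, 0, by simpa using (ite_ne_right_iff.1 hβ).1⟩⟩
    fun β g v => by
      split_ifs with h
      · rw [h, shiftOp_smul]
      · simp

end Series

/-! ### Transfer matrices -/

section Transfer

variable {ħ : ℂ} {N : ℕ}

/-- The product `L_{i_1 j_1}(z + a_1 - ħ) ⋯ L_{i_N j_N}(z + a_N - ħ)`. -/
def LModule.monodromy (X : LModule ħ) (a : Fin N → ℂ) (z : ℂ) (i j : Fin N → ℤˣ) :
    Module.End ℂ X.carrier :=
  (List.ofFn fun l => X.L (i l) (j l) (z + a l - ħ)).prod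

theorem LModule.monodromy_isDiffOp (X : LModule ħ) (a : Fin N → ℂ) (z : ℂ)
    (i j : BalancedSigns N) : IsDiffOp ħ X.wt 0 0 (X.monodromy a z i.1 j.1) := by
  have h := IsDiffOp.prod_ofFn (fun l => ((i.1 l : ℤ) : ℂ)) (fun l => ((j.1 l : ℤ) : ℂ)) _
    fun l => X.L_mem (i.1 l) (j.1 l) (z + a l - ħ)
  have hi : ∑ l, ((i.1 l : ℤ) : ℂ) = 0 := by exact_mod_cast i.2
  have hj : ∑ l, ((j.1 l : ℤ) : ℂ) = 0 := by exact_mod_cast j.2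
  rwa [hi, hj] at h

/-- The matrix of traces over the weight space `X[α]` of the operators `L_{ij}(z)`. -/
def LModule.traceMatrix (X : LModule ħ) (a : Fin N → ℂ) (z α : ℂ) :
    Matrix (BalancedSigns N) (BalancedSigns N) Mero :=
  fun i j => LinearMap.trace Mero (X.wt α) ((X.monodromy_isDiffOp a z i j).restrict α)

/-- The transfer matrix `t_X(z;p) = ∑_α p^α T_α ∑_{i,j} E_{ij} Tr_{X[α]} L_{ij}(z)`. -/
def transferMatrix (X : LModule ħ) (a : Fin N → ℂ) (z : ℂ) : DynSeries ħ N :=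
  DynSeries.mk
    (fun α => shiftOp ħ N α * (Matrix.toLin' (X.traceMatrix a z α)).restrictScalars ℂ)
    (by
      obtain ⟨S, hS⟩ := X.bounded
      refine ⟨S, fun α hα => hS α fun h => hα ?_⟩
      have : X.traceMatrix a z α = 0 := by
        ext i j
        have : Subsingleton (X.wt α) := by rw [h]; infer_instance
        change LinearMap.trace Mero (X.wt α) _ = 0
        rw [Subsingleton.elim (IsDiffOp.restrict _ α) 0, map_zero]
      rw [this, map_zero]
      ext
      simp)
    fun α g v => by
      simp only [Module.End.mul_apply, LinearMap.restrictScalars_apply, map_smul, shiftOp_smul]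

/-- The transfer matrix of the asymptotic representation of spin parameter `ℓ`. -/
def asymTransfer (τ : ℍ) (ħ : ℂ) (a : Fin N → ℂ) (ℓ z : ℂ) : DynSeries ħ N :=
  transferMatrix (asymptoticRep τ ħ ℓ) a z

/-- The Baxter Q-operator. -/
def baxterQ (τ : ℍ) (ħ : ℂ) (a : Fin N → ℂ) (z : ℂ) : DynSeries ħ N :=
  asymTransfer τ ħ a (z / ħ) 0

/-- The normalised Q-operator `p^{-z/ħ} T_{-z/ħ} Q(z;p)`. -/
def baxterQNorm (τ : ℍ) (ħ : ℂ) (a : Fin N → ℂ) (z : ℂ) : DynSeries ħ N :=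
  pT ħ N (-(z / ħ)) * baxterQ τ ħ a z

end Transfer

end EllipticSl2

end

open EllipticSl2

namespace EllipticSl2

/-! ### The theta function -/

section Theta

/-! Measured in units of `ħ`, the operators `L_{ik}(z)` on the asymptotic representation depend on
two numbers `U = z/ħ` and `V = z/ħ + ℓ`, which play nearly symmetric roles. A transfer matrix is
thus labelled by a pair `(U, V)`, and all the commutation relations in (i) say that a product
labelled `(U, V), (U', V')` is unchanged when either `V, V'` or `U, U'` are exchanged. Up to a
common offset, `t_{W^ℓ}(z)` has label `(z/ħ, z/ħ + ℓ)` and `Q(z)` has label `(0, z/ħ)`. Exchanging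
the second parameters gives the two commutation statements, and exchanging the first parameters
turns `t_{W^ℓ}(z) Q(z)` into `Q(z + ℓħ) t_{W^0}(z)`.

A product of transfer matrices is the transfer matrix of a tensor product, because moving `T_β` past
a matrix produces exactly the dynamical shift of the coproduct (`isRep_transferProd`). The exchange
of `V, V'` comes from an explicit operator `sop` that intertwines the two tensor products
(`sop_top`). Its coefficients are products of theta functions, and each intertwining relation
reduces to a four-term partial fraction identity (`IsBracket.fourTerm`), itself a consequence of the
three-term identity. The operator is triangular, and invertible for generic `U`, so the traces agree
there and, by continuity in `U`, everywhere (`traceProd_exchange`). Genericity really has to be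
removed: it fails for `ℓ = 0`. A reflection `x ↦ -(x + weight)` sends `(U, V)` to `(-V - 2, -U - 2)`
and so converts the exchange of second parameters into that of first parameters (`traceProd_refl`,
`traceProd_exchange'`).

For invertibility, a transfer matrix is `p^ℓ` times a power series in `p^{-2}`, so only the leading
coefficient matters. It is triangular for a suitable weight on sign sequences, with products of
theta values on the diagonal (`suffixWeight_of_mon_ne_zero`, `monCoeff_zero_diag`). These are
nonzero since theta vanishes only on the lattice (`exists_int_of_theta_eq_zero`).

For (ii), translating `V` by a quasi-period multiplies each `L_{+k}` by a factor free of `x` and of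
the degree, and leaves `L_{-k}` alone (`lop_add_period`). A balanced sequence of length `2n` has
exactly `n` plus signs, which gives the `n`-th power of that factor. -/

theorem theta_add_one (τ : ℍ) (z : ℂ) : theta τ (z + 1) = -theta τ z := by
  rw [theta_eq, theta_eq, show z + 1 + 1 / 2 + (τ : ℂ) / 2 = (z + 1 / 2 + τ / 2) + 1 by ring,
    jacobiTheta₂_add_left,
    show Complex.I * Real.pi * ((τ : ℂ) / 4 + (z + 1) + 1 / 2) =
      Complex.I * Real.pi * ((τ : ℂ) / 4 + z + 1 / 2) + Real.pi * Complex.I by ring,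
    Complex.exp_add, Complex.exp_pi_mul_I]
  ring

theorem theta_add_tau (τ : ℍ) (z : ℂ) :
    theta τ (z + τ) = -Complex.exp (-(Complex.I * Real.pi * (τ + 2 * z))) * theta τ z := by
  rw [theta_eq, theta_eq, show z + τ + 1 / 2 + (τ : ℂ) / 2 = (z + 1 / 2 + τ / 2) + τ by ring,
    jacobiTheta₂_add_left']
  have h : Complex.exp (Complex.I * Real.pi * ((τ : ℂ) / 4 + (z + τ) + 1 / 2)) *
      Complex.exp (-Real.pi * Complex.I * (τ + 2 * (z + 1 / 2 + τ / 2))) =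
      -(Complex.exp (-(Complex.I * Real.pi * (τ + 2 * z))) *
        Complex.exp (Complex.I * Real.pi * ((τ : ℂ) / 4 + z + 1 / 2))) := by
    rw [← Complex.exp_add, ← Complex.exp_add, ← Complex.exp_sub_pi_mul_I]
    congr 1
    ring
  linear_combination (-jacobiTheta₂ (z + 1 / 2 + τ / 2) τ) * h

theorem theta_neg (τ : ℍ) (z : ℂ) : theta τ (-z) = -theta τ z := by
  rw [theta_eq, theta_eq]
  rw [show -z + 1 / 2 + (τ : ℂ) / 2 = -((z + 1 / 2 + τ / 2) - 1 - τ) by ring,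
    jacobiTheta₂_neg_left]
  have h1 := jacobiTheta₂_add_left ((z + 1 / 2 + τ / 2) - 1 - τ) τ
  have h2 := jacobiTheta₂_add_left' ((z + 1 / 2 + τ / 2) - τ) τ
  rw [show (z + 1 / 2 + (τ : ℂ) / 2) - 1 - τ + 1 = (z + 1 / 2 + τ / 2) - τ by ring] at h1
  rw [sub_add_cancel] at h2
  rw [← h1, h2]
  have h : Complex.exp (Complex.I * Real.pi * ((τ : ℂ) / 4 + z + 1 / 2)) *
      Complex.exp (-Real.pi * Complex.I * (τ + 2 * (z + 1 / 2 + τ / 2 - τ))) =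
      -Complex.exp (Complex.I * Real.pi * ((τ : ℂ) / 4 + -z + 1 / 2)) := by
    rw [← Complex.exp_add, ← Complex.exp_sub_pi_mul_I]
    congr 1
    ring
  linear_combination (-jacobiTheta₂ (z + 1 / 2 + τ / 2 - τ) τ) * h

/-- The even part in the expansion of a product of theta functions. -/
noncomputable def thetaEven (τ : ℍ) (x : ℂ) : ℂ := jacobiTheta₂ (2 * x) (2 * τ)

/-- The odd part in the expansion of a product of theta functions. -/
noncomputable def thetaOdd (τ : ℍ) (x : ℂ) : ℂ :=
  Complex.exp (Complex.I * Real.pi * (τ / 2 + 2 * x)) * jacobiTheta₂ (2 * x + τ) (2 * τ)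

/-- Pairs of integers, according to the parity of their difference. -/
noncomputable def intPairParity : (ℤ × ℤ) ⊕ (ℤ × ℤ) ≃ ℤ × ℤ :=
  Equiv.ofBijective (Sum.elim (fun p => (p.1 + p.2, p.1 - p.2 - 1)) fun p => (p.1 + p.2, p.1 - p.2))
    ⟨by
      rintro (⟨a, b⟩ | ⟨a, b⟩) (⟨c, d⟩ | ⟨c, d⟩) h <;>
        simp only [Sum.elim_inl, Sum.elim_inr, Prod.mk.injEq] at h <;>
        simp only [Sum.inl.injEq, Sum.inr.injEq, Prod.mk.injEq, reduceCtorEq] <;> omega, by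
      rintro ⟨j, k⟩
      rcases Int.even_or_odd' (j - k) with ⟨c, h | h⟩
      · exact ⟨Sum.inr (k + c, c), by simp only [Sum.elim_inr, Prod.mk.injEq]; omega⟩
      · exact ⟨Sum.inl (k + c + 1, c), by simp only [Sum.elim_inl, Prod.mk.injEq]; omega⟩⟩

theorem intPairParity_inl (p : ℤ × ℤ) :
    intPairParity (Sum.inl p) = (p.1 + p.2, p.1 - p.2 - 1) := rfl

theorem intPairParity_inr (p : ℤ × ℤ) :
    intPairParity (Sum.inr p) = (p.1 + p.2, p.1 - p.2) := rfl

/-- Multiply the two series and split the index pairs `(j, k)` by the parity of `j - k`. In terms of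
half-sum and half-difference the quadratic form `j² + k²` becomes diagonal, so each parity class
factors into a series in `x` times a series in `y`, both of modulus `2τ`. -/
theorem theta_mul_theta (τ : ℍ) (x y : ℂ) : theta τ (x + y) * theta τ (x - y) =
    thetaEven τ x * thetaOdd τ y - thetaOdd τ x * thetaEven τ y := by
  have s2 : ∀ z : ℂ, Summable fun n : ℤ => ‖jacobiTheta₂_term n z (2 * τ)‖ := fun z =>
    ((summable_jacobiTheta₂_term_iff z (2 * τ)).2 (by simpa using τ.im_pos)).norm
  have s1 : ∀ z : ℂ, Summable fun n : ℤ => ‖jacobiTheta₂_term n z τ‖ := fun z =>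
    ((summable_jacobiTheta₂_term_iff z τ).2 τ.im_pos).norm
  have hs := summable_mul_of_summable_norm (s1 (x + y + 1 / 2 + τ / 2)) (s1 (x - y + 1 / 2 + τ / 2))
  rw [theta_eq, theta_eq, thetaEven, thetaOdd, thetaEven, thetaOdd]
  have h1 : jacobiTheta₂ (x + y + 1 / 2 + τ / 2) τ * jacobiTheta₂ (x - y + 1 / 2 + τ / 2) τ = _ :=
    tsum_mul_tsum_of_summable_norm (s1 _) (s1 _)
  have h2 : jacobiTheta₂ (2 * x) (2 * τ) * jacobiTheta₂ (2 * y + τ) (2 * τ) = _ :=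
    tsum_mul_tsum_of_summable_norm (s2 _) (s2 _)
  have h3 : jacobiTheta₂ (2 * x + τ) (2 * τ) * jacobiTheta₂ (2 * y) (2 * τ) = _ :=
    tsum_mul_tsum_of_summable_norm (s2 _) (s2 _)
  rw [← intPairParity.tsum_eq] at h1
  have hs' := (intPairParity.summable_iff).2 hs
  have hl : Summable ((fun p : (ℤ × ℤ) ⊕ (ℤ × ℤ) => jacobiTheta₂_term (intPairParity p).1
      (x + y + 1 / 2 + τ / 2) τ * jacobiTheta₂_term (intPairParity p).2 (x - y + 1 / 2 + τ / 2) τ) ∘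
      Sum.inl) := hs'.comp_injective Sum.inl_injective
  have hr : Summable ((fun p : (ℤ × ℤ) ⊕ (ℤ × ℤ) => jacobiTheta₂_term (intPairParity p).1
      (x + y + 1 / 2 + τ / 2) τ * jacobiTheta₂_term (intPairParity p).2 (x - y + 1 / 2 + τ / 2) τ) ∘
      Sum.inr) := hs'.comp_injective Sum.inr_injective
  rw [Summable.tsum_sum hl hr] at h1
  have h4 : ∀ a b c d : ℂ, -(a * b) * -(c * d) = a * c * (b * d) := fun a b c d => by ring
  rw [h4, h1, mul_left_comm (jacobiTheta₂ (2 * x) (2 * τ)), h2,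
    mul_assoc _ _ (jacobiTheta₂ (2 * y) (2 * τ)), h3, mul_add, ← tsum_mul_left, ← tsum_mul_left,
    ← tsum_mul_left, ← tsum_mul_left]
  have h5 : ∀ a b c d : ℂ, a = c → b = -d → a + b = c - d := by
    rintro a b c d rfl rfl
    ring
  -- The shifts by `1/2` contribute `exp(πi(j + k + 1))` in total: this is `1` when `j - k` is odd
  -- and `-1` when it is even, whence the minus sign.
  refine h5 _ _ _ _ ?_ ?_
  · refine tsum_congr fun p => ?_
    obtain ⟨m, n⟩ := p
    simp only [intPairParity_inl, jacobiTheta₂_term,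
      ← Complex.exp_add]
    rw [Complex.exp_eq_exp_iff_exists_int]
    refine ⟨m, ?_⟩
    push_cast
    ring
  · rw [← tsum_neg]
    refine tsum_congr fun p => ?_
    obtain ⟨m, n⟩ := p
    simp only [intPairParity_inr, jacobiTheta₂_term,
      ← Complex.exp_add]
    rw [← neg_one_mul, ← Complex.exp_pi_mul_I, ← Complex.exp_add,
      Complex.exp_eq_exp_iff_exists_int]
    refine ⟨m, ?_⟩
    push_cast
    ring

/-- The three-term identity for an odd function. -/
def ThreeTerm (f : ℂ → ℂ) : Prop :=
  ∀ x y z w : ℂ, f (x + y) * f (x - y) * (f (z + w) * f (z - w)) -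
    f (x + z) * f (x - z) * (f (y + w) * f (y - w)) +
    f (x + w) * f (x - w) * (f (y + z) * f (y - z)) = 0

/-- Each product `θ(x + y) θ(x - y)` is a 2×2 determinant of the vectors (`thetaEven`, `thetaOdd`)
at `x` and `y`; the identity is the Plücker relation for four such vectors. -/
theorem theta_threeTerm (τ : ℍ) : ThreeTerm (theta τ) := by
  intro x y z w
  simp only [theta_mul_theta]
  ring

/-- Otherwise `jacobiTheta₂` vanishes identically, but its mean over a real period is the zeroth
Fourier coefficient, which is 1. -/
theorem exists_theta_ne_zero (τ : ℍ) : ∃ z, theta τ z ≠ 0 := by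
  by_contra! h
  have h0 : ∀ z, jacobiTheta₂ z τ = 0 := by
    intro z
    have := h (z - 1 / 2 - τ / 2)
    rw [theta_eq, neg_eq_zero, mul_eq_zero] at this
    rcases this with h | h
    · exact absurd h (Complex.exp_ne_zero _)
    · rwa [show z - 1 / 2 - (τ : ℂ) / 2 + 1 / 2 + τ / 2 = z by ring] at h
  let F : ℤ → C(ℝ, ℂ) := fun n =>
    ⟨fun t => jacobiTheta₂_term n (t : ℂ) τ, by unfold jacobiTheta₂_term; fun_prop⟩
  have hn : ∀ (n : ℤ) (t : ℝ), ‖jacobiTheta₂_term n (t : ℂ) τ‖ = ‖jacobiTheta₂_term n 0 τ‖ := by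
    intro n t
    rw [norm_jacobiTheta₂_term, norm_jacobiTheta₂_term]
    simp
  have hs : Summable fun n => ‖(F n).restrict (⟨Set.uIcc (0 : ℝ) 1, isCompact_uIcc⟩ :
      TopologicalSpace.Compacts ℝ)‖ := by
    refine Summable.of_nonneg_of_le (fun _ => norm_nonneg _) (fun n => ?_)
      ((summable_jacobiTheta₂_term_iff 0 τ).2 τ.im_pos).norm
    refine (ContinuousMap.norm_le _ (norm_nonneg _)).2 fun t => ?_
    exact (hn n t).le
  have hsum := intervalIntegral.hasSum_intervalIntegral_of_summable_norm (a := 0) (b := 1) hs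
  have hz : ∫ t in (0 : ℝ)..1, ∑' n, F n t = 0 := by
    have : ∀ t : ℝ, ∑' n, F n t = 0 := fun t => h0 t
    simp [this]
  rw [hz] at hsum
  have hI : ∀ n : ℤ, ∫ t in (0 : ℝ)..1, F n t = if n = 0 then 1 else 0 := by
    intro n
    change ∫ t in (0 : ℝ)..1, jacobiTheta₂_term n (t : ℂ) τ = _
    unfold jacobiTheta₂_term
    split_ifs with hn0
    · simp [hn0]
    · have hc : (2 * Real.pi * Complex.I * n : ℂ) ≠ 0 := by
        simp [Real.pi_ne_zero, hn0]
      simp_rw [Complex.exp_add]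
      rw [intervalIntegral.integral_mul_const, integral_exp_mul_complex hc]
      have : Complex.exp (2 * Real.pi * Complex.I * n * (1 : ℝ)) = 1 := by
        rw [Complex.exp_eq_one_iff]
        exact ⟨n, by push_cast; ring⟩
      rw [this]
      simp
  rw [funext hI] at hsum
  have h1 := hsum.unique (hasSum_ite_eq 0 (1 : ℂ))
  exact zero_ne_one h1

end Theta

/-! ### Countable exceptional sets -/

section Cocountable

/-- The points to be avoided later form countable unions of discrete sets, such as all integer
translates of the poles. The codiscrete filter is not stable under countable intersections; the
cocountable one is. -/
instance : CountableInterFilter (cocountable : Filter ℂ) :=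
  CardinalInterFilter.toCountableInterFilter _ (Cardinal.aleph0_lt_aleph_one)

theorem cocountable_le_codiscrete : (cocountable : Filter ℂ) ≤ codiscrete ℂ := by
  intro s hs
  rw [mem_codiscrete'] at hs
  rw [mem_cocountable]
  have : DiscreteTopology (sᶜ : Set ℂ) := hs.2.to_subtype
  exact Set.countable_coe_iff.1 (countable_of_Lindelof_of_discrete (X := (sᶜ : Set ℂ)))

theorem dense_of_mem_cocountable {s : Set ℂ} (hs : s ∈ (cocountable : Filter ℂ)) : Dense s := by
  rw [mem_cocountable] at hs
  simpa using hs.dense_compl ℂ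

instance : NeBot (cocountable : Filter ℂ) := by
  rw [neBot_iff]
  intro h
  have := dense_of_mem_cocountable (s := ∅) (by rw [h]; trivial)
  simpa using this.nonempty

theorem tendsto_cocountable_of_injective {g : ℂ → ℂ} (hg : Function.Injective g) :
    Tendsto g cocountable cocountable := by
  intro s hs
  rw [mem_map, mem_cocountable]
  rw [mem_cocountable] at hs
  exact hs.preimage hg

/-- Cocountable sets are dense. This is the tool for removing genericity assumptions by continuity.
-/
theorem eq_of_eventually_cocountable {g h : ℂ → ℂ} {x : ℂ} (hg : ContinuousAt g x)
    (hh : ContinuousAt h x) (H : ∀ᶠ y in cocountable, g y = h y) : g x = h x := by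
  have hd : x ∈ closure {y | g y = h y} := dense_of_mem_cocountable H x
  rw [mem_closure_iff_nhdsWithin_neBot] at hd
  refine tendsto_nhds_unique (f := g) (l := nhdsWithin x {y | g y = h y}) (hg.mono_left nhdsWithin_le_nhds)
    ((hh.mono_left nhdsWithin_le_nhds).congr' ?_)
  filter_upwards [self_mem_nhdsWithin] with y hy using hy.symm

theorem eventually_theta_ne_zero (τ : ℍ) : ∀ᶠ x in cocountable, theta τ x ≠ 0 := by
  rcases meromorphic_zero_or (meromorphic_theta_comp τ differentiable_id) with h | h
  · obtain ⟨z, hz⟩ := exists_theta_ne_zero τ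
    refine absurd (eq_of_eventually_cocountable (x := z) ?_ continuousAt_const
      (cocountable_le_codiscrete h)) hz
    exact (differentiable_theta τ).continuous.continuousAt
  · exact cocountable_le_codiscrete h

end Cocountable

/-! ### The zeros of the theta function -/

section Zeros

theorem eventually_theta_add_ne_zero (τ : ℍ) (c : ℂ) :
    ∀ᶠ x in cocountable, theta τ (x + c) ≠ 0 :=
  (tendsto_cocountable_of_injective (add_left_injective c)).eventually (eventually_theta_ne_zero τ)

/-- If `p` is a zero of the theta function, the quotient of `θ(s)` by `θ(s - p)` is
multiplicative. -/
theorem theta_quot_symm {τ : ℍ} {p : ℂ} (hp : theta τ p = 0) (s t h : ℂ) :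
    theta τ (s + h) * theta τ t * (theta τ (s - p) * theta τ (t + h - p)) =
      theta τ s * theta τ (t + h) * (theta τ (s + h - p) * theta τ (t - p)) := by
  -- The first two arguments differ by `p`, so the first of the three products contains `θ(p) = 0`
  -- and disappears.
  have := theta_threeTerm τ ((s + h + t) / 2) ((s + h + t) / 2 - p) ((s + h - t) / 2)
    ((s - t - h) / 2)
  rw [show (s + h + t) / 2 - ((s + h + t) / 2 - p) = p by ring, hp,
    show (s + h + t) / 2 + (s + h - t) / 2 = s + h by ring,
    show (s + h + t) / 2 - (s + h - t) / 2 = t by ring,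
    show (s + h + t) / 2 - p + (s - t - h) / 2 = s - p by ring,
    show (s + h + t) / 2 - p - (s - t - h) / 2 = t + h - p by ring,
    show (s + h + t) / 2 + (s - t - h) / 2 = s by ring,
    show (s + h + t) / 2 - (s - t - h) / 2 = t + h by ring,
    show (s + h + t) / 2 - p + (s + h - t) / 2 = s + h - p by ring,
    show (s + h + t) / 2 - p - (s + h - t) / 2 = t - p by ring] at this
  linear_combination -this

/-- By `theta_quot_symm` the ratio `e(h)` of the two sides is independent of `s`. Telescoping
through `s + h` gives `e(h + k) = e(h) e(k)`. A generic choice of `s` near each `h` shows that `e`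
is holomorphic, so it is an exponential. -/
theorem exists_theta_quot {τ : ℍ} {p : ℂ} (hp : theta τ p = 0) :
    ∃ κ : ℂ, ∀ s h, theta τ (s + h) * theta τ (s - p) =
      Complex.exp (κ * h) * (theta τ s * theta τ (s + h - p)) := by
  have ne : ∀ h : ℂ, ∃ t, theta τ t ≠ 0 ∧ theta τ (t - p) ≠ 0 ∧ theta τ (t + h) ≠ 0 ∧
      theta τ (t + h - p) ≠ 0 := by
    intro h
    have e2 := eventually_theta_add_ne_zero τ (-p)
    have e4 := eventually_theta_add_ne_zero τ (h - p)
    simp only [← sub_eq_add_neg, ← add_sub_assoc] at e2 e4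
    exact ((eventually_theta_ne_zero τ).and (e2.and
      ((eventually_theta_add_ne_zero τ h).and e4))).exists
  have hc : ∀ h : ℂ, ∃ c : ℂ, ∀ s, theta τ (s + h) * theta τ (s - p) =
      c * (theta τ s * theta τ (s + h - p)) := by
    intro h
    obtain ⟨t, h1, h2, h3, h4⟩ := ne h
    refine ⟨theta τ (t + h) * theta τ (t - p) / (theta τ t * theta τ (t + h - p)), fun s => ?_⟩
    have := theta_quot_symm hp s t h
    field_simp
    linear_combination this
  choose e he using hc
  have he_eq : ∀ h t, theta τ t ≠ 0 → theta τ (t + h - p) ≠ 0 →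
      e h = theta τ (t + h) * theta τ (t - p) / (theta τ t * theta τ (t + h - p)) := by
    intro h t h1 h4
    rw [eq_div_iff (mul_ne_zero h1 h4), he h t]
  have hadd : ∀ h k, e (h + k) = e h * e k := by
    intro h k
    have e2 := eventually_theta_add_ne_zero τ (h - p)
    have e3 := eventually_theta_add_ne_zero τ (h + k - p)
    have e4 := eventually_theta_add_ne_zero τ (-p)
    simp only [← sub_eq_add_neg, ← add_sub_assoc, ← add_assoc] at e2 e3 e4
    obtain ⟨t, h1, h2, h3, h4, h5⟩ := ((eventually_theta_ne_zero τ).and (e2.and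
      (e3.and ((eventually_theta_add_ne_zero τ h).and e4)))).exists
    have k1 := he (h + k) t
    have k2 := he h t
    have k3 := he k (t + h)
    rw [← add_assoc] at k1
    have : e (h + k) * (theta τ t * theta τ (t + h + k - p) * theta τ (t + h) *
        theta τ (t + h - p)) = e h * e k * (theta τ t * theta τ (t + h + k - p) * theta τ (t + h) *
        theta τ (t + h - p)) := by
      linear_combination (-theta τ (t + h) * theta τ (t + h - p)) * k1 +
        theta τ (t + h + k) * theta τ (t + h - p) * k2 +
        (e h * theta τ t * theta τ (t + h - p)) * k3
    exact mul_right_cancel₀ (by positivity) this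
  have hdiff : Differentiable ℂ e := by
    intro h
    obtain ⟨t, h1, h2, h3, h4⟩ := ne h
    have hd := differentiable_theta τ
    have hev : ∀ᶠ k in nhds h, theta τ (t + k - p) ≠ 0 := by
      have : ContinuousAt (fun k => theta τ (t + k - p)) h := by
        have := hd.continuous
        fun_prop
      exact this.eventually_ne h4
    have : DifferentiableAt ℂ (fun k => theta τ (t + k) * theta τ (t - p) /
        (theta τ t * theta τ (t + k - p))) h := by
      refine DifferentiableAt.div (by fun_prop) (by fun_prop) (mul_ne_zero h1 h4)
    refine this.congr_of_eventuallyEq ?_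
    filter_upwards [hev] with k hk using he_eq k t h1 hk
  have h0 : e 0 = 1 := by
    obtain ⟨t, h1, h2, -⟩ := ne 0
    rw [he_eq 0 t h1 (by simpa using h2)]
    simp only [add_zero]
    exact div_self (mul_ne_zero h1 h2)
  refine ⟨deriv e 0, fun s h => ?_⟩
  rw [he h s]
  congr 1
  have hder : ∀ x, deriv e x = deriv e 0 * e x := by
    intro x
    have h1 : (fun y => e (x + y)) = fun y => e x * e y := funext fun y => hadd x y
    have h2 := congrArg (fun g => deriv g 0) h1
    simp only [deriv_comp_const_add, add_zero, deriv_const_mul_field] at h2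
    rw [h2, mul_comm]
  have hconst : ∀ x y, e x * Complex.exp (-(deriv e 0 * x)) =
      e y * Complex.exp (-(deriv e 0 * y)) := by
    refine is_const_of_deriv_eq_zero (f := fun x => e x * Complex.exp (-(deriv e 0 * x)))
      (by fun_prop) fun x => ?_
    have hd1 : HasDerivAt e (deriv e 0 * e x) x := hder x ▸ (hdiff x).hasDerivAt
    have hd2 : HasDerivAt (fun x => Complex.exp (-(deriv e 0 * x)))
        (Complex.exp (-(deriv e 0 * x)) * -(deriv e 0 * 1)) x :=
      (((hasDerivAt_id x).const_mul (deriv e 0)).neg).cexp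
    refine (hd1.mul hd2).deriv.trans ?_
    ring
  have := hconst h 0
  rw [h0, mul_zero, neg_zero, Complex.exp_zero, mul_one, Complex.exp_neg] at this
  have h3 := Complex.exp_ne_zero (deriv e 0 * h)
  field_simp at this
  exact this

/-- The zeros of the theta function are the points of the lattice. -/
theorem exists_int_of_theta_eq_zero {τ : ℍ} {p : ℂ} (hp : theta τ p = 0) :
    ∃ r s : ℤ, p = r + s * τ := by
  obtain ⟨κ, hκ⟩ := exists_theta_quot hp
  have e2 := eventually_theta_add_ne_zero τ (-p)
  obtain ⟨t, h1, h2⟩ := ((eventually_theta_ne_zero τ).and e2).exists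
  rw [← sub_eq_add_neg] at h2
  -- The step `1` forces `exp κ = 1`, so `κ = 2πik`. In the step `τ` the two quasi-period factors
  -- differ by `exp(2πip)`, so `κτ + 2πip` is a multiple of `2πi`, which locates `p`.
  have k1 := hκ t 1
  have k2 := hκ t τ
  rw [theta_add_one, show t + 1 - p = t - p + 1 by ring, theta_add_one, mul_one] at k1
  rw [theta_add_tau, show t + τ - p = t - p + τ by ring, theta_add_tau] at k2
  have l1 : Complex.exp κ = 1 := by
    have : theta τ t * theta τ (t - p) * (Complex.exp κ - 1) = 0 := by linear_combination k1
    have := (mul_eq_zero.1 this).resolve_left (mul_ne_zero h1 h2)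
    linear_combination this
  obtain ⟨k, hk⟩ := Complex.exp_eq_one_iff.1 l1
  have l2 : Complex.exp (-(Complex.I * Real.pi * (τ + 2 * t))) =
      Complex.exp (κ * τ) * Complex.exp (-(Complex.I * Real.pi * (τ + 2 * (t - p)))) := by
    refine mul_right_cancel₀ (mul_ne_zero h1 h2) ?_
    linear_combination -k2
  rw [← Complex.exp_add, Complex.exp_eq_exp_iff_exists_int] at l2
  obtain ⟨m, hm⟩ := l2
  refine ⟨-m, -k, ?_⟩
  have hpi : (2 * Real.pi * Complex.I : ℂ) ≠ 0 := Complex.two_pi_I_ne_zero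
  refine mul_left_cancel₀ hpi ?_
  rw [hk] at hm
  push_cast
  linear_combination -hm

end Zeros

end EllipticSl2

namespace EllipticSl2

/-! ### Odd functions with the three-term identity -/

/-- The properties of `f(t) = θ(t ħ)` that are used below. -/
structure IsBracket (f : ℂ → ℂ) : Prop where
  odd : ∀ x, f (-x) = -f x
  threeTerm : ThreeTerm f
  continuous : Continuous f
  eventually_ne : ∀ᶠ x in cocountable, f x ≠ 0
  nat_ne : ∀ n : ℕ, f (n + 1) ≠ 0

namespace IsBracket

variable {f : ℂ → ℂ} (hf : IsBracket f)
include hf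

theorem zero : f 0 = 0 := by
  have := hf.odd 0
  rw [neg_zero] at this
  linear_combination this / 2

theorem sub_comm (x y : ℂ) : f (x - y) = -f (y - x) := by
  rw [← hf.odd, neg_sub]

theorem eventually_add_ne (c : ℂ) : ∀ᶠ x in cocountable, f (x + c) ≠ 0 :=
  (tendsto_cocountable_of_injective (add_left_injective c)).eventually hf.eventually_ne

theorem eventually_sub_ne (c : ℂ) : ∀ᶠ x in cocountable, f (c - x) ≠ 0 :=
  (tendsto_cocountable_of_injective sub_right_injective).eventually hf.eventually_ne

/-- Lagrange interpolation in `w` with nodes `u` and `v`: with `c + d` fixed, the functions `f(w -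
c) f(w - d)` span a space of dimension at most two. It is the three-term identity recentred at `(c +
d)/2`. -/
theorem interpolate (c d u v w : ℂ) :
    f (u - v) * f (u + v - c - d) * (f (w - c) * f (w - d)) =
      f (w - v) * f (w + v - c - d) * (f (u - c) * f (u - d)) -
        f (w - u) * f (w + u - c - d) * (f (v - c) * f (v - d)) := by
  have h := hf.threeTerm (u - (c + d) / 2) (v - (c + d) / 2) (w - (c + d) / 2) ((c - d) / 2)
  rw [show u - (c + d) / 2 + (v - (c + d) / 2) = u + v - c - d by ring,
    show u - (c + d) / 2 - (v - (c + d) / 2) = u - v by ring,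
    show w - (c + d) / 2 + (c - d) / 2 = w - d by ring,
    show w - (c + d) / 2 - (c - d) / 2 = w - c by ring,
    show u - (c + d) / 2 + (w - (c + d) / 2) = w + u - c - d by ring,
    show u - (c + d) / 2 - (w - (c + d) / 2) = u - w by ring,
    show v - (c + d) / 2 + (c - d) / 2 = v - d by ring,
    show v - (c + d) / 2 - (c - d) / 2 = v - c by ring,
    show u - (c + d) / 2 + (c - d) / 2 = u - d by ring,
    show u - (c + d) / 2 - (c - d) / 2 = u - c by ring,
    show v - (c + d) / 2 + (w - (c + d) / 2) = w + v - c - d by ring,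
    show v - (c + d) / 2 - (w - (c + d) / 2) = v - w by ring, hf.sub_comm u w,
    hf.sub_comm v w] at h
  linear_combination h

/-- Interpolate the `c₁, c₂` factors at `w₃, w₄` from `w₁, w₂`, and the `c₃, c₄` factors at `w₁, w₂`
from `w₃, w₄`. The balance of zeros and poles identifies the node factors of both expansions up to
sign, and the combination vanishes after cancelling the common factor `f(w₁ + w₂ - c₁ - c₂)`. -/
theorem fourTerm_aux {w₁ w₂ w₃ w₄ c₁ c₂ c₃ c₄ : ℂ} (h : c₁ + c₂ + c₃ + c₄ = w₁ + w₂ + w₃ + w₄)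
    (hκ : f (w₁ + w₂ - c₁ - c₂) ≠ 0) :
    f (w₁ - c₁) * f (w₁ - c₂) * (f (w₁ - c₃) * f (w₁ - c₄)) *
        (f (w₂ - w₃) * f (w₂ - w₄) * f (w₃ - w₄)) -
      f (w₂ - c₁) * f (w₂ - c₂) * (f (w₂ - c₃) * f (w₂ - c₄)) *
        (f (w₁ - w₃) * f (w₁ - w₄) * f (w₃ - w₄)) +
      f (w₃ - c₁) * f (w₃ - c₂) * (f (w₃ - c₃) * f (w₃ - c₄)) *
        (f (w₁ - w₂) * f (w₁ - w₄) * f (w₂ - w₄)) -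
      f (w₄ - c₁) * f (w₄ - c₂) * (f (w₄ - c₃) * f (w₄ - c₄)) *
        (f (w₁ - w₂) * f (w₁ - w₃) * f (w₂ - w₃)) = 0 := by
  have e3 := hf.interpolate c₁ c₂ w₁ w₂ w₃
  have e4 := hf.interpolate c₁ c₂ w₁ w₂ w₄
  have g1 := hf.interpolate c₃ c₄ w₃ w₄ w₁
  have g2 := hf.interpolate c₃ c₄ w₃ w₄ w₂
  have k1 : f (w₃ + w₄ - c₃ - c₄) = -f (w₁ + w₂ - c₁ - c₂) := by
    rw [← hf.odd]
    congr 1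
    linear_combination -h
  have k2 : f (w₁ + w₄ - c₃ - c₄) = -f (w₃ + w₂ - c₁ - c₂) := by
    rw [← hf.odd]
    congr 1
    linear_combination -h
  have k3 : f (w₁ + w₃ - c₃ - c₄) = -f (w₄ + w₂ - c₁ - c₂) := by
    rw [← hf.odd]
    congr 1
    linear_combination -h
  have k4 : f (w₂ + w₄ - c₃ - c₄) = -f (w₃ + w₁ - c₁ - c₂) := by
    rw [← hf.odd]
    congr 1
    linear_combination -h
  have k5 : f (w₂ + w₃ - c₃ - c₄) = -f (w₄ + w₁ - c₁ - c₂) := by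
    rw [← hf.odd]
    congr 1
    linear_combination -h
  rw [k1, k2, k3] at g1
  rw [k1, k4, k5] at g2
  rw [hf.sub_comm w₃ w₂, hf.sub_comm w₃ w₁] at e3
  rw [hf.sub_comm w₄ w₂, hf.sub_comm w₄ w₁] at e4
  refine (mul_eq_zero.1 ?_).resolve_left hκ
  linear_combination (f (w₃ - c₃) * f (w₃ - c₄) * f (w₁ - w₄) * f (w₂ - w₄)) * e3 -
    (f (w₄ - c₃) * f (w₄ - c₄) * f (w₁ - w₃) * f (w₂ - w₃)) * e4 -
    (f (w₁ - c₁) * f (w₁ - c₂) * f (w₂ - w₃) * f (w₂ - w₄)) * g1 +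
    (f (w₂ - c₁) * f (w₂ - c₂) * f (w₁ - w₃) * f (w₁ - w₄)) * g2

/-- The four-term partial fraction identity. -/
theorem fourTerm {w₁ w₂ w₃ w₄ c₁ c₂ c₃ c₄ : ℂ} (h : c₁ + c₂ + c₃ + c₄ = w₁ + w₂ + w₃ + w₄) :
    f (w₁ - c₁) * f (w₁ - c₂) * (f (w₁ - c₃) * f (w₁ - c₄)) *
        (f (w₂ - w₃) * f (w₂ - w₄) * f (w₃ - w₄)) -
      f (w₂ - c₁) * f (w₂ - c₂) * (f (w₂ - c₃) * f (w₂ - c₄)) *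
        (f (w₁ - w₃) * f (w₁ - w₄) * f (w₃ - w₄)) +
      f (w₃ - c₁) * f (w₃ - c₂) * (f (w₃ - c₃) * f (w₃ - c₄)) *
        (f (w₁ - w₂) * f (w₁ - w₄) * f (w₂ - w₄)) -
      f (w₄ - c₁) * f (w₄ - c₂) * (f (w₄ - c₃) * f (w₄ - c₄)) *
        (f (w₁ - w₂) * f (w₁ - w₃) * f (w₂ - w₃)) = 0 := by
  have hc := hf.continuous
  -- Moving `c₁` by `ε` and `c₃` by `-ε` keeps the balance, and for generic `ε` makes the factor to
  -- be cancelled nonzero.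
  have key := eq_of_eventually_cocountable (x := 0) (h := fun _ => 0) (g := fun ε =>
    f (w₁ - (c₁ + ε)) * f (w₁ - c₂) * (f (w₁ - (c₃ - ε)) * f (w₁ - c₄)) *
        (f (w₂ - w₃) * f (w₂ - w₄) * f (w₃ - w₄)) -
      f (w₂ - (c₁ + ε)) * f (w₂ - c₂) * (f (w₂ - (c₃ - ε)) * f (w₂ - c₄)) *
        (f (w₁ - w₃) * f (w₁ - w₄) * f (w₃ - w₄)) +
      f (w₃ - (c₁ + ε)) * f (w₃ - c₂) * (f (w₃ - (c₃ - ε)) * f (w₃ - c₄)) *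
        (f (w₁ - w₂) * f (w₁ - w₄) * f (w₂ - w₄)) -
      f (w₄ - (c₁ + ε)) * f (w₄ - c₂) * (f (w₄ - (c₃ - ε)) * f (w₄ - c₄)) *
        (f (w₁ - w₂) * f (w₁ - w₃) * f (w₂ - w₃))) (by fun_prop) continuousAt_const ?_
  · simpa using key
  · filter_upwards [hf.eventually_sub_ne (w₁ + w₂ - c₁ - c₂)] with ε hε
    refine hf.fourTerm_aux (by linear_combination h) ?_
    rwa [show w₁ + w₂ - (c₁ + ε) - c₂ = w₁ + w₂ - c₁ - c₂ - ε by ring]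

/-- The four-term identity with poles at `0, Q, n, R`. -/
theorem partialFraction {α β X Z Q n R : ℂ} (h : α - β + X + Z = Q + n + R) (hn : f n ≠ 0)
    (hQ : f Q ≠ 0) (hR : f R ≠ 0) (hQn : f (Q - n) ≠ 0) (hRn : f (R - n) ≠ 0) :
    f α * f β * f (Q - R) * f X * f Z / (f n * f R * f Q) +
        f (α - Q) * f (β + Q) * f (Q - X) * f (Z - Q) / (f Q * f (Q - n)) =
      f (α - n) * f (β + n) * f (Q - R) * f (X - n) * f (Z - n) / (f n * f (R - n) * f (Q - n)) +
        f (α - R) * f (β + R) * f (R - X) * f (Z - R) / (f (R - n) * f R) := by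
  have := hf.fourTerm (w₁ := 0) (w₂ := Q) (w₃ := n) (w₄ := R) (c₁ := α) (c₂ := -β) (c₃ := X)
    (c₄ := Z) (by linear_combination h)
  simp only [zero_sub, hf.odd, sub_neg_eq_add] at this
  rw [zero_add, hf.sub_comm Q α, hf.sub_comm n α, hf.sub_comm R α, hf.sub_comm Q Z,
    hf.sub_comm n Z, hf.sub_comm R Z, hf.sub_comm n X, hf.sub_comm n R, add_comm Q β,
    add_comm n β, add_comm R β] at this
  field_simp
  linear_combination this

end IsBracket

/-! ### Falling products -/

/-- The product `f(z) f(z - 1) ⋯ f(z - n + 1)`. -/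
noncomputable def fallProd (f : ℂ → ℂ) (z : ℂ) (n : ℕ) : ℂ := ∏ i ∈ Finset.range n, f (z - i)

/-- The product `f(z) f(z + 1) ⋯ f(z + n - 1)`. -/
noncomputable def riseProd (f : ℂ → ℂ) (z : ℂ) (n : ℕ) : ℂ := ∏ i ∈ Finset.range n, f (z + i)

section FallProd

variable (f : ℂ → ℂ)

theorem fallProd_succ_right (z : ℂ) (n : ℕ) :
    fallProd f z (n + 1) = fallProd f z n * f (z - n) := Finset.prod_range_succ _ _

theorem riseProd_succ (z : ℂ) (n : ℕ) :
    riseProd f z (n + 1) = riseProd f z n * f (z + n) := Finset.prod_range_succ _ _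

theorem fallProd_succ_left (z : ℂ) (n : ℕ) :
    fallProd f z (n + 1) = f z * fallProd f (z - 1) n := by
  rw [fallProd, Finset.prod_range_succ', fallProd, mul_comm]
  congr 1
  · simp
  · refine Finset.prod_congr rfl fun i _ => ?_
    congr 1
    push_cast
    ring

theorem fallProd_shift (z : ℂ) (n : ℕ) :
    f z * fallProd f (z - 1) n = fallProd f z n * f (z - n) := by
  rw [← fallProd_succ_left, fallProd_succ_right]

theorem fallProd_ne_zero {z : ℂ} {n : ℕ} (h : ∀ i < n, f (z - i) ≠ 0) : fallProd f z n ≠ 0 :=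
  Finset.prod_ne_zero_iff.2 fun i hi => h i (Finset.mem_range.1 hi)

end FallProd

/-! ### Coefficients of the intertwiner -/

/-- The coefficients of the operator exchanging two parameters, up to a factor independent
of `x`. -/
noncomputable def gCoeff (f : ℂ → ℂ) (δ : ℂ) (n : ℕ) (A X Z P Q : ℂ) : ℂ :=
  (-1) ^ n * fallProd f (A + n) n / fallProd f n n * riseProd f δ n *
    (fallProd f X n * fallProd f Z n / (fallProd f (P - n) n * fallProd f Q n))

/-- The common factor of the coefficients in an intertwining relation. -/
noncomputable def gCore (f : ℂ → ℂ) (δ : ℂ) (n : ℕ) (A X Z P Q : ℂ) : ℂ :=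
  (-1) ^ n * fallProd f (A + n) n / fallProd f n n * riseProd f δ n *
    (fallProd f (X - 1) n * fallProd f (Z - 1) n /
      (fallProd f (P - n - 2) n * fallProd f (Q - 1) n))

section GCoeff

variable (f : ℂ → ℂ) (δ : ℂ) (n : ℕ) (A X Z P Q : ℂ)

theorem gCoeff_zero : gCoeff f δ 0 A X Z P Q = 1 := by simp [gCoeff, fallProd, riseProd]

/-- In each intertwining relation four coefficients occur, two of length `n + 1` and two of length
`n`. Writing all of them as `gCore` times a ratio with a bounded number of brackets makes the
relation independent of the long products. -/
theorem gCoeff_succ : gCoeff f δ (n + 1) A X Z P Q = -gCore f δ n A X Z P Q *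
    (f (A + n + 1) * f (δ + n) * f X * f Z / (f (n + 1) * f (P - n - 1) * f Q)) := by
  simp only [gCoeff, gCore, fallProd_succ_left, riseProd_succ, pow_succ]
  push_cast
  rw [show A + ((n : ℂ) + 1) = A + n + 1 by ring, show A + (n : ℂ) + 1 - 1 = A + n by ring,
    show (n : ℂ) + 1 - 1 = n by ring, show P - ((n : ℂ) + 1) = P - n - 1 by ring,
    show P - (n : ℂ) - 1 - 1 = P - n - 2 by ring]
  ring

/-- The subscripts 1 to 4, here and for `gCoeff_shift₁` to `gCoeff_shift₄`, belong to the relations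
for `L_{--}`, `L_{-+}`, `L_{+-}`, `L_{++}`; each relation shifts the arguments differently. -/
theorem gCoeff_succ_shift₁ : gCoeff f δ (n + 1) A (X - 1) (Z - 1) (P - 1) (Q - 1) =
    -gCore f δ n A X Z P Q * (f (A + n + 1) * f (δ + n) * f (X - n - 1) * f (Z - n - 1) /
      (f (n + 1) * f (P - 2 * n - 2) * f (Q - n - 1))) := by
  simp only [gCoeff, gCore]
  rw [fallProd_succ_left f (A + _), fallProd_succ_left f ((n + 1 : ℕ) : ℂ)]
  simp only [fallProd_succ_right, riseProd_succ, pow_succ]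
  push_cast
  rw [show A + ((n : ℂ) + 1) = A + n + 1 by ring, show A + (n : ℂ) + 1 - 1 = A + n by ring,
    show (n : ℂ) + 1 - 1 = n by ring, show P - 1 - ((n : ℂ) + 1) = P - n - 2 by ring,
    show P - (n : ℂ) - 2 - n = P - 2 * n - 2 by ring, show X - 1 - (n : ℂ) = X - n - 1 by ring,
    show Z - 1 - (n : ℂ) = Z - n - 1 by ring, show Q - 1 - (n : ℂ) = Q - n - 1 by ring]
  ring

theorem gCoeff_succ_shift₂ : gCoeff f δ (n + 1) A X (Z - 1) (P - 1) (Q - 1) =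
    -gCore f δ n A X Z P Q * (f (A + n + 1) * f (δ + n) * f X * f (Z - n - 1) /
      (f (n + 1) * f (P - 2 * n - 2) * f (Q - n - 1))) := by
  simp only [gCoeff, gCore]
  rw [fallProd_succ_left f (A + _), fallProd_succ_left f ((n + 1 : ℕ) : ℂ),
    fallProd_succ_left f X]
  simp only [fallProd_succ_right, riseProd_succ, pow_succ]
  push_cast
  rw [show A + ((n : ℂ) + 1) = A + n + 1 by ring, show A + (n : ℂ) + 1 - 1 = A + n by ring,
    show (n : ℂ) + 1 - 1 = n by ring, show P - 1 - ((n : ℂ) + 1) = P - n - 2 by ring,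
    show P - (n : ℂ) - 2 - n = P - 2 * n - 2 by ring,
    show Z - 1 - (n : ℂ) = Z - n - 1 by ring, show Q - 1 - (n : ℂ) = Q - n - 1 by ring]
  ring

theorem gCoeff_succ_shift₃ : gCoeff f δ (n + 1) (A - 1) (X - 1) Z (P - 1) (Q - 1) =
    -gCore f δ n A X Z P Q * (f A * f (δ + n) * f (X - n - 1) * f Z /
      (f (n + 1) * f (P - 2 * n - 2) * f (Q - n - 1))) := by
  simp only [gCoeff, gCore]
  rw [fallProd_succ_left f ((n + 1 : ℕ) : ℂ), fallProd_succ_left f Z]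
  simp only [fallProd_succ_right, riseProd_succ, pow_succ]
  push_cast
  rw [show A - 1 + ((n : ℂ) + 1) = A + n by ring, show A + (n : ℂ) - n = A by ring,
    show (n : ℂ) + 1 - 1 = n by ring, show P - 1 - ((n : ℂ) + 1) = P - n - 2 by ring,
    show P - (n : ℂ) - 2 - n = P - 2 * n - 2 by ring, show X - 1 - (n : ℂ) = X - n - 1 by ring,
    show Q - 1 - (n : ℂ) = Q - n - 1 by ring]
  ring

theorem gCoeff_succ_shift₄ : gCoeff f δ (n + 1) (A - 1) X Z (P - 1) (Q - 1) =
    -gCore f δ n A X Z P Q * (f A * f (δ + n) * f X * f Z /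
      (f (n + 1) * f (P - 2 * n - 2) * f (Q - n - 1))) := by
  simp only [gCoeff, gCore]
  rw [fallProd_succ_left f ((n + 1 : ℕ) : ℂ), fallProd_succ_left f Z, fallProd_succ_left f X]
  simp only [fallProd_succ_right, riseProd_succ, pow_succ]
  push_cast
  rw [show A - 1 + ((n : ℂ) + 1) = A + n by ring, show A + (n : ℂ) - n = A by ring,
    show (n : ℂ) + 1 - 1 = n by ring, show P - 1 - ((n : ℂ) + 1) = P - n - 2 by ring,
    show P - (n : ℂ) - 2 - n = P - 2 * n - 2 by ring,
    show Q - 1 - (n : ℂ) = Q - n - 1 by ring]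
  ring

variable {f X Z P Q A}

theorem fallProd_eq_mul_div {z w : ℂ} (h : f (z - n) ≠ 0) (hw : z - 1 = w) :
    fallProd f z n = fallProd f w n * (f z / f (z - n)) := by
  subst hw
  rw [mul_div_assoc', eq_div_iff h, ← fallProd_shift, mul_comm]

theorem inv_fallProd_eq {z w : ℂ} (h : f (z - n) ≠ 0) (hw : z - 1 = w) :
    (fallProd f z n)⁻¹ = (fallProd f w n)⁻¹ * (f (z - n) / f z) := by
  rw [fallProd_eq_mul_div n h hw, mul_inv, inv_div]

theorem inv_fallProd_eq' {z w : ℂ} (h : f z ≠ 0) (hw : z - 1 = w) :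
    (fallProd f w n)⁻¹ = (fallProd f z n)⁻¹ * (f z / f (z - n)) := by
  subst hw
  have := fallProd_shift f z n
  have h2 : fallProd f (z - 1) n = fallProd f z n * f (z - n) / f z := by
    rw [eq_div_iff h, ← this, mul_comm]
  rw [h2, inv_div, div_eq_mul_inv, mul_inv]
  ring

/-- This coefficient of length `n` is common to all four relations. -/
theorem gCoeff_shift₀ (hQ : f (Q - 1) ≠ 0) :
    gCoeff f δ n A (X - 1) (Z - 1) (P - 2) (Q - 2) =
      gCore f δ n A X Z P Q * (f (Q - 1) / f (Q - n - 1)) := by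
  simp only [gCoeff, gCore, div_eq_mul_inv, mul_inv]
  rw [inv_fallProd_eq' (z := Q - 1) n hQ (by ring : Q - 1 - 1 = Q - 2),
    show P - 2 - (n : ℂ) = P - n - 2 by ring, show Q - 1 - (n : ℂ) = Q - n - 1 by ring]
  ring

theorem gCoeff_shift₁ (hP : f (P - 2 * n - 1) ≠ 0) (hA : f (A + 1) ≠ 0) :
    gCoeff f δ n (A + 1) (X - 1) (Z - 1) (P - 1) (Q - 1) =
      gCore f δ n A X Z P Q * (f (A + n + 1) / f (A + 1) * (f (P - 2 * n - 1) / f (P - n - 1))) := by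
  simp only [gCoeff, gCore, div_eq_mul_inv, mul_inv]
  rw [inv_fallProd_eq (z := P - 1 - n) (w := P - n - 2) n
      (by rwa [show P - 1 - (n : ℂ) - n = P - 2 * n - 1 by ring]) (by ring),
    fallProd_eq_mul_div (z := A + 1 + n) (w := A + n) n
      (by rwa [show A + 1 + (n : ℂ) - n = A + 1 by ring]) (by ring),
    show P - 1 - (n : ℂ) - n = P - 2 * n - 1 by ring, show P - 1 - (n : ℂ) = P - n - 1 by ring,
    show A + 1 + (n : ℂ) - n = A + 1 by ring, show A + 1 + (n : ℂ) = A + n + 1 by ring]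
  ring

theorem gCoeff_shift₂ (hP : f (P - 2 * n - 1) ≠ 0) (hA : f (A + 1) ≠ 0) (hX : f (X - n) ≠ 0) :
    gCoeff f δ n (A + 1) X (Z - 1) (P - 1) (Q - 1) =
      gCore f δ n A X Z P Q * (f (A + n + 1) / f (A + 1) * (f (P - 2 * n - 1) / f (P - n - 1)) *
        (f X / f (X - n))) := by
  simp only [gCoeff, gCore, div_eq_mul_inv, mul_inv]
  rw [inv_fallProd_eq (z := P - 1 - n) (w := P - n - 2) n
      (by rwa [show P - 1 - (n : ℂ) - n = P - 2 * n - 1 by ring]) (by ring),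
    fallProd_eq_mul_div (z := A + 1 + n) (w := A + n) n
      (by rwa [show A + 1 + (n : ℂ) - n = A + 1 by ring]) (by ring),
    fallProd_eq_mul_div (z := X) n hX rfl,
    show P - 1 - (n : ℂ) - n = P - 2 * n - 1 by ring, show P - 1 - (n : ℂ) = P - n - 1 by ring,
    show A + 1 + (n : ℂ) - n = A + 1 by ring, show A + 1 + (n : ℂ) = A + n + 1 by ring]
  ring

theorem gCoeff_shift₃ (hP : f (P - 2 * n - 1) ≠ 0) (hZ : f (Z - n) ≠ 0) :
    gCoeff f δ n A (X - 1) Z (P - 1) (Q - 1) =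
      gCore f δ n A X Z P Q * (f Z / f (Z - n) * (f (P - 2 * n - 1) / f (P - n - 1))) := by
  simp only [gCoeff, gCore, div_eq_mul_inv, mul_inv]
  rw [inv_fallProd_eq (z := P - 1 - n) (w := P - n - 2) n
      (by rwa [show P - 1 - (n : ℂ) - n = P - 2 * n - 1 by ring]) (by ring),
    fallProd_eq_mul_div (z := Z) n hZ rfl,
    show P - 1 - (n : ℂ) - n = P - 2 * n - 1 by ring, show P - 1 - (n : ℂ) = P - n - 1 by ring]
  ring

theorem gCoeff_shift₄ (hP : f (P - 2 * n - 1) ≠ 0) (hZ : f (Z - n) ≠ 0) (hX : f (X - n) ≠ 0) :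
    gCoeff f δ n A X Z (P - 1) (Q - 1) =
      gCore f δ n A X Z P Q * (f Z / f (Z - n) * (f (P - 2 * n - 1) / f (P - n - 1)) *
        (f X / f (X - n))) := by
  simp only [gCoeff, gCore, div_eq_mul_inv, mul_inv]
  rw [inv_fallProd_eq (z := P - 1 - n) (w := P - n - 2) n
      (by rwa [show P - 1 - (n : ℂ) - n = P - 2 * n - 1 by ring]) (by ring),
    fallProd_eq_mul_div (z := Z) n hZ rfl, fallProd_eq_mul_div (z := X) n hX rfl,
    show P - 1 - (n : ℂ) - n = P - 2 * n - 1 by ring, show P - 1 - (n : ℂ) = P - n - 1 by ring]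
  ring

end GCoeff

end EllipticSl2

namespace EllipticSl2

/-! ### Local exchange relations -/

theorem add_eq_add_of_mul {T₁ T₂ T₃ T₄ u₁ u₂ u₃ u₄ : ℂ} (c : ℂ) (h : u₁ + u₂ = u₃ + u₄)
    (h₁ : T₁ = c * u₁) (h₂ : T₂ = c * u₂) (h₃ : T₃ = c * u₃) (h₄ : T₄ = c * u₄) :
    T₁ + T₂ = T₃ + T₄ := by
  rw [h₁, h₂, h₃, h₄, ← mul_add, h, mul_add]

section Local

variable (f : ℂ → ℂ)

/-- Coefficient of `L_{++}`. -/
noncomputable def locPP (U V j x : ℂ) : ℂ :=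
  f (V - j + 1) * f (x + (V - U) - j + 1) * f (x - j) / (f x * f (x + (V - U) - 2 * j + 1))

/-- Coefficient of `L_{+-}` without the factor `f (V - U - j)`. -/
noncomputable def locPM (U V j x : ℂ) : ℂ := f (V + x - j) / f (x + (V - U) - 2 * j - 1)

/-- Coefficient of `L_{-+}`. -/
noncomputable def locMP (U j x : ℂ) : ℂ := -(f (U - x + j) * f j / f x)

/-- Coefficient of `L_{--}`. -/
noncomputable def locMM (U j : ℂ) : ℂ := f (U + j + 1)

/-- Coefficients of the operator exchanging `V` and `V'`, up to a factor independent of `x`. -/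
noncomputable def exch (U V U' V' : ℂ) (n : ℕ) (A b x : ℂ) : ℂ :=
  gCoeff f (V' - V) n A (x - 1 - b) (x + (V - U) + (V' - U') - (A + n) - 2 * b)
    (x + V - U' - 2 * b) (x + V' - U' - 2 * b - 1)

/-- Points where no denominator vanishes. -/
def Regular (U V U' V' x : ℂ) : Prop :=
  ∀ n : ℤ, f (x + n) ≠ 0 ∧ f (x + (V' - U') + n) ≠ 0 ∧ f (x + (V - U') + n) ≠ 0 ∧
    f (x + (V - U) + (V' - U') + n) ≠ 0

variable {f} (hf : IsBracket f) {U V U' V' x : ℂ} (hx : Regular f U V U' V' x)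
include hf hx

/-- This compares the coefficients of `Φ (x - 1) (A + s + 1) b` in the intertwining relation for
`L_{--}`. After division by `-gCore · f(A + n)`, with `n = s + 1`, the four terms are those of
`partialFraction`, with poles at `0, Q, n, R`. -/
theorem exchange_mm (A b s : ℕ) :
    locMM f U (A + s + 1) * locMM f U' b * exch f U V U' V' (s + 1) A b x +
      locMP f U (A + s + 1) (x + (V' - U') - 2 * (b + 1)) *
        (locPM f U' V' b x * f (V' - U' - b)) *
        (f (V - U - (A + s)) * exch f U V U' V' s A (b + 1) x) =
    locMM f U A * locMM f U' (b + s + 1) * exch f U V U' V' (s + 1) A b (x - 1) +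
      locMP f U (A + 1) (x + (V - U') - 2 * (b + s + 1)) *
        (locPM f U' V (b + s) x * f (V - U' - (b + s))) *
        (f (V' - U - A) * exch f U V U' V' s (A + 1) b (x - 1)) := by
  -- The names are kept opaque so that simplification treats them as atoms: `α, -β, X, Z` are the
  -- zeros and `0, Q, n, R` the poles of the partial fraction identity.
  obtain ⟨α, hα⟩ : ∃ α, α = U + A + s + 2 := ⟨_, rfl⟩
  obtain ⟨β, hβ⟩ : ∃ β, β = U' + b + 1 := ⟨_, rfl⟩
  obtain ⟨X, hX⟩ : ∃ X, X = x - 1 - b := ⟨_, rfl⟩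
  obtain ⟨Z, hZ⟩ : ∃ Z, Z = x + (V - U) + (V' - U') - (A + s + 1) - 2 * b := ⟨_, rfl⟩
  obtain ⟨R, hR⟩ : ∃ R, R = x + V - U' - 2 * b - s - 1 := ⟨_, rfl⟩
  obtain ⟨Q, hQ⟩ : ∃ Q, Q = x + V' - U' - 2 * b - 1 := ⟨_, rfl⟩
  obtain ⟨n, hn⟩ : ∃ n : ℂ, n = s + 1 := ⟨_, rfl⟩
  have g1 : exch f U V U' V' (s + 1) A b x = gCoeff f (V' - V) (s + 1) A X Z (R + n) Q := by
    unfold exch; congr 1 <;> simp only [hX, hZ, hR, hQ, hn] <;> push_cast <;> ring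
  have g2 : exch f U V U' V' s A (b + 1) x =
      gCoeff f (V' - V) s A (X - 1) (Z - 1) (R + n - 2) (Q - 2) := by
    unfold exch; congr 1 <;> (simp only [hX, hZ, hR, hQ, hn]; ring)
  have g3 : exch f U V U' V' (s + 1) A b (x - 1) =
      gCoeff f (V' - V) (s + 1) A (X - 1) (Z - 1) (R + n - 1) (Q - 1) := by
    unfold exch; congr 1 <;> simp only [hX, hZ, hR, hQ, hn] <;> push_cast <;> ring
  have g4 : exch f U V U' V' s (A + 1) b (x - 1) =
      gCoeff f (V' - V) s (A + 1) (X - 1) (Z - 1) (R + n - 1) (Q - 1) := by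
    unfold exch; congr 1 <;> (simp only [hX, hZ, hR, hQ, hn]; ring)
  have nn : f n ≠ 0 := by rw [hn]; exact hf.nat_ne s
  have nA : f ((A : ℂ) + 1) ≠ 0 := hf.nat_ne A
  have nQ : f Q ≠ 0 := by
    convert (hx (-2 * b - 1)).2.1 using 2; push_cast; rw [hQ]; ring
  have nQ1 : f (Q - 1) ≠ 0 := by
    convert (hx (-2 * b - 2)).2.1 using 2; push_cast; rw [hQ]; ring
  have nQn : f (Q - n) ≠ 0 := by
    convert (hx (-2 * b - 2 - s)).2.1 using 2; push_cast; rw [hQ, hn]; ring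
  have nR : f R ≠ 0 := by
    convert (hx (-2 * b - s - 1)).2.2.1 using 2; push_cast; rw [hR]; ring
  have nRn : f (R - n) ≠ 0 := by
    convert (hx (-2 * b - s - s - 2)).2.2.1 using 2; push_cast; rw [hR, hn]; ring
  have nRn1 : f (R - n + 1) ≠ 0 := by
    convert (hx (-2 * b - s - s - 1)).2.2.1 using 2; push_cast; rw [hR, hn]; ring
  have pf := hf.partialFraction (α := α) (β := β) (X := X) (Z := Z) (Q := Q) (n := n) (R := R)
    (by simp only [hα, hβ, hX, hZ, hR, hQ, hn]; ring) nn nQ nR nQn nRn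
  rw [g1, g2, g3, g4, gCoeff_succ, gCoeff_shift₀ _ _ nQ1, gCoeff_succ_shift₁,
    gCoeff_shift₁ _ _ (by convert nRn1 using 2; rw [hn]; ring) nA]
  generalize gCore f (V' - V) s A X Z (R + n) Q = C
  simp only [locMM, locMP, locPM]
  rw [show U + ((A : ℂ) + s + 1) + 1 = α by rw [hα]; ring, ← hβ,
    show (A : ℂ) + s + 1 = A + n by rw [hn]; ring,
    show V' - V + (s : ℂ) = Q - R by rw [hQ, hR]; ring, ← hn,
    show R + n - s - 1 = R by rw [hn]; ring,
    show U - (x + (V' - U') - 2 * ((b : ℂ) + 1)) + (A + n) = α - Q by rw [hα, hQ, hn]; ring,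
    show x + (V' - U') - 2 * ((b : ℂ) + 1) = Q - 1 by rw [hQ]; ring,
    show V' + x - b = β + Q by rw [hβ, hQ]; ring,
    show x + (V' - U') - 2 * (b : ℂ) - 1 = Q by rw [hQ]; ring,
    show V' - U' - (b : ℂ) = Q - X by rw [hQ, hX]; ring,
    show V - U - ((A : ℂ) + s) = Z - Q by rw [hZ, hQ]; ring,
    show Q - (s : ℂ) - 1 = Q - n by rw [hn]; ring,
    show U + (A : ℂ) + 1 = α - n by rw [hα, hn]; ring,
    show U' + ((b : ℂ) + s + 1) + 1 = β + n by rw [hβ, hn]; ring,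
    show X - (s : ℂ) - 1 = X - n by rw [hn]; ring,
    show Z - (s : ℂ) - 1 = Z - n by rw [hn]; ring,
    show R + n - 2 * (s : ℂ) - 2 = R - n by rw [hn]; ring,
    show U - (x + (V - U') - 2 * ((b : ℂ) + s + 1)) + (A + 1) = α - R by rw [hα, hR]; ring,
    show x + (V - U') - 2 * ((b : ℂ) + s + 1) = R - n by rw [hR, hn]; ring,
    show V + x - ((b : ℂ) + s) = β + R by rw [hβ, hR]; ring,
    show x + (V - U') - 2 * ((b : ℂ) + s) - 1 = R - n + 1 by rw [hR, hn]; ring,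
    show V - U' - ((b : ℂ) + s) = R - X by rw [hR, hX]; ring,
    show V' - U - (A : ℂ) = Z - R by rw [hZ, hR]; ring,
    show R + n - 2 * (s : ℂ) - 1 = R - n + 1 by rw [hn]; ring]
  refine add_eq_add_of_mul (-C * f (A + n)) pf ?_ ?_ ?_ ?_
  · field_simp
  · field_simp
  · field_simp
  · field_simp

/-- The same mechanism, but the brackets of `b` coming from `L_{-+}` and `L_{++}` replace the zero
`X` by `-b`; the leftover `f X / f x` is common to all four terms. -/
theorem exchange_mp (A b s : ℕ) :
    locMM f U (A + s + 1) * locMP f U' b x * exch f U V U' V' (s + 1) A (b - 1) x +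
      locMP f U (A + s + 1) (x + (V' - U') - 2 * b) * locPP f U' V' b x *
        (f (V - U - (A + s)) * exch f U V U' V' s A b x) =
    locMM f U A * locMP f U' (b + s + 1) x * exch f U V U' V' (s + 1) A b (x + 1) +
      locMP f U (A + 1) (x + (V - U') - 2 * (b + s)) * locPP f U' V (b + s) x *
        (f (V' - U - A) * exch f U V U' V' s (A + 1) b (x + 1)) := by
  obtain ⟨α, hα⟩ : ∃ α, α = U + A + s + 2 := ⟨_, rfl⟩
  obtain ⟨β, hβ⟩ : ∃ β, β = U' - x + b := ⟨_, rfl⟩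
  obtain ⟨X, hX⟩ : ∃ X, X = x - b := ⟨_, rfl⟩
  obtain ⟨Z, hZ⟩ : ∃ Z, Z = x + (V - U) + (V' - U') - (A + s + 1) - 2 * b + 2 := ⟨_, rfl⟩
  obtain ⟨R, hR⟩ : ∃ R, R = x + V - U' - 2 * b - s + 1 := ⟨_, rfl⟩
  obtain ⟨Q, hQ⟩ : ∃ Q, Q = x + V' - U' - 2 * b + 1 := ⟨_, rfl⟩
  obtain ⟨n, hn⟩ : ∃ n : ℂ, n = s + 1 := ⟨_, rfl⟩
  have g1 : exch f U V U' V' (s + 1) A (b - 1) x =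
      gCoeff f (V' - V) (s + 1) A X Z (R + n) Q := by
    unfold exch; congr 1 <;> simp only [hX, hZ, hR, hQ, hn] <;> push_cast <;> ring
  have g2 : exch f U V U' V' s A b x =
      gCoeff f (V' - V) s A (X - 1) (Z - 1) (R + n - 2) (Q - 2) := by
    unfold exch; congr 1 <;> (simp only [hX, hZ, hR, hQ, hn]; ring)
  have g3 : exch f U V U' V' (s + 1) A b (x + 1) =
      gCoeff f (V' - V) (s + 1) A X (Z - 1) (R + n - 1) (Q - 1) := by
    unfold exch; congr 1 <;> simp only [hX, hZ, hR, hQ, hn] <;> push_cast <;> ring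
  have g4 : exch f U V U' V' s (A + 1) b (x + 1) =
      gCoeff f (V' - V) s (A + 1) X (Z - 1) (R + n - 1) (Q - 1) := by
    unfold exch; congr 1 <;> (simp only [hX, hZ, hR, hQ, hn]; ring)
  have nx : f x ≠ 0 := by simpa using (hx 0).1
  have nXs : f (X - s) ≠ 0 := by
    convert (hx (-b - s)).1 using 2; push_cast; rw [hX]; ring
  have nn : f n ≠ 0 := by rw [hn]; exact hf.nat_ne s
  have nA : f ((A : ℂ) + 1) ≠ 0 := hf.nat_ne A
  have nQ : f Q ≠ 0 := by
    convert (hx (-2 * b + 1)).2.1 using 2; push_cast; rw [hQ]; ring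
  have nQ1 : f (Q - 1) ≠ 0 := by
    convert (hx (-2 * b)).2.1 using 2; push_cast; rw [hQ]; ring
  have nQn : f (Q - n) ≠ 0 := by
    convert (hx (-2 * b - s)).2.1 using 2; push_cast; rw [hQ, hn]; ring
  have nR : f R ≠ 0 := by
    convert (hx (-2 * b - s + 1)).2.2.1 using 2; push_cast; rw [hR]; ring
  have nRn : f (R - n) ≠ 0 := by
    convert (hx (-2 * b - s - s)).2.2.1 using 2; push_cast; rw [hR, hn]; ring
  have nRn1 : f (R - n + 1) ≠ 0 := by
    convert (hx (-2 * b - s - s + 1)).2.2.1 using 2; push_cast; rw [hR, hn]; ring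
  have pf := hf.partialFraction (α := α) (β := β) (X := -b) (Z := Z) (Q := Q) (n := n) (R := R)
    (by simp only [hα, hβ, hZ, hR, hQ, hn]; ring) nn nQ nR nQn nRn
  rw [sub_neg_eq_add, sub_neg_eq_add, hf.odd, show -(b : ℂ) - n = -(b + n) by ring,
    hf.odd] at pf
  rw [g1, g2, g3, g4, gCoeff_succ, gCoeff_shift₀ _ _ nQ1, gCoeff_succ_shift₂,
    gCoeff_shift₂ _ _ (by convert nRn1 using 2; rw [hn]; ring) nA nXs]
  generalize gCore f (V' - V) s A X Z (R + n) Q = C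
  simp only [locMM, locMP, locPP]
  rw [show U + ((A : ℂ) + s + 1) + 1 = α by rw [hα]; ring, ← hβ,
    show (A : ℂ) + s + 1 = A + n by rw [hn]; ring,
    show V' - V + (s : ℂ) = Q - R by rw [hQ, hR]; ring, ← hn,
    show R + n - s - 1 = R by rw [hn]; ring,
    show U - (x + (V' - U') - 2 * (b : ℂ)) + (A + n) = α - Q by rw [hα, hQ, hn]; ring,
    show V' - (b : ℂ) + 1 = β + Q by rw [hβ, hQ]; ring,
    show x + (V' - U') - (b : ℂ) + 1 = Q + b by rw [hQ]; ring,
    show x + (V' - U') - 2 * (b : ℂ) + 1 = Q by rw [hQ]; ring,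
    show x + (V' - U') - 2 * (b : ℂ) = Q - 1 by rw [hQ]; ring,
    show V - U - ((A : ℂ) + s) = Z - Q by rw [hZ, hQ]; ring, ← hX,
    show Q - (s : ℂ) - 1 = Q - n by rw [hn]; ring,
    show U + (A : ℂ) + 1 = α - n by rw [hα, hn]; ring,
    show U' - x + ((b : ℂ) + s + 1) = β + n by rw [hβ, hn]; ring,
    show (b : ℂ) + s + 1 = b + n by rw [hn]; ring,
    show Z - (s : ℂ) - 1 = Z - n by rw [hn]; ring,
    show R + n - 2 * (s : ℂ) - 2 = R - n by rw [hn]; ring,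
    show U - (x + (V - U') - 2 * ((b : ℂ) + s)) + (A + 1) = α - R by rw [hα, hR]; ring,
    show V - ((b : ℂ) + s) + 1 = β + R by rw [hβ, hR]; ring,
    show x + (V - U') - ((b : ℂ) + s) + 1 = R + b by rw [hR]; ring,
    show x + (V - U') - 2 * ((b : ℂ) + s) + 1 = R - n + 1 by rw [hR, hn]; ring,
    show x + (V - U') - 2 * ((b : ℂ) + s) = R - n by rw [hR, hn]; ring,
    show x - ((b : ℂ) + s) = X - s by rw [hX]; ring,
    show V' - U - (A : ℂ) = Z - R by rw [hZ, hR]; ring,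
    show R + n - 2 * (s : ℂ) - 1 = R - n + 1 by rw [hn]; ring]
  refine add_eq_add_of_mul (-C * f (A + n) * f X / f x) pf ?_ ?_ ?_ ?_
  · field_simp
  · field_simp
  · field_simp
  · field_simp

/-- Here the zero `Z` of the partial fraction identity is replaced by `A + n`, and the leftover
common factor is `f Z / f D`. -/
theorem exchange_pm (A b s : ℕ) :
    locPP f U V (A + s) (x + (V' - U') - 2 * (b + 1)) *
        (locPM f U' V' b x * f (V' - U' - b)) * exch f U V U' V' s A (b + 1) x +
      locPM f U V (A + s) (x + (V' - U') - 2 * b) * locMM f U' b *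
        exch f U V U' V' (s + 1) A b x =
    locPP f U V' A (x + (V - U') - 2 * (b + s + 1)) *
        (locPM f U' V (b + s) x * f (V - U' - (b + s))) * exch f U V U' V' s A b (x - 1) +
      locPM f U V' (A - 1) (x + (V - U') - 2 * (b + s + 1)) * locMM f U' (b + s + 1) *
        exch f U V U' V' (s + 1) (A - 1) b (x - 1) := by
  obtain ⟨α, hα⟩ : ∃ α, α = V + x + (V' - U') - 2 * b - (A + s) := ⟨_, rfl⟩
  obtain ⟨β, hβ⟩ : ∃ β, β = U' + b + 1 := ⟨_, rfl⟩
  obtain ⟨X, hX⟩ : ∃ X, X = x - 1 - b := ⟨_, rfl⟩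
  obtain ⟨Z, hZ⟩ : ∃ Z, Z = x + (V - U) + (V' - U') - (A + s + 1) - 2 * b := ⟨_, rfl⟩
  obtain ⟨R, hR⟩ : ∃ R, R = x + V - U' - 2 * b - s - 1 := ⟨_, rfl⟩
  obtain ⟨Q, hQ⟩ : ∃ Q, Q = x + V' - U' - 2 * b - 1 := ⟨_, rfl⟩
  obtain ⟨n, hn⟩ : ∃ n : ℂ, n = s + 1 := ⟨_, rfl⟩
  obtain ⟨D, hD⟩ : ∃ D, D = Z - A - s := ⟨_, rfl⟩
  have g1 : exch f U V U' V' (s + 1) A b x = gCoeff f (V' - V) (s + 1) A X Z (R + n) Q := by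
    unfold exch; congr 1 <;> simp only [hX, hZ, hR, hQ, hn] <;> push_cast <;> ring
  have g2 : exch f U V U' V' s A (b + 1) x =
      gCoeff f (V' - V) s A (X - 1) (Z - 1) (R + n - 2) (Q - 2) := by
    unfold exch; congr 1 <;> (simp only [hX, hZ, hR, hQ, hn]; ring)
  have g3 : exch f U V U' V' s A b (x - 1) =
      gCoeff f (V' - V) s A (X - 1) Z (R + n - 1) (Q - 1) := by
    unfold exch; congr 1 <;> (simp only [hX, hZ, hR, hQ, hn]; ring)
  have g4 : exch f U V U' V' (s + 1) (A - 1) b (x - 1) =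
      gCoeff f (V' - V) (s + 1) (A - 1) (X - 1) Z (R + n - 1) (Q - 1) := by
    unfold exch; congr 1 <;> simp only [hX, hZ, hR, hQ, hn] <;> push_cast <;> ring
  have nn : f n ≠ 0 := by rw [hn]; exact hf.nat_ne s
  have nQ : f Q ≠ 0 := by
    convert (hx (-2 * b - 1)).2.1 using 2; push_cast; rw [hQ]; ring
  have nQ1 : f (Q - 1) ≠ 0 := by
    convert (hx (-2 * b - 2)).2.1 using 2; push_cast; rw [hQ]; ring
  have nQn : f (Q - n) ≠ 0 := by
    convert (hx (-2 * b - 2 - s)).2.1 using 2; push_cast; rw [hQ, hn]; ring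
  have nR : f R ≠ 0 := by
    convert (hx (-2 * b - s - 1)).2.2.1 using 2; push_cast; rw [hR]; ring
  have nRn : f (R - n) ≠ 0 := by
    convert (hx (-2 * b - s - s - 2)).2.2.1 using 2; push_cast; rw [hR, hn]; ring
  have nRn1 : f (R - n + 1) ≠ 0 := by
    convert (hx (-2 * b - s - s - 1)).2.2.1 using 2; push_cast; rw [hR, hn]; ring
  have nZs : f (Z - s) ≠ 0 := by
    convert (hx (-2 * b - (A + s + 1) - s)).2.2.2 using 2; push_cast; rw [hZ]; ring
  have nD : f D ≠ 0 := by
    convert (hx (-2 * b - (A + s + 1) - A - s)).2.2.2 using 2; push_cast; rw [hD, hZ]; ring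
  have pf := hf.partialFraction (α := α) (β := β) (X := X) (Z := A + n) (Q := Q) (n := n) (R := R)
    (by simp only [hα, hβ, hX, hR, hQ, hn]; ring) nn nQ nR nQn nRn
  rw [hf.sub_comm (A + n) Q, hf.sub_comm (A + n) R, add_sub_cancel_right] at pf
  rw [g1, g2, g3, g4, gCoeff_succ, gCoeff_shift₀ _ _ nQ1,
    gCoeff_shift₃ _ _ (by convert nRn1 using 2; rw [hn]; ring) nZs, gCoeff_succ_shift₃]
  generalize gCore f (V' - V) s A X Z (R + n) Q = C
  simp only [locMM, locPM, locPP]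
  rw [show V - ((A : ℂ) + s) + 1 = α - Q by rw [hα, hQ]; ring,
    show x + (V' - U') - 2 * ((b : ℂ) + 1) + (V - U) - (A + s) + 1 = Z by rw [hZ]; ring,
    show x + (V' - U') - 2 * ((b : ℂ) + 1) - (A + s) = Q - (A + n) by rw [hQ, hn]; ring,
    show x + (V' - U') - 2 * ((b : ℂ) + 1) + (V - U) - 2 * (A + s) + 1 = D by
      rw [hD, hZ]; ring,
    show x + (V' - U') - 2 * ((b : ℂ) + 1) = Q - 1 by rw [hQ]; ring,
    show V' + x - b = β + Q by rw [hβ, hQ]; ring,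
    show x + (V' - U') - 2 * (b : ℂ) - 1 = Q by rw [hQ]; ring,
    show V' - U' - (b : ℂ) = Q - X by rw [hQ, hX]; ring,
    show V + (x + (V' - U') - 2 * (b : ℂ)) - (A + s) = α by rw [hα]; ring,
    show x + (V' - U') - 2 * (b : ℂ) + (V - U) - 2 * (A + s) - 1 = D by rw [hD, hZ]; ring,
    ← hβ,
    show (A : ℂ) + s + 1 = A + n by rw [hn]; ring,
    show V' - V + (s : ℂ) = Q - R by rw [hQ, hR]; ring, ← hn,
    show R + n - s - 1 = R by rw [hn]; ring,
    show Q - (s : ℂ) - 1 = Q - n by rw [hn]; ring,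
    show V' - (A : ℂ) + 1 = α - R by rw [hα, hR]; ring,
    show x + (V - U') - 2 * ((b : ℂ) + s + 1) + (V' - U) - A + 1 = Z - s by rw [hZ]; ring,
    show x + (V - U') - 2 * ((b : ℂ) + s + 1) - A = R - (A + n) by rw [hR, hn]; ring,
    show x + (V - U') - 2 * ((b : ℂ) + s + 1) + (V' - U) - 2 * A + 1 = D by rw [hD, hZ]; ring,
    show V' + (x + (V - U') - 2 * ((b : ℂ) + s + 1)) - (A - 1) = α - n by rw [hα, hn]; ring,
    show x + (V - U') - 2 * ((b : ℂ) + s + 1) + (V' - U) - 2 * (A - 1) - 1 = D by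
      rw [hD, hZ]; ring,
    show x + (V - U') - 2 * ((b : ℂ) + s + 1) = R - n by rw [hR, hn]; ring,
    show V + x - ((b : ℂ) + s) = β + R by rw [hβ, hR]; ring,
    show x + (V - U') - 2 * ((b : ℂ) + s) - 1 = R - n + 1 by rw [hR, hn]; ring,
    show V - U' - ((b : ℂ) + s) = R - X by rw [hR, hX]; ring,
    show U' + ((b : ℂ) + s + 1) + 1 = β + n by rw [hβ, hn]; ring,
    show X - (s : ℂ) - 1 = X - n by rw [hn]; ring,
    show R + n - 2 * (s : ℂ) - 2 = R - n by rw [hn]; ring,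
    show R + n - 2 * (s : ℂ) - 1 = R - n + 1 by rw [hn]; ring]
  refine add_eq_add_of_mul (-C * f Z / f D) ((add_comm _ _).trans (pf.trans (add_comm _ _)))
    ?_ ?_ ?_ ?_
  · field_simp
  · field_simp
  · field_simp
  · field_simp

/-- Both replacements at once: the zeros are `α, -β, -b, A + n`, and both leftover factors appear.
-/
theorem exchange_pp (A b s : ℕ) :
    locPP f U V (A + s) (x + (V' - U') - 2 * b) * locPP f U' V' b x *
        exch f U V U' V' s A b x +
      locPM f U V (A + s) (x + (V' - U') - 2 * (b - 1)) * locMP f U' b x *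
        exch f U V U' V' (s + 1) A (b - 1) x =
    locPP f U V' A (x + (V - U') - 2 * (b + s)) * locPP f U' V (b + s) x *
        exch f U V U' V' s A b (x + 1) +
      locPM f U V' (A - 1) (x + (V - U') - 2 * (b + s)) * locMP f U' (b + s + 1) x *
        exch f U V U' V' (s + 1) (A - 1) b (x + 1) := by
  obtain ⟨α, hα⟩ : ∃ α, α = V + x + (V' - U') - 2 * b + 2 - (A + s) := ⟨_, rfl⟩
  obtain ⟨β, hβ⟩ : ∃ β, β = U' - x + b := ⟨_, rfl⟩
  obtain ⟨X, hX⟩ : ∃ X, X = x - b := ⟨_, rfl⟩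
  obtain ⟨Z, hZ⟩ : ∃ Z, Z = x + (V - U) + (V' - U') - (A + s + 1) - 2 * b + 2 := ⟨_, rfl⟩
  obtain ⟨R, hR⟩ : ∃ R, R = x + V - U' - 2 * b - s + 1 := ⟨_, rfl⟩
  obtain ⟨Q, hQ⟩ : ∃ Q, Q = x + V' - U' - 2 * b + 1 := ⟨_, rfl⟩
  obtain ⟨n, hn⟩ : ∃ n : ℂ, n = s + 1 := ⟨_, rfl⟩
  obtain ⟨D, hD⟩ : ∃ D, D = Z - A - s := ⟨_, rfl⟩
  have g1 : exch f U V U' V' (s + 1) A (b - 1) x =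
      gCoeff f (V' - V) (s + 1) A X Z (R + n) Q := by
    unfold exch; congr 1 <;> simp only [hX, hZ, hR, hQ, hn] <;> push_cast <;> ring
  have g2 : exch f U V U' V' s A b x =
      gCoeff f (V' - V) s A (X - 1) (Z - 1) (R + n - 2) (Q - 2) := by
    unfold exch; congr 1 <;> (simp only [hX, hZ, hR, hQ, hn]; ring)
  have g3 : exch f U V U' V' s A b (x + 1) =
      gCoeff f (V' - V) s A X Z (R + n - 1) (Q - 1) := by
    unfold exch; congr 1 <;> (simp only [hX, hZ, hR, hQ, hn]; ring)
  have g4 : exch f U V U' V' (s + 1) (A - 1) b (x + 1) =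
      gCoeff f (V' - V) (s + 1) (A - 1) X Z (R + n - 1) (Q - 1) := by
    unfold exch; congr 1 <;> simp only [hX, hZ, hR, hQ, hn] <;> push_cast <;> ring
  have nx : f x ≠ 0 := by simpa using (hx 0).1
  have nXs : f (X - s) ≠ 0 := by
    convert (hx (-b - s)).1 using 2; push_cast; rw [hX]; ring
  have nn : f n ≠ 0 := by rw [hn]; exact hf.nat_ne s
  have nQ : f Q ≠ 0 := by
    convert (hx (-2 * b + 1)).2.1 using 2; push_cast; rw [hQ]; ring
  have nQ1 : f (Q - 1) ≠ 0 := by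
    convert (hx (-2 * b)).2.1 using 2; push_cast; rw [hQ]; ring
  have nQn : f (Q - n) ≠ 0 := by
    convert (hx (-2 * b - s)).2.1 using 2; push_cast; rw [hQ, hn]; ring
  have nR : f R ≠ 0 := by
    convert (hx (-2 * b - s + 1)).2.2.1 using 2; push_cast; rw [hR]; ring
  have nRn : f (R - n) ≠ 0 := by
    convert (hx (-2 * b - s - s)).2.2.1 using 2; push_cast; rw [hR, hn]; ring
  have nRn1 : f (R - n + 1) ≠ 0 := by
    convert (hx (-2 * b - s - s + 1)).2.2.1 using 2; push_cast; rw [hR, hn]; ring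
  have nZs : f (Z - s) ≠ 0 := by
    convert (hx (-2 * b + 2 - (A + s + 1) - s)).2.2.2 using 2; push_cast; rw [hZ]; ring
  have nD : f D ≠ 0 := by
    convert (hx (-2 * b + 2 - (A + s + 1) - A - s)).2.2.2 using 2; push_cast; rw [hD, hZ]; ring
  have pf := hf.partialFraction (α := α) (β := β) (X := -b) (Z := A + n) (Q := Q) (n := n) (R := R)
    (by simp only [hα, hβ, hR, hQ, hn]; ring) nn nQ nR nQn nRn
  rw [hf.sub_comm (A + n) Q, hf.sub_comm (A + n) R, add_sub_cancel_right, sub_neg_eq_add,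
    sub_neg_eq_add, hf.odd, show -(b : ℂ) - n = -(b + n) by ring, hf.odd] at pf
  rw [g1, g2, g3, g4, gCoeff_succ, gCoeff_shift₀ _ _ nQ1,
    gCoeff_shift₄ _ _ (by convert nRn1 using 2; rw [hn]; ring) nZs nXs, gCoeff_succ_shift₄]
  generalize gCore f (V' - V) s A X Z (R + n) Q = C
  simp only [locMP, locPM, locPP]
  rw [show V - ((A : ℂ) + s) + 1 = α - Q by rw [hα, hQ]; ring,
    show x + (V' - U') - 2 * (b : ℂ) + (V - U) - (A + s) + 1 = Z by rw [hZ]; ring,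
    show x + (V' - U') - 2 * (b : ℂ) - (A + s) = Q - (A + n) by rw [hQ, hn]; ring,
    show x + (V' - U') - 2 * (b : ℂ) + (V - U) - 2 * (A + s) + 1 = D by rw [hD, hZ]; ring,
    show V' - (b : ℂ) + 1 = β + Q by rw [hβ, hQ]; ring,
    show x + (V' - U') - (b : ℂ) + 1 = Q + b by rw [hQ]; ring,
    show x + (V' - U') - 2 * (b : ℂ) + 1 = Q by rw [hQ]; ring,
    show x + (V' - U') - 2 * (b : ℂ) = Q - 1 by rw [hQ]; ring,
    show V + (x + (V' - U') - 2 * ((b : ℂ) - 1)) - (A + s) = α by rw [hα]; ring,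
    show x + (V' - U') - 2 * ((b : ℂ) - 1) + (V - U) - 2 * (A + s) - 1 = D by
      rw [hD, hZ]; ring,
    ← hβ, ← hX,
    show (A : ℂ) + s + 1 = A + n by rw [hn]; ring,
    show V' - V + (s : ℂ) = Q - R by rw [hQ, hR]; ring, ← hn,
    show R + n - s - 1 = R by rw [hn]; ring,
    show Q - (s : ℂ) - 1 = Q - n by rw [hn]; ring,
    show V' - (A : ℂ) + 1 = α - R by rw [hα, hR]; ring,
    show x + (V - U') - 2 * ((b : ℂ) + s) + (V' - U) - A + 1 = Z - s by rw [hZ]; ring,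
    show x + (V - U') - 2 * ((b : ℂ) + s) - A = R - (A + n) by rw [hR, hn]; ring,
    show x + (V - U') - 2 * ((b : ℂ) + s) + (V' - U) - 2 * A + 1 = D by rw [hD, hZ]; ring,
    show V' + (x + (V - U') - 2 * ((b : ℂ) + s)) - (A - 1) = α - n by rw [hα, hn]; ring,
    show x + (V - U') - 2 * ((b : ℂ) + s) + (V' - U) - 2 * (A - 1) - 1 = D by
      rw [hD, hZ]; ring,
    show V - ((b : ℂ) + s) + 1 = β + R by rw [hβ, hR]; ring,
    show x + (V - U') - ((b : ℂ) + s) + 1 = R + b by rw [hR]; ring,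
    show x + (V - U') - 2 * ((b : ℂ) + s) + 1 = R - n + 1 by rw [hR, hn]; ring,
    show x + (V - U') - 2 * ((b : ℂ) + s) = R - n by rw [hR, hn]; ring,
    show x - ((b : ℂ) + s) = X - s by rw [hX]; ring,
    show U' - x + ((b : ℂ) + s + 1) = β + n by rw [hβ, hn]; ring,
    show (b : ℂ) + s + 1 = b + n by rw [hn]; ring,
    show R + n - 2 * (s : ℂ) - 2 = R - n by rw [hn]; ring,
    show R + n - 2 * (s : ℂ) - 1 = R - n + 1 by rw [hn]; ring]
  refine add_eq_add_of_mul (-C * f Z / f D * f X / f x)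
    ((add_comm _ _).trans (pf.trans (add_comm _ _))) ?_ ?_ ?_ ?_
  · field_simp
  · field_simp
  · field_simp
  · field_simp

end Local

end EllipticSl2

namespace EllipticSl2

/-! ### Operators on functions -/

/-- Shift of a sequence by one step, with value zero at `0`. -/
def predFun (g : ℕ → ℂ) : ℕ → ℂ
  | 0 => 0
  | j + 1 => g j

@[simp] theorem predFun_zero (g : ℕ → ℂ) : predFun g 0 = 0 := rfl

@[simp] theorem predFun_succ (g : ℕ → ℂ) (j : ℕ) : predFun g (j + 1) = g j := rfl

theorem sum_units_int (g : ℤˣ → ℂ) : ∑ k, g k = g 1 + g (-1) := by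
  rw [UnitsInt.univ, Finset.sum_pair (by decide)]

section Operators

variable (f : ℂ → ℂ)

/-- The operator `L_{ik}` on functions of `x` with values in the asymptotic representation. -/
noncomputable def lop (U V : ℂ) (i k : ℤˣ) (Φ : ℂ → ℕ → ℂ) (x : ℂ) (j : ℕ) : ℂ :=
  if i = 1 then
    if k = 1 then locPP f U V j x * Φ (x + 1) j
    else predFun (fun j => locPM f U V j x * f (V - U - j) * Φ (x - 1) j) j
  else
    if k = 1 then locMP f U (j + 1) x * Φ (x + 1) (j + 1)
    else locMM f U j * Φ (x - 1) j

variable {f}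

@[simp] theorem lop_pp (U V : ℂ) (Φ : ℂ → ℕ → ℂ) (x : ℂ) (j : ℕ) :
    lop f U V 1 1 Φ x j = locPP f U V j x * Φ (x + 1) j := rfl

@[simp] theorem lop_pm (U V : ℂ) (Φ : ℂ → ℕ → ℂ) (x : ℂ) (j : ℕ) :
    lop f U V 1 (-1) Φ x j =
      predFun (fun j => locPM f U V j x * f (V - U - j) * Φ (x - 1) j) j := rfl

@[simp] theorem lop_mp (U V : ℂ) (Φ : ℂ → ℕ → ℂ) (x : ℂ) (j : ℕ) :
    lop f U V (-1) 1 Φ x j = locMP f U (j + 1) x * Φ (x + 1) (j + 1) := rfl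

@[simp] theorem lop_mm (U V : ℂ) (Φ : ℂ → ℕ → ℂ) (x : ℂ) (j : ℕ) :
    lop f U V (-1) (-1) Φ x j = locMM f U j * Φ (x - 1) j := rfl

variable (f)

/-- The operator `L_{ij}` on the tensor product of two asymptotic representations. -/
noncomputable def top (U V U' V' : ℂ) (i j : ℤˣ) (Φ : ℂ → ℕ → ℕ → ℂ) (x : ℂ) (A B : ℕ) : ℂ :=
  ∑ k : ℤˣ, lop f U V i k (fun _ A' => lop f U' V' k j (fun x' B' => Φ x' A' B') x B)
    (x + (V' - U') - 2 * B) A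

/-- Coefficients independent of `x` of the exchange operator. -/
noncomputable def exchWeight (U V V' : ℂ) (A s : ℕ) : ℂ :=
  fallProd f (V' - U) A / fallProd f (V - U) (A + s)

/-- The operator exchanging `V` and `V'`. -/
noncomputable def sop (U V U' V' : ℂ) (Φ : ℂ → ℕ → ℕ → ℂ) (x : ℂ) (A B : ℕ) : ℂ :=
  ∑ p ∈ Finset.HasAntidiagonal.antidiagonal B, exchWeight f U V V' A p.1 * exch f U V U' V' p.1 A p.2 x *
    Φ x (A + p.1) p.2

variable {f} {U V U' V' : ℂ}

/-- The weights absorb the brackets `f(V - U - j)` and `f(V' - U - j)` that `locPM` omits. This and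
`exchWeight_succ` bring terms with neighbouring indices to a common weight. -/
theorem exchWeight_eq (h : ∀ i : ℕ, f (V - U - i) ≠ 0) (A s : ℕ) :
    exchWeight f U V V' A s = exchWeight f U V V' A (s + 1) * f (V - U - (A + s)) := by
  have := h (A + s)
  rw [exchWeight, exchWeight, ← add_assoc, fallProd_succ_right]
  push_cast at this ⊢
  field_simp

theorem exchWeight_succ (A s : ℕ) :
    exchWeight f U V V' (A + 1) s = exchWeight f U V V' A (s + 1) * f (V' - U - A) := by
  rw [exchWeight, exchWeight, fallProd_succ_right, show A + 1 + s = A + (s + 1) by ring]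
  ring

theorem exch_zero (A b x : ℂ) : exch f U V U' V' 0 A b x = 1 := gCoeff_zero ..

/-- The falling product runs through `f 0`. Hence the term with `A - 1` in a local relation drops
out at `A = 0`, where the operators have no such term. -/
theorem exch_neg_one (hf : IsBracket f) (s : ℕ) (b x : ℂ) :
    exch f U V U' V' (s + 1) (0 - 1) b x = 0 := by
  have : fallProd f ((0 : ℂ) - 1 + (s + 1 : ℕ)) (s + 1) = 0 := by
    refine Finset.prod_eq_zero (Finset.self_mem_range_succ s) ?_
    push_cast
    rw [show (0 : ℂ) - 1 + (s + 1) - s = 0 by ring, hf.zero]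
  simp only [exch, gCoeff, this, mul_zero, zero_div, zero_mul]

theorem locMP_zero (hf : IsBracket f) (U x : ℂ) : locMP f U 0 x = 0 := by
  simp [locMP, hf.zero]

theorem locPM_exchange (j x : ℂ) :
    locPM f U V j (x + (V' - U')) = locPM f U V' j (x + (V - U')) := by
  simp only [locPM]
  congr 2 <;> ring

theorem sum_antidiagonal_pred (g : ℕ → ℕ → ℂ) (h : ∀ s, g s 0 = 0) (B : ℕ) :
    ∑ p ∈ Finset.HasAntidiagonal.antidiagonal B, g p.1 (p.2 + 1) = ∑ p ∈ Finset.HasAntidiagonal.antidiagonal (B + 1), g p.1 p.2 := by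
  rw [Finset.Nat.sum_antidiagonal_succ' (f := fun p => g p.1 p.2)]
  simp [h]

variable (hf : IsBracket f) (hU : ∀ i : ℕ, f (V - U - i) ≠ 0) {x : ℂ}
  (hx : Regular f U V U' V' x)
include hf hU hx

/-- Both sides are sorted by the values of `Φ` they contain. One boundary term, with nothing moved
between the factors, agrees at sight; for every `s + b = B` two terms remain on each side, and they
match by `exchange_mm`. -/
theorem sop_top_mm (Φ : ℂ → ℕ → ℕ → ℂ) (A B : ℕ) :
    sop f U V U' V' (top f U V U' V' (-1) (-1) Φ) x A B =
      top f U V' U' V (-1) (-1) (sop f U V U' V' Φ) x A B := by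
  cases B with
  | zero => simp [sop, top, exch_zero]; ring
  | succ B =>
    have hL : sop f U V U' V' (top f U V U' V' (-1) (-1) Φ) x A (B + 1) =
        exchWeight f U V V' A 0 * (locMM f U A * locMM f U' (B + 1 : ℕ) * Φ (x - 1) A (B + 1)) +
        (∑ p ∈ Finset.HasAntidiagonal.antidiagonal B, exchWeight f U V V' A (p.1 + 1) *
          exch f U V U' V' (p.1 + 1) A p.2 x * (locMM f U (A + (p.1 + 1) : ℕ) *
            locMM f U' p.2 * Φ (x - 1) (A + (p.1 + 1)) p.2) +
        ∑ p ∈ Finset.HasAntidiagonal.antidiagonal B, exchWeight f U V V' A p.1 *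
          exch f U V U' V' p.1 A (p.2 + 1 : ℕ) x *
            (locMP f U ((A + p.1 : ℕ) + 1) (x + (V' - U') - 2 * (p.2 + 1 : ℕ)) *
            (locPM f U' V' p.2 x * f (V' - U' - p.2)) * Φ (x - 1) (A + p.1 + 1) p.2)) := by
      rw [sop]
      simp only [top, sum_units_int, lop_mp, lop_mm, lop_pm, mul_add, Finset.sum_add_distrib]
      rw [Finset.Nat.sum_antidiagonal_succ', Finset.Nat.sum_antidiagonal_succ]
      simp only [predFun_zero, predFun_succ, mul_zero, zero_add, exch_zero, add_zero]
      simp only [mul_assoc, mul_one]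
      ring
    have hR : top f U V' U' V (-1) (-1) (sop f U V U' V' Φ) x A (B + 1) =
        exchWeight f U V V' A 0 * (locMM f U A * locMM f U' (B + 1 : ℕ) * Φ (x - 1) A (B + 1)) +
        (∑ p ∈ Finset.HasAntidiagonal.antidiagonal B, locMM f U A * locMM f U' (B + 1 : ℕ) *
          (exchWeight f U V V' A (p.1 + 1) *
          exch f U V U' V' (p.1 + 1) A p.2 (x - 1) * Φ (x - 1) (A + (p.1 + 1)) p.2) +
        ∑ p ∈ Finset.HasAntidiagonal.antidiagonal B, locMP f U (A + 1) (x + (V - U') - 2 * (B + 1 : ℕ)) *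
            (locPM f U' V B x * f (V - U' - B)) * (exchWeight f U V V' (A + 1) p.1 *
          exch f U V U' V' p.1 (A + 1 : ℕ) p.2 (x - 1) * Φ (x - 1) (A + 1 + p.1) p.2)) := by
      simp only [top, sum_units_int, lop_mp, lop_mm, lop_pm, predFun_succ, sop]
      rw [Finset.Nat.sum_antidiagonal_succ, ← Finset.mul_sum, ← Finset.mul_sum]
      simp only [exch_zero, add_zero]
      ring
    rw [hL, hR, ← Finset.sum_add_distrib, ← Finset.sum_add_distrib]
    congr 1
    refine Finset.sum_congr rfl fun p hp => ?_
    obtain ⟨s, b⟩ := p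
    have hB : B = b + s := by rw [add_comm]; exact (Finset.HasAntidiagonal.mem_antidiagonal.1 hp).symm
    subst hB
    have key := exchange_mm hf hx A b s
    simp only [exchWeight_eq hU A s, exchWeight_succ,
      show A + (s + 1) = A + s + 1 by ring, show A + 1 + s = A + s + 1 by ring]
    push_cast
    linear_combination (exchWeight f U V V' A (s + 1) * Φ (x - 1) (A + s + 1) b) * key

theorem sop_top_mp (Φ : ℂ → ℕ → ℕ → ℂ) (A B : ℕ) :
    sop f U V U' V' (top f U V U' V' (-1) 1 Φ) x A B =
      top f U V' U' V (-1) 1 (sop f U V U' V' Φ) x A B := by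
  have hL : sop f U V U' V' (top f U V U' V' (-1) 1 Φ) x A B =
      exchWeight f U V V' A 0 * (locMM f U A * locMP f U' (B + 1 : ℕ) x * Φ (x + 1) A (B + 1)) +
      (∑ p ∈ Finset.HasAntidiagonal.antidiagonal B, exchWeight f U V V' A p.1 *
        exch f U V U' V' p.1 A p.2 x * (locMP f U ((A + p.1 : ℕ) + 1) (x + (V' - U') - 2 * p.2) *
          (locPP f U' V' p.2 x * Φ (x + 1) (A + p.1 + 1) p.2)) +
      ∑ p ∈ Finset.HasAntidiagonal.antidiagonal B, exchWeight f U V V' A (p.1 + 1) *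
        exch f U V U' V' (p.1 + 1) A (p.2 - 1) x * (locMM f U (A + (p.1 + 1) : ℕ) *
          (locMP f U' p.2 x * Φ (x + 1) (A + (p.1 + 1)) p.2))) := by
    have h := sum_antidiagonal_pred (fun s b => exchWeight f U V V' A s *
        exch f U V U' V' s A (b - 1) x * (locMM f U (A + s : ℕ) *
          (locMP f U' b x * Φ (x + 1) (A + s) b)))
      (fun s => by simp [locMP_zero hf]) B
    rw [Finset.Nat.sum_antidiagonal_succ] at h
    simp only [Nat.cast_add, Nat.cast_one, add_sub_cancel_right] at h
    rw [sop]
    simp only [top, sum_units_int, lop_mp, lop_mm, lop_pp, mul_add, Finset.sum_add_distrib]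
    push_cast
    rw [h]
    simp only [exch_zero, add_zero, Nat.cast_zero]
    ring
  have hR : top f U V' U' V (-1) 1 (sop f U V U' V' Φ) x A B =
      exchWeight f U V V' A 0 * (locMM f U A * locMP f U' (B + 1 : ℕ) x * Φ (x + 1) A (B + 1)) +
      (∑ p ∈ Finset.HasAntidiagonal.antidiagonal B, locMM f U A * locMP f U' (B + 1 : ℕ) x *
        (exchWeight f U V V' A (p.1 + 1) *
        exch f U V U' V' (p.1 + 1) A p.2 (x + 1) * Φ (x + 1) (A + (p.1 + 1)) p.2) +
      ∑ p ∈ Finset.HasAntidiagonal.antidiagonal B, locMP f U (A + 1) (x + (V - U') - 2 * B) *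
          locPP f U' V B x * (exchWeight f U V V' (A + 1) p.1 *
        exch f U V U' V' p.1 (A + 1 : ℕ) p.2 (x + 1) * Φ (x + 1) (A + 1 + p.1) p.2)) := by
    simp only [top, sum_units_int, lop_mp, lop_mm, lop_pp, sop]
    rw [Finset.Nat.sum_antidiagonal_succ, ← Finset.mul_sum, ← Finset.mul_sum]
    simp only [exch_zero, add_zero]
    push_cast
    ring
  rw [hL, hR, ← Finset.sum_add_distrib, ← Finset.sum_add_distrib]
  congr 1
  refine Finset.sum_congr rfl fun p hp => ?_
  obtain ⟨s, b⟩ := p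
  have hB : B = b + s := by rw [add_comm]; exact (Finset.HasAntidiagonal.mem_antidiagonal.1 hp).symm
  subst hB
  have key := exchange_mp hf hx A b s
  simp only [exchWeight_eq hU A s, exchWeight_succ,
    show A + (s + 1) = A + s + 1 by ring, show A + 1 + s = A + s + 1 by ring]
  push_cast
  linear_combination (exchWeight f U V V' A (s + 1) * Φ (x + 1) (A + s + 1) b) * key

omit hf hx in
-- For `L_{+-}` and `L_{++}` the boundary term lowers the index of the left factor, so the weight
-- changes too; the change compensates the passage from `f(V - U - j)` to `f(V' - U - j)`.
theorem exchWeight_predFun (c : ℕ → ℂ) (y : ℂ) (A : ℕ) :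
    exchWeight f U V V' A 0 *
        predFun (fun j => locPM f U V j (y + (V' - U')) * f (V - U - j) * c j) A =
      predFun (fun j => locPM f U V' j (y + (V - U')) * f (V' - U - j) *
        (exchWeight f U V V' j 0 * c j)) A := by
  cases A with
  | zero => simp
  | succ A =>
    simp only [predFun_succ]
    rw [locPM_exchange, exchWeight_succ, exchWeight_eq hU A 0]
    push_cast
    rw [add_zero]
    ring

theorem sop_top_pm (Φ : ℂ → ℕ → ℕ → ℂ) (A B : ℕ) :
    sop f U V U' V' (top f U V U' V' 1 (-1) Φ) x A B =
      top f U V' U' V 1 (-1) (sop f U V U' V' Φ) x A B := by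
  cases B with
  | zero =>
    have := exchWeight_predFun (V' := V') (U' := U') hU
      (fun j => locMM f U' 0 * Φ (x - 1) j 0) x A
    simpa [sop, top, exch_zero, mul_left_comm (locMM f U' 0)] using this
  | succ B =>
    have h0 := exchWeight_predFun (V' := V') (U' := U') hU
      (fun j => locMM f U' (B + 1 : ℕ) * Φ (x - 1) j (B + 1)) (x - 2 * (B + 1 : ℕ)) A
    simp only [show ∀ c : ℂ, x - 2 * (B + 1 : ℕ) + c = x + c - 2 * (B + 1 : ℕ) by
      intro c; ring] at h0
    have hL : sop f U V U' V' (top f U V U' V' 1 (-1) Φ) x A (B + 1) =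
        exchWeight f U V V' A 0 * predFun (fun j =>
          locPM f U V j (x + (V' - U') - 2 * (B + 1 : ℕ)) * f (V - U - j) *
            (locMM f U' (B + 1 : ℕ) * Φ (x - 1) j (B + 1))) A +
        (∑ p ∈ Finset.HasAntidiagonal.antidiagonal B, exchWeight f U V V' A p.1 *
          exch f U V U' V' p.1 A (p.2 + 1 : ℕ) x *
          (locPP f U V (A + p.1 : ℕ) (x + (V' - U') - 2 * (p.2 + 1 : ℕ)) *
            (locPM f U' V' p.2 x * f (V' - U' - p.2) * Φ (x - 1) (A + p.1) p.2)) +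
        ∑ p ∈ Finset.HasAntidiagonal.antidiagonal B, exchWeight f U V V' A (p.1 + 1) *
          exch f U V U' V' (p.1 + 1) A p.2 x *
          (locPM f U V (A + p.1 : ℕ) (x + (V' - U') - 2 * p.2) * f (V - U - (A + p.1 : ℕ)) *
            (locMM f U' p.2 * Φ (x - 1) (A + p.1) p.2))) := by
      rw [sop]
      simp only [top, sum_units_int, lop_pm, lop_mm, lop_pp, mul_add, Finset.sum_add_distrib]
      rw [Finset.Nat.sum_antidiagonal_succ', Finset.Nat.sum_antidiagonal_succ]
      simp only [predFun_zero, predFun_succ, mul_zero, zero_add, exch_zero, add_zero, mul_one,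
        show ∀ g s, predFun g (A + (s + 1)) = g (A + s) from fun _ _ => rfl]
      ring
    have hR : top f U V' U' V 1 (-1) (sop f U V U' V' Φ) x A (B + 1) =
        predFun (fun j => locPM f U V' j (x + (V - U') - 2 * (B + 1 : ℕ)) * f (V' - U - j) *
          (exchWeight f U V V' j 0 * (locMM f U' (B + 1 : ℕ) * Φ (x - 1) j (B + 1)))) A +
        (∑ p ∈ Finset.HasAntidiagonal.antidiagonal B,
          locPP f U V' A (x + (V - U') - 2 * (B + 1 : ℕ)) *
            (locPM f U' V B x * f (V - U' - B)) * (exchWeight f U V V' A p.1 *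
          exch f U V U' V' p.1 A p.2 (x - 1) * Φ (x - 1) (A + p.1) p.2) +
        ∑ p ∈ Finset.HasAntidiagonal.antidiagonal B, predFun (fun j =>
          locPM f U V' j (x + (V - U') - 2 * (B + 1 : ℕ)) * f (V' - U - j) *
          (locMM f U' (B + 1 : ℕ) * (exchWeight f U V V' j (p.1 + 1) *
          exch f U V U' V' (p.1 + 1) j p.2 (x - 1) * Φ (x - 1) (j + (p.1 + 1)) p.2))) A) := by
      simp only [top, sum_units_int, lop_pm, lop_mm, lop_pp, predFun_succ, sop]
      rw [← Finset.mul_sum]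
      cases A with
      | zero => simp [mul_assoc]
      | succ A =>
        simp only [predFun_succ]
        rw [Finset.Nat.sum_antidiagonal_succ, ← Finset.mul_sum, ← Finset.mul_sum]
        simp only [exch_zero, add_zero]
        ring
    rw [hL, hR, h0, ← Finset.sum_add_distrib, ← Finset.sum_add_distrib]
    congr 1
    refine Finset.sum_congr rfl fun p hp => ?_
    obtain ⟨s, b⟩ := p
    have hB : B = b + s := by
      rw [add_comm]; exact (Finset.HasAntidiagonal.mem_antidiagonal.1 hp).symm
    subst hB
    have key := exchange_pm hf hx A b s
    cases A with
    | zero =>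
      simp only [Nat.cast_zero, exch_neg_one hf] at key
      rw [exchWeight_eq hU 0 s]
      simp only [predFun_zero]
      push_cast at key ⊢
      linear_combination
        (exchWeight f U V V' 0 (s + 1) * f (V - U - (0 + s)) * Φ (x - 1) (0 + s) b) * key
    | succ A =>
      have h1 := exchWeight_eq (V' := V') hU (A + 1) s
      have h2 := exchWeight_succ (f := f) (U := U) (V := V) (V' := V') A s
      simp only [predFun_succ, show A + (s + 1) = A + 1 + s by ring]
      push_cast at key h1 h2 ⊢
      simp only [add_sub_cancel_right] at key
      linear_combination (exchWeight f U V V' (A + 1) s * Φ (x - 1) (A + 1 + s) b) * key -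
        (exch f U V U' V' (s + 1) (A + 1) b x *
          locPM f U V (A + 1 + s) (x + (V' - U') - 2 * b) *
            (locMM f U' b * Φ (x - 1) (A + 1 + s) b)) * h1 +
        (locPM f U V' A (x + (V - U') - 2 * (b + s + 1)) * locMM f U' (b + s + 1) *
          exch f U V U' V' (s + 1) A b (x - 1) * Φ (x - 1) (A + 1 + s) b) * h2

theorem sop_top_pp (Φ : ℂ → ℕ → ℕ → ℂ) (A B : ℕ) :
    sop f U V U' V' (top f U V U' V' 1 1 Φ) x A B =
      top f U V' U' V 1 1 (sop f U V U' V' Φ) x A B := by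
  have h0 := exchWeight_predFun (V' := V') (U' := U') hU
    (fun j => locMP f U' (B + 1 : ℕ) x * Φ (x + 1) j (B + 1)) (x - 2 * B) A
  simp only [show ∀ c : ℂ, x - 2 * B + c = x + c - 2 * B by intro c; ring] at h0
  have hL : sop f U V U' V' (top f U V U' V' 1 1 Φ) x A B =
      exchWeight f U V V' A 0 * predFun (fun j =>
        locPM f U V j (x + (V' - U') - 2 * B) * f (V - U - j) *
          (locMP f U' (B + 1 : ℕ) x * Φ (x + 1) j (B + 1))) A +
      (∑ p ∈ Finset.HasAntidiagonal.antidiagonal B, exchWeight f U V V' A p.1 *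
        exch f U V U' V' p.1 A p.2 x *
        (locPP f U V (A + p.1 : ℕ) (x + (V' - U') - 2 * p.2) *
          (locPP f U' V' p.2 x * Φ (x + 1) (A + p.1) p.2)) +
      ∑ p ∈ Finset.HasAntidiagonal.antidiagonal B, exchWeight f U V V' A (p.1 + 1) *
        exch f U V U' V' (p.1 + 1) A (p.2 - 1) x *
        (locPM f U V (A + p.1 : ℕ) (x + (V' - U') - 2 * (p.2 - 1)) * f (V - U - (A + p.1 : ℕ)) *
          (locMP f U' p.2 x * Φ (x + 1) (A + p.1) p.2))) := by
    -- Reindexing `b + 1` as `b` introduces a term `b = 0` with the meaningless argument `b - 1`; it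
    -- vanishes because `locMP` is zero at index `0`.
    have h := sum_antidiagonal_pred (fun s b => exchWeight f U V V' A s *
        exch f U V U' V' s A (b - 1) x * predFun (fun j =>
        locPM f U V j (x + (V' - U') - 2 * (b - 1)) * f (V - U - j) *
          (locMP f U' b x * Φ (x + 1) j b)) (A + s))
      (fun s => by cases h : A + s <;> simp [locMP_zero hf]) B
    rw [Finset.Nat.sum_antidiagonal_succ] at h
    simp only [Nat.cast_add, Nat.cast_one, add_sub_cancel_right,
        show ∀ g s, predFun g (A + (s + 1)) = g (A + s) from fun _ _ => rfl] at h
    rw [sop]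
    simp only [top, sum_units_int, lop_mp, lop_pm, lop_pp, mul_add, Finset.sum_add_distrib]
    push_cast
    rw [h]
    simp only [exch_zero, add_zero, mul_one]
    ring
  have hR : top f U V' U' V 1 1 (sop f U V U' V' Φ) x A B =
      predFun (fun j => locPM f U V' j (x + (V - U') - 2 * B) * f (V' - U - j) *
        (exchWeight f U V V' j 0 * (locMP f U' (B + 1 : ℕ) x * Φ (x + 1) j (B + 1)))) A +
      (∑ p ∈ Finset.HasAntidiagonal.antidiagonal B,
        locPP f U V' A (x + (V - U') - 2 * B) *
          locPP f U' V B x * (exchWeight f U V V' A p.1 *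
        exch f U V U' V' p.1 A p.2 (x + 1) * Φ (x + 1) (A + p.1) p.2) +
      ∑ p ∈ Finset.HasAntidiagonal.antidiagonal B, predFun (fun j =>
        locPM f U V' j (x + (V - U') - 2 * B) * f (V' - U - j) *
        (locMP f U' (B + 1 : ℕ) x * (exchWeight f U V V' j (p.1 + 1) *
        exch f U V U' V' (p.1 + 1) j p.2 (x + 1) * Φ (x + 1) (j + (p.1 + 1)) p.2))) A) := by
    simp only [top, sum_units_int, lop_mp, lop_pm, lop_pp, sop]
    rw [← Finset.mul_sum]
    cases A with
    | zero => simp [mul_assoc]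
    | succ A =>
      simp only [predFun_succ]
      rw [Finset.Nat.sum_antidiagonal_succ, ← Finset.mul_sum, ← Finset.mul_sum]
      simp only [exch_zero, add_zero]
      push_cast
      ring
  rw [hL, hR, h0, ← Finset.sum_add_distrib, ← Finset.sum_add_distrib]
  congr 1
  refine Finset.sum_congr rfl fun p hp => ?_
  obtain ⟨s, b⟩ := p
  have hB : B = b + s := by
    rw [add_comm]; exact (Finset.HasAntidiagonal.mem_antidiagonal.1 hp).symm
  subst hB
  have key := exchange_pp hf hx A b s
  cases A with
  | zero =>
    simp only [Nat.cast_zero, exch_neg_one hf] at key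
    rw [exchWeight_eq hU 0 s]
    simp only [predFun_zero]
    push_cast at key ⊢
    linear_combination
      (exchWeight f U V V' 0 (s + 1) * f (V - U - (0 + s)) * Φ (x + 1) (0 + s) b) * key
  | succ A =>
    have h1 := exchWeight_eq (V' := V') hU (A + 1) s
    have h2 := exchWeight_succ (f := f) (U := U) (V := V) (V' := V') A s
    simp only [predFun_succ, show A + (s + 1) = A + 1 + s by ring]
    push_cast at key h1 h2 ⊢
    simp only [add_sub_cancel_right] at key
    linear_combination (exchWeight f U V V' (A + 1) s * Φ (x + 1) (A + 1 + s) b) * key -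
      (exch f U V U' V' (s + 1) (A + 1) (b - 1) x *
        locPM f U V (A + 1 + s) (x + (V' - U') - 2 * (b - 1)) *
          (locMP f U' b x * Φ (x + 1) (A + 1 + s) b)) * h1 +
      (locPM f U V' A (x + (V - U') - 2 * (b + s)) * locMP f U' (b + s + 1) x *
        exch f U V U' V' (s + 1) A b (x + 1) * Φ (x + 1) (A + 1 + s) b) * h2

theorem sop_top (i j : ℤˣ) (Φ : ℂ → ℕ → ℕ → ℂ) (A B : ℕ) :
    sop f U V U' V' (top f U V U' V' i j Φ) x A B =
      top f U V' U' V i j (sop f U V U' V' Φ) x A B := by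
  rcases Int.units_eq_one_or i with rfl | rfl <;> rcases Int.units_eq_one_or j with rfl | rfl
  · exact sop_top_pp hf hU hx Φ A B
  · exact sop_top_pm hf hU hx Φ A B
  · exact sop_top_mp hf hU hx Φ A B
  · exact sop_top_mm hf hU hx Φ A B

end Operators

end EllipticSl2

namespace EllipticSl2

/-! ### Monodromy operators on functions -/

section Monodromy

variable (f : ℂ → ℂ)

/-- The product of the operators `L_{i_l k_l}` with spectral parameters shifted by `y_l`. -/
noncomputable def mon (U V : ℂ) : ∀ {N : ℕ}, (Fin N → ℂ) → (Fin N → ℤˣ) → (Fin N → ℤˣ) →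
    (ℂ → ℕ → ℂ) → ℂ → ℕ → ℂ
  | 0, _, _, _, Φ => Φ
  | _ + 1, y, i, k, Φ => lop f (U + y 0) (V + y 0) (i 0) (k 0)
      (mon U V (Fin.tail y) (Fin.tail i) (Fin.tail k) Φ)

/-- The monodromy operator of the tensor product of two asymptotic representations. -/
noncomputable def tmon (U V U' V' : ℂ) : ∀ {N : ℕ}, (Fin N → ℂ) → (Fin N → ℤˣ) →
    (Fin N → ℤˣ) → (ℂ → ℕ → ℕ → ℂ) → ℂ → ℕ → ℕ → ℂ
  | 0, _, _, _, Φ => Φ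
  | _ + 1, y, i, j, Φ => top f (U + y 0) (V + y 0) (U' + y 0) (V' + y 0) (i 0) (j 0)
      (tmon U V U' V' (Fin.tail y) (Fin.tail i) (Fin.tail j) Φ)

variable {f} {U V U' V' : ℂ}

/-- Locality: the value at `(x, j)` reads `Φ` at the single argument `x + k` and the single index
compatible with weights. This allows pointwise arguments at regular `x` without any analytic
structure on `Φ`. -/
theorem lop_congr {i k : ℤˣ} {Φ Ψ : ℂ → ℕ → ℂ} {x : ℂ} {j : ℕ}
    (h : ∀ j' : ℕ, (2 * j' : ℤ) = 2 * j - i + k → Φ (x + (k : ℤ)) j' = Ψ (x + (k : ℤ)) j') :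
    lop f U V i k Φ x j = lop f U V i k Ψ x j := by
  rcases Int.units_eq_one_or i with rfl | rfl <;> rcases Int.units_eq_one_or k with rfl | rfl
  · have := h j (by simp)
    simp only [Units.val_one, Int.cast_one] at this
    simp only [lop_pp, this]
  · cases j with
    | zero => simp
    | succ j =>
      have := h j (by push_cast; ring)
      simp only [Units.val_neg, Units.val_one, Int.cast_neg, Int.cast_one, ← sub_eq_add_neg] at this
      simp only [lop_pm, predFun_succ, this]
  · have := h (j + 1) (by push_cast; ring)
    simp only [Units.val_one, Int.cast_one] at this
    simp only [lop_mp, this]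
  · have := h j (by simp)
    simp only [Units.val_neg, Units.val_one, Int.cast_neg, Int.cast_one, ← sub_eq_add_neg] at this
    simp only [lop_mm, this]

theorem lop_sum {ι : Type*} (s : Finset ι) (c : ι → ℂ) (Φ : ι → ℂ → ℕ → ℂ) (i k : ℤˣ) (x : ℂ)
    (j : ℕ) : lop f U V i k (fun x j => ∑ q ∈ s, c q * Φ q x j) x j =
      ∑ q ∈ s, c q * lop f U V i k (Φ q) x j := by
  rcases Int.units_eq_one_or i with rfl | rfl <;> rcases Int.units_eq_one_or k with rfl | rfl
  · simp only [lop_pp, Finset.mul_sum, mul_left_comm]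
  · cases j with
    | zero => simp
    | succ j => simp only [lop_pm, predFun_succ, Finset.mul_sum, mul_left_comm]
  · simp only [lop_mp, Finset.mul_sum, mul_left_comm]
  · simp only [lop_mm, Finset.mul_sum, mul_left_comm]

theorem top_congr {i j : ℤˣ} {Φ Ψ : ℂ → ℕ → ℕ → ℂ} {x : ℂ} {A B : ℕ}
    (h : ∀ A' B' : ℕ, (2 * (A' + B') : ℤ) = 2 * (A + B) - i + j →
      Φ (x + (j : ℤ)) A' B' = Ψ (x + (j : ℤ)) A' B') :
    top f U V U' V' i j Φ x A B = top f U V U' V' i j Ψ x A B := by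
  refine Finset.sum_congr rfl fun k _ => lop_congr fun A' hA => lop_congr fun B' hB => ?_
  exact h A' B' (by linarith)

theorem top_sum {ι : Type*} (s : Finset ι) (c : ι → ℂ) (Φ : ι → ℂ → ℕ → ℕ → ℂ) (i j : ℤˣ)
    (x : ℂ) (A B : ℕ) : top f U V U' V' i j (fun x A B => ∑ q ∈ s, c q * Φ q x A B) x A B =
      ∑ q ∈ s, c q * top f U V U' V' i j (Φ q) x A B := by
  simp only [top, lop_sum, Finset.mul_sum]
  exact Finset.sum_comm

theorem mon_congr {N : ℕ} (y : Fin N → ℂ) (i k : Fin N → ℤˣ) {Φ Ψ : ℂ → ℕ → ℂ} {x : ℂ} {j : ℕ}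
    (h : ∀ j' : ℕ, (2 * j' : ℤ) = 2 * j - ∑ l, (i l : ℤ) + ∑ l, (k l : ℤ) →
      Φ (x + (∑ l, (k l : ℤ) : ℤ)) j' = Ψ (x + (∑ l, (k l : ℤ) : ℤ)) j') :
    mon f U V y i k Φ x j = mon f U V y i k Ψ x j := by
  induction N generalizing x j with
  | zero => simpa [mon] using h j
  | succ N ih =>
    refine lop_congr fun j' hj' => ih _ _ _ fun j'' hj'' => ?_
    have := h j'' (by
      rw [Fin.sum_univ_succ, Fin.sum_univ_succ]; simp only [Fin.tail] at hj''; linarith)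
    rw [Fin.sum_univ_succ] at this
    push_cast at this ⊢
    simpa only [add_assoc, Fin.tail] using this

theorem tmon_congr {N : ℕ} (y : Fin N → ℂ) (i j : Fin N → ℤˣ) {Φ Ψ : ℂ → ℕ → ℕ → ℂ} {x : ℂ}
    {A B : ℕ}
    (h : ∀ A' B' : ℕ, (2 * (A' + B') : ℤ) = 2 * (A + B) - ∑ l, (i l : ℤ) + ∑ l, (j l : ℤ) →
      Φ (x + (∑ l, (j l : ℤ) : ℤ)) A' B' = Ψ (x + (∑ l, (j l : ℤ) : ℤ)) A' B') :
    tmon f U V U' V' y i j Φ x A B = tmon f U V U' V' y i j Ψ x A B := by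
  induction N generalizing x A B with
  | zero => simpa [tmon] using h A B
  | succ N ih =>
    refine top_congr fun A' B' hj' => ih _ _ _ fun A'' B'' hj'' => ?_
    have := h A'' B'' (by
      rw [Fin.sum_univ_succ, Fin.sum_univ_succ]; simp only [Fin.tail] at hj''; linarith)
    rw [Fin.sum_univ_succ] at this
    push_cast at this ⊢
    simpa only [add_assoc, Fin.tail] using this

theorem tmon_sum {ι : Type*} (s : Finset ι) (c : ι → ℂ) (Φ : ι → ℂ → ℕ → ℕ → ℂ) {N : ℕ}
    (y : Fin N → ℂ) (i j : Fin N → ℤˣ) (x : ℂ) (A B : ℕ) :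
    tmon f U V U' V' y i j (fun x A B => ∑ q ∈ s, c q * Φ q x A B) x A B =
      ∑ q ∈ s, c q * tmon f U V U' V' y i j (Φ q) x A B := by
  induction N generalizing x A B with
  | zero => rfl
  | succ N ih =>
    simp only [tmon]
    rw [← top_sum]
    exact top_congr fun A' B' _ => ih ..

theorem sop_sum {ι : Type*} (s : Finset ι) (c : ι → ℂ) (Φ : ι → ℂ → ℕ → ℕ → ℂ)
    (x : ℂ) (A B : ℕ) : sop f U V U' V' (fun x A B => ∑ q ∈ s, c q * Φ q x A B) x A B =
      ∑ q ∈ s, c q * sop f U V U' V' (Φ q) x A B := by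
  simp only [sop, Finset.mul_sum]
  rw [Finset.sum_comm]
  exact Finset.sum_congr rfl fun _ _ => Finset.sum_congr rfl fun _ _ => by ring

theorem sop_congr {Φ Ψ : ℂ → ℕ → ℕ → ℂ} {x : ℂ} {A B : ℕ}
    (h : ∀ A' B' : ℕ, A' + B' = A + B → Φ x A' B' = Ψ x A' B') :
    sop f U V U' V' Φ x A B = sop f U V U' V' Ψ x A B := by
  refine Finset.sum_congr rfl fun p hp => ?_
  rw [h]
  have := Finset.HasAntidiagonal.mem_antidiagonal.1 hp
  omega

/-- Only differences of the parameters enter. One and the same operator therefore serves at every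
site, whatever its inhomogeneity, and can be carried through the monodromy site by site. -/
theorem sop_shift (y : ℂ) : sop f (U + y) (V + y) (U' + y) (V' + y) = sop f U V U' V' := by
  funext Φ x A B
  simp only [sop, exchWeight, exch, add_sub_add_right_eq_sub]
  refine Finset.sum_congr rfl fun p _ => ?_
  rw [show x + (V + y) - (U' + y) - 2 * (p.2 : ℂ) = x + V - U' - 2 * p.2 by ring,
    show x + (V' + y) - (U' + y) - 2 * (p.2 : ℂ) - 1 = x + V' - U' - 2 * p.2 - 1 by ring]

theorem Regular.shift {x : ℂ} (hx : Regular f U V U' V' x) (y : ℂ) :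
    Regular f (U + y) (V + y) (U' + y) (V' + y) x := by
  simpa only [Regular, add_sub_add_right_eq_sub] using hx

theorem Regular.add_int {x : ℂ} (hx : Regular f U V U' V' x) (k : ℤ) :
    Regular f U V U' V' (x + k) := by
  intro n
  have := hx (k + n)
  push_cast at this
  refine ⟨?_, ?_, ?_, ?_⟩
  · convert this.1 using 2; ring
  · convert this.2.1 using 2; ring
  · convert this.2.2.1 using 2; ring
  · convert this.2.2.2 using 2; ring

theorem sop_tmon (hf : IsBracket f) (hU : ∀ i : ℕ, f (V - U - i) ≠ 0) {x : ℂ}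
    (hx : Regular f U V U' V' x) {N : ℕ} (y : Fin N → ℂ) (i j : Fin N → ℤˣ)
    (Φ : ℂ → ℕ → ℕ → ℂ) (A B : ℕ) :
    sop f U V U' V' (tmon f U V U' V' y i j Φ) x A B =
      tmon f U V' U' V y i j (sop f U V U' V' Φ) x A B := by
  induction N generalizing x A B with
  | zero => rfl
  | succ N ih =>
    simp only [tmon]
    rw [← sop_shift (y 0), sop_top hf (by simpa using hU) (hx.shift _)]
    refine top_congr fun A' B' _ => ?_
    rw [sop_shift]
    exact ih (hx.add_int _) ..

/-! ### Tensor products of functions -/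

/-- When `L_{kj}` acts on the right factor, `x` moves by `j` and the right weight `V' - U' - 2B` by
`k - j`, so their sum moves by `k`. That is the shift which `L_{ik}` requires on the left factor, so
the coproduct acts factor by factor. -/
theorem top_mul (i j : ℤˣ) (φ ψ : ℂ → ℕ → ℂ) (x : ℂ) (A B : ℕ) :
    top f U V U' V' i j (fun x A B => φ (x + (V' - U') - 2 * B) A * ψ x B) x A B =
      ∑ k : ℤˣ, lop f U V i k φ (x + (V' - U') - 2 * B) A * lop f U' V' k j ψ x B := by
  refine Finset.sum_congr rfl fun k _ => ?_
  have h1 : ∀ A' : ℕ, lop f U' V' k j (fun x B => φ (x + (V' - U') - 2 * B) A' * ψ x B) x B =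
      lop f U' V' k j ψ x B * φ (x + (V' - U') - 2 * B + (k : ℤ)) A' := by
    intro A'
    rcases Int.units_eq_one_or k with rfl | rfl <;> rcases Int.units_eq_one_or j with rfl | rfl
    · simp only [lop_pp, Units.val_one, Int.cast_one]
      rw [show x + 1 + (V' - U') - 2 * B = x + (V' - U') - 2 * B + 1 by ring]
      ring
    · cases B with
      | zero => simp
      | succ B =>
        simp only [lop_pm, Units.val_one, Int.cast_one, predFun_succ]
        push_cast
        rw [show x - 1 + (V' - U') - 2 * B = x + (V' - U') - 2 * (B + 1) + 1 by ring]
        ring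
    · simp only [lop_mp, Units.val_neg, Units.val_one, Int.cast_neg, Int.cast_one]
      push_cast
      rw [show x + 1 + (V' - U') - 2 * (B + 1) = x + (V' - U') - 2 * B + -1 by ring]
      ring
    · simp only [lop_mm, Units.val_neg, Units.val_one, Int.cast_neg, Int.cast_one]
      rw [show x - 1 + (V' - U') - 2 * B = x + (V' - U') - 2 * B + -1 by ring]
      ring
  simp only [h1]
  -- A sum over a one-point set expresses homogeneity under a constant scalar.
  have h2 := lop_sum (f := f) (U := U) (V := V) {()} (fun _ => lop f U' V' k j ψ x B)
    (fun _ _ A' => φ (x + (V' - U') - 2 * B + (k : ℤ)) A') i k (x + (V' - U') - 2 * B) A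
  simp only [Finset.sum_singleton] at h2
  rw [h2, mul_comm]
  congr 1
  exact lop_congr fun _ _ => rfl

theorem tmon_mul {N : ℕ} (y : Fin N → ℂ) (i j : Fin N → ℤˣ) (φ ψ : ℂ → ℕ → ℂ) (x : ℂ)
    (A B : ℕ) :
    tmon f U V U' V' y i j (fun x A B => φ (x + (V' - U') - 2 * B) A * ψ x B) x A B =
      ∑ k : Fin N → ℤˣ, mon f U V y i k φ (x + (V' - U') - 2 * B) A *
        mon f U' V' y k j ψ x B := by
  induction N generalizing x A B with
  | zero => simp [tmon, mon]
  | succ N ih =>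
    rw [← (Fin.consEquiv fun _ => ℤˣ).sum_comp, Fintype.sum_prod_type, Finset.sum_comm]
    have h : ∀ k : Fin N → ℤˣ, _ := fun k => top_mul (f := f) (U := U + y 0) (V := V + y 0)
      (U' := U' + y 0) (V' := V' + y 0) (i 0) (j 0)
      (mon f U V (Fin.tail y) (Fin.tail i) k φ) (mon f U' V' (Fin.tail y) k (Fin.tail j) ψ) x A B
    simp only [add_sub_add_right_eq_sub] at h
    refine Eq.trans ?_ (Finset.sum_congr rfl fun k _ => h k)
    have h2 := top_sum (f := f) (U := U + y 0) (V := V + y 0)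
      (U' := U' + y 0) (V' := V' + y 0) Finset.univ (fun _ => 1) (fun k x A B =>
      mon f U V (Fin.tail y) (Fin.tail i) k φ (x + (V' - U') - 2 * B) A *
        mon f U' V' (Fin.tail y) k (Fin.tail j) ψ x B) (i 0) (j 0) x A B
    simp only [one_mul] at h2
    rw [← h2]
    exact top_congr fun A' B' _ => ih ..

/-! ### Traces -/

/-- The basis function concentrated in degree `j`. -/
def delta (j : ℕ) : ℂ → ℕ → ℂ := fun _ j' => if j' = j then 1 else 0

variable (f) in
/-- Diagonal coefficient of the monodromy operator in degree `j`. -/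
noncomputable def monCoeff (U V : ℂ) {N : ℕ} (y : Fin N → ℂ) (i k : Fin N → ℤˣ) (j : ℕ)
    (x : ℂ) : ℂ := mon f U V y i k (delta j) x j

variable (f) in
/-- Trace over the degree `m` part of the monodromy operator of a tensor product. -/
noncomputable def traceProd (U V U' V' : ℂ) {N : ℕ} (y : Fin N → ℂ) (i j : Fin N → ℤˣ) (m : ℕ)
    (x : ℂ) : ℂ :=
  ∑ p ∈ Finset.HasAntidiagonal.antidiagonal m, ∑ k : Fin N → ℤˣ,
    monCoeff f U V y i k p.1 (x + (V' - U') - 2 * p.2) * monCoeff f U' V' y k j p.2 x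

theorem monCoeff_eq_zero {N : ℕ} (y : Fin N → ℂ) (i k : Fin N → ℤˣ)
    (h : ∑ l, (i l : ℤ) ≠ ∑ l, (k l : ℤ)) (j : ℕ) (x : ℂ) : monCoeff f U V y i k j x = 0 := by
  have hz : ∀ (N : ℕ) (y : Fin N → ℂ) (i k : Fin N → ℤˣ) (x : ℂ) (j : ℕ),
      mon f U V y i k (fun _ _ => 0) x j = 0 := by
    intro N
    induction N with
    | zero => intros; rfl
    | succ N ih =>
      intro y i k x j
      simp only [mon]
      have h0 := lop_sum (f := f) (U := U + y 0) (V := V + y 0) (∅ : Finset ℕ) (fun _ => 0)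
        (fun _ _ _ => 0) (i 0) (k 0) x j
      simp only [Finset.sum_empty] at h0
      exact (lop_congr fun _ _ => ih ..).trans h0
  rw [monCoeff, ← hz N y i k x j]
  refine mon_congr _ _ _ fun j' hj' => ?_
  rw [delta, if_neg]
  omega

/-- The basis function concentrated in bidegree `(q, m - q)`. -/
def delta₂ (m q : ℕ) : ℂ → ℕ → ℕ → ℂ := fun _ A B => delta q 0 A * delta (m - q) 0 B

theorem traceProd_eq {N : ℕ} (y : Fin N → ℂ) (i j : Fin N → ℤˣ) (m : ℕ) (x : ℂ) :
    traceProd f U V U' V' y i j m x =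
      ∑ q : Fin (m + 1), tmon f U V U' V' y i j (delta₂ m q) x q (m - q : ℕ) := by
  rw [traceProd, Finset.Nat.sum_antidiagonal_eq_sum_range_succ_mk, Finset.sum_range]
  refine Finset.sum_congr rfl fun q _ => ?_
  exact (tmon_mul y i j (delta q) (delta (m - q)) x q (m - q : ℕ)).symm

theorem eq_sum_delta₂ (m : ℕ) (Ψ : ℕ → ℕ → ℂ) (x : ℂ) {A B : ℕ} (h : A + B = m) :
    Ψ A B = ∑ q : Fin (m + 1), Ψ q (m - q : ℕ) * delta₂ m q x A B := by
  rw [Finset.sum_eq_single (⟨A, by omega⟩ : Fin (m + 1))]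
  · have : m - A = B := by omega
    simp [delta₂, delta, this]
  · intro q _ hq
    have : A ≠ q := fun h => hq (Fin.ext h.symm)
    simp [delta₂, delta, this]
  · simp

/-- For balanced `i, j` the monodromy reads its argument at `x` itself and preserves the total
degree `m`. At fixed `x` everything is therefore a complex matrix of size `m + 1`, and the exchange
operator conjugates one monodromy into the other. -/
theorem traceProd_exchange_of_ne_zero (hf : IsBracket f) (hU : ∀ i : ℕ, f (V - U - i) ≠ 0)
    (hU' : ∀ i : ℕ, f (V' - U - i) ≠ 0) {x : ℂ} (hx : Regular f U V U' V' x) {N : ℕ}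
    (y : Fin N → ℂ) (i j : Fin N → ℤˣ) (hi : ∑ l, (i l : ℤ) = 0) (hj : ∑ l, (j l : ℤ) = 0)
    (m : ℕ) : traceProd f U V U' V' y i j m x = traceProd f U V' U' V y i j m x := by
  let S : Matrix (Fin (m + 1)) (Fin (m + 1)) ℂ :=
    fun p q => sop f U V U' V' (delta₂ m q) x p (m - p : ℕ)
  let M : Matrix (Fin (m + 1)) (Fin (m + 1)) ℂ :=
    fun p q => tmon f U V U' V' y i j (delta₂ m q) x p (m - p : ℕ)
  let M' : Matrix (Fin (m + 1)) (Fin (m + 1)) ℂ :=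
    fun p q => tmon f U V' U' V y i j (delta₂ m q) x p (m - p : ℕ)
  have hSe : ∀ (Ψ : ℂ → ℕ → ℕ → ℂ) (p : Fin (m + 1)),
      sop f U V U' V' Ψ x p (m - p : ℕ) = ∑ q, S p q * Ψ x q (m - q : ℕ) := by
    intro Ψ p
    simp only [S, mul_comm (sop ..)]
    rw [← sop_sum]
    exact sop_congr fun A B h => eq_sum_delta₂ m (Ψ x) x (by omega)
  have hMe : ∀ (Ψ : ℂ → ℕ → ℕ → ℂ) (p : Fin (m + 1)),
      tmon f U V' U' V y i j Ψ x p (m - p : ℕ) = ∑ q, M' p q * Ψ x q (m - q : ℕ) := by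
    intro Ψ p
    simp only [M', mul_comm (tmon ..)]
    rw [← tmon_sum]
    refine tmon_congr _ _ _ fun A B h => ?_
    rw [hi, hj] at h
    simp only [hj, Int.cast_zero, add_zero]
    exact eq_sum_delta₂ m (Ψ x) x (by omega)
  have hSM : S * M = M' * S := by
    ext p r
    rw [Matrix.mul_apply, Matrix.mul_apply]
    have := sop_tmon hf hU hx y i j (delta₂ m r) p (m - p : ℕ)
    rwa [hSe, hMe] at this
  have hdet : S.det ≠ 0 := by
    -- The operator only moves degree from the right factor to the left one, so the matrix is upper
    -- triangular; its diagonal is nonzero by both hypotheses on `f`.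
    have htri : ∀ p q : Fin (m + 1), q ≤ p → S p q =
        if p = q then exchWeight f U V V' p 0 else 0 := by
      intro p q hqp
      have hqp' : (q : ℕ) ≤ p := hqp
      change ∑ r ∈ _, _ = _
      rw [Finset.sum_eq_single (0, (m - p : ℕ))]
      · split_ifs with h
        · simp [h, delta₂, delta, exch_zero]
        · have : (p : ℕ) ≠ q := fun h' => h (Fin.ext h')
          simp [delta₂, delta, this]
      · rintro ⟨s, b⟩ hr hr'
        have := Finset.HasAntidiagonal.mem_antidiagonal.1 hr
        have hs : s ≠ 0 := by
          rintro rfl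
          apply hr'
          simp at this
          rw [this]
        have : (p : ℕ) + s ≠ q := by omega
        simp [delta₂, delta, this]
      · simp
    rw [Matrix.det_of_isUpperTriangular]
    · refine Finset.prod_ne_zero_iff.2 fun p _ => ?_
      rw [htri p p le_rfl, if_pos rfl]
      exact div_ne_zero (fallProd_ne_zero f fun i _ => hU' i) (fallProd_ne_zero f fun i _ => hU i)
    · intro p q h
      have h' : q < p := h
      rw [htri p q h'.le, if_neg h'.ne']
  have hM' : M' = S * M * S⁻¹ := by
    rw [hSM, Matrix.mul_assoc, Matrix.mul_nonsing_inv _ (isUnit_iff_ne_zero.2 hdet),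
      Matrix.mul_one]
  have htr : M'.trace = M.trace := by
    rw [hM', Matrix.trace_mul_comm, ← Matrix.mul_assoc,
      Matrix.nonsing_inv_mul _ (isUnit_iff_ne_zero.2 hdet), Matrix.one_mul]
  rw [traceProd_eq, traceProd_eq]
  exact htr.symm

end Monodromy

end EllipticSl2

namespace EllipticSl2

/-! ### Reflection -/

section Reflection

variable (f : ℂ → ℂ)

/-- Gauge factor of the reflection. -/
noncomputable def reflCoeff (ℓ : ℂ) (j : ℕ) (x : ℂ) : ℂ :=
  (-1) ^ j * fallProd f (x - 1) j / fallProd f (x + ℓ - j) j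

/-- The operator intertwining a representation with its reflection. -/
noncomputable def reflOp (ℓ : ℂ) (Φ : ℂ → ℕ → ℂ) (x : ℂ) (j : ℕ) : ℂ :=
  reflCoeff f ℓ j x * Φ (-(x + ℓ - 2 * j)) j

/-- Points where no denominator of the coefficients vanishes. -/
def LocRegular (ℓ x : ℂ) : Prop := ∀ n : ℤ, f (x + n) ≠ 0 ∧ f (x + ℓ + n) ≠ 0

variable {f} {U V ℓ x : ℂ}

theorem LocRegular.add_int (hx : LocRegular f ℓ x) (k : ℤ) : LocRegular f ℓ (x + k) := by
  intro n
  have := hx (k + n)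
  push_cast at this
  refine ⟨?_, ?_⟩
  · convert this.1 using 2; ring
  · convert this.2 using 2; ring

theorem LocRegular.left (hx : LocRegular f ℓ x) {y : ℂ} (n : ℤ) (h : y = x + n) : f y ≠ 0 :=
  h ▸ (hx n).1

theorem LocRegular.right (hx : LocRegular f ℓ x) {y : ℂ} (n : ℤ) (h : y = x + ℓ + n) : f y ≠ 0 :=
  h ▸ (hx n).2

theorem fallProd_right_ne_zero (hx : LocRegular f ℓ x) (j : ℕ) (k : ℤ) :
    fallProd f (x + ℓ - j + k) j ≠ 0 :=
  fallProd_ne_zero f fun i _ => hx.right (k - i - j) (by push_cast; ring)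

theorem reflCoeff_ne_zero (hx : LocRegular f ℓ x) (j : ℕ) : reflCoeff f ℓ j x ≠ 0 := by
  refine div_ne_zero (mul_ne_zero (pow_ne_zero _ (by norm_num)) (fallProd_ne_zero f fun i _ => ?_))
    (by simpa using fallProd_right_ne_zero hx j 0)
  exact hx.left (-1 - i) (by push_cast; ring)

theorem reflCoeff_shift (hx : LocRegular f ℓ x) (j : ℕ) :
    reflCoeff f ℓ j (x - 1) * (f (x - 1) * f (x + ℓ - 2 * j)) =
      reflCoeff f ℓ j x * (f (x - 1 - j) * f (x + ℓ - j)) := by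
  have h1 := fallProd_shift f (x - 1) j
  have h2 := fallProd_shift f (x + ℓ - j) j
  have n1 := fallProd_right_ne_zero hx j (-1)
  have n2 := fallProd_right_ne_zero hx j 0
  simp only [Int.cast_zero, add_zero, Int.cast_neg, Int.cast_one, ← sub_eq_add_neg] at n1 n2
  rw [reflCoeff, reflCoeff, show x - 1 + ℓ - j = x + ℓ - j - 1 by ring, div_mul_eq_mul_div,
    div_mul_eq_mul_div, div_eq_div_iff n1 n2]
  rw [show x + ℓ - j - j = x + ℓ - 2 * j by ring] at h2
  linear_combination ((-1) ^ j * f (x + ℓ - 2 * j) * fallProd f (x + ℓ - j) j) * h1 -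
    ((-1) ^ j * fallProd f (x - 1) j * f (x - 1 - j)) * h2

theorem reflCoeff_succ (hx : LocRegular f ℓ x) (j : ℕ) :
    reflCoeff f ℓ (j + 1) x * f (x + ℓ - 2 * j - 1) = -reflCoeff f ℓ j (x - 1) * f (x - 1) := by
  have n1 := fallProd_right_ne_zero hx j (-1)
  have n2 : f (x + ℓ - 2 * j - 1) ≠ 0 := hx.right (-2 * j - 1) (by push_cast; ring)
  rw [reflCoeff, reflCoeff, fallProd_succ_left, fallProd_succ_right]
  push_cast at n1 ⊢
  rw [show x + ℓ - (j + 1) = x + ℓ - j + -1 by ring,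
    show x + ℓ - j + -1 - j = x + ℓ - 2 * j - 1 by ring, show x - 1 + ℓ - j = x + ℓ - j + -1 by ring,
    pow_succ]
  generalize f (x + ℓ - 2 * j - 1) = D at n2 ⊢
  field_simp

variable (hf : IsBracket f)
include hf

/-- Replacing `x` by minus the sum of `x` and the weight interchanges the roles of `U` and `V`, and
of `L_{++}` and `L_{--}`. The gauge factor is made to satisfy the recursions `reflCoeff_shift`
(diagonal cases) and `reflCoeff_succ` (off-diagonal cases). -/
theorem lop_reflOp (hx : LocRegular f (V - U) x) (i k : ℤˣ) (Φ : ℂ → ℕ → ℂ) (j : ℕ) :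
    lop f U V i k (reflOp f (V - U) Φ) x j =
      -reflOp f (V - U) (lop f (-V - 2) (-U - 2) (-k) (-i) Φ) x j := by
  have n0 : f x ≠ 0 := hx.left 0 (by simp)
  have n1 : f (x - 1) ≠ 0 := hx.left (-1) (by push_cast; ring)
  rcases Int.units_eq_one_or i with rfl | rfl <;> rcases Int.units_eq_one_or k with rfl | rfl
  · have h := reflCoeff_shift (by simpa using hx.add_int 1 : LocRegular f (V - U) (x + 1)) j
    have n2 : f (x + (V - U) - 2 * j + 1) ≠ 0 := hx.right (-2 * j + 1) (by push_cast; ring)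
    simp only [lop_pp, lop_mm, reflOp, locPP, locMM]
    rw [show x + 1 - 1 = x by ring, show x + 1 + (V - U) - 2 * j = x + (V - U) - 2 * j + 1 by ring,
      show x + 1 + (V - U) - j = x + (V - U) - j + 1 by ring] at h
    rw [show -V - 2 + (j : ℂ) + 1 = -(V - j + 1) by ring, hf.odd,
      show -(x + 1 + (V - U) - 2 * j) = -(x + (V - U) - 2 * j) - 1 by ring, div_mul_eq_mul_div,
      div_eq_iff (mul_ne_zero n0 n2)]
    linear_combination
      (-f (V - j + 1) * Φ (-(x + (V - U) - 2 * j) - 1) j) * h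
  · cases j with
    | zero => simp [reflOp]
    | succ j =>
      have h := reflCoeff_succ hx j
      have n2 : f (x + (V - U) - 2 * j - 1) ≠ 0 := hx.right (-2 * j - 1) (by push_cast; ring)
      simp only [lop_pm, neg_neg, predFun_succ, reflOp, locPM]
      push_cast
      rw [show -(x + (V - U) - 2 * ((j : ℂ) + 1)) + (-U - 2 - (-V - 2)) - 2 * j - 1 = -(x - 1) by ring,
        show -U - 2 + -(x + (V - U) - 2 * ((j : ℂ) + 1)) - j = -(V + x - j) by ring,
        show -(x + (V - U) - 2 * ((j : ℂ) + 1)) - 1 = -(x - 1 + (V - U) - 2 * j) by ring,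
        show -U - 2 - (-V - 2) - (j : ℂ) = V - U - j by ring, hf.odd, hf.odd, neg_div_neg_eq]
      rw [← eq_div_iff n2] at h
      rw [h]
      generalize f (x + (V - U) - 2 * j - 1) = D at n2 ⊢
      field_simp
  · have h := reflCoeff_succ (by simpa using hx.add_int 1 : LocRegular f (V - U) (x + 1)) j
    have n2 : f (x + (V - U) - 2 * j) ≠ 0 := hx.right (-2 * j) (by push_cast; ring)
    simp only [lop_mp, neg_neg, reflOp, locMP]
    rw [show x + 1 + (V - U) - 2 * (j : ℂ) - 1 = x + (V - U) - 2 * j by ring,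
      add_sub_cancel_right] at h
    push_cast
    rw [show -V - 2 - -(x + (V - U) - 2 * (j : ℂ)) + (j + 1) = -(U - x + (j + 1)) by ring,
      show -(x + 1 + (V - U) - 2 * ((j : ℂ) + 1)) = -(x + (V - U) - 2 * j) + 1 by ring,
      hf.odd, hf.odd (x + (V - U) - 2 * j)]
    rw [← eq_div_iff n2] at h
    rw [h]
    generalize f (x + (V - U) - 2 * j) = D at n2 ⊢
    field_simp
  · have h := reflCoeff_shift hx j
    have n2 : f (x + (V - U) - 2 * j) ≠ 0 := hx.right (-2 * j) (by push_cast; ring)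
    simp only [lop_mm, neg_neg, lop_pp, reflOp, locPP, locMM]
    rw [show -U - 2 - (j : ℂ) + 1 = -(U + j + 1) by ring, hf.odd,
      show -(x + (V - U) - 2 * (j : ℂ)) + (-U - 2 - (-V - 2)) - j + 1 = -(x - 1 - j) by ring, hf.odd,
      show -(x + (V - U) - 2 * (j : ℂ)) - j = -(x + (V - U) - j) by ring, hf.odd,
      show -(x + (V - U) - 2 * (j : ℂ)) + (-U - 2 - (-V - 2)) - 2 * j + 1 = -(x - 1) by ring, hf.odd,
      hf.odd, show -(x - 1 + (V - U) - 2 * (j : ℂ)) = -(x + (V - U) - 2 * j) + 1 by ring]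
    rw [← eq_div_iff (mul_ne_zero n1 n2)] at h
    rw [h]
    generalize f (x + (V - U) - 2 * j) = D at n2 ⊢
    field_simp

theorem mon_reflOp (hx : LocRegular f (V - U) x) {N : ℕ} (y : Fin N → ℂ) (i k : Fin N → ℤˣ)
    (Φ : ℂ → ℕ → ℂ) (j : ℕ) :
    mon f U V y i k (reflOp f (V - U) Φ) x j =
      (-1) ^ N * reflOp f (V - U) (mon f (-V - 2) (-U - 2) (-y) (-k) (-i) Φ) x j := by
  induction N generalizing x j with
  | zero => simp [mon]
  | succ N ih =>
    simp only [mon]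
    have h1 := lop_reflOp hf (U := U + y 0) (V := V + y 0) (by simpa using hx) (i 0) (k 0)
      (mon f (-V - 2) (-U - 2) (-Fin.tail y) (-Fin.tail k) (-Fin.tail i) Φ) j
    rw [show -(V + y 0) - 2 = -V - 2 + (-y) 0 by simp; ring,
      show -(U + y 0) - 2 = -U - 2 + (-y) 0 by simp; ring,
      show V + y 0 - (U + y 0) = V - U by ring] at h1
    have h2 := lop_sum (f := f) (U := U + y 0) (V := V + y 0) {()} (fun _ => (-1) ^ N)
      (fun _ => reflOp f (V - U)
        (mon f (-V - 2) (-U - 2) (-Fin.tail y) (-Fin.tail k) (-Fin.tail i) Φ)) (i 0) (k 0) x j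
    simp only [Finset.sum_singleton] at h2
    rw [h1] at h2
    refine (lop_congr fun j' _ => ?_).trans (h2.trans ?_)
    · exact ih (hx.add_int _) _ _ _ _
    · rw [pow_succ, mul_neg, mul_neg_one, neg_mul]
      rfl

theorem monCoeff_refl (hx : LocRegular f (V - U) x) {N : ℕ} (y : Fin N → ℂ) (i k : Fin N → ℤˣ)
    (hi : ∑ l, (i l : ℤ) = 0) (hk : ∑ l, (k l : ℤ) = 0) (j : ℕ) :
    monCoeff f U V y i k j x =
      (-1) ^ N * monCoeff f (-V - 2) (-U - 2) (-y) (-k) (-i) j (-(x + (V - U) - 2 * j)) := by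
  have h := mon_reflOp hf hx y i k (delta j) j
  have h2 : mon f U V y i k (reflOp f (V - U) (delta j)) x j =
      mon f U V y i k (fun z j' => ∑ q ∈ {()}, reflCoeff f (V - U) j x * delta j z j') x j := by
    refine mon_congr _ _ _ fun j' hj' => ?_
    have : j' = j := by rw [hi, hk] at hj'; omega
    simp [reflOp, this, hk, delta]
  have h3 : ∀ {N : ℕ} (y : Fin N → ℂ) (i k : Fin N → ℤˣ) (x c : ℂ) (j' : ℕ),
      mon f U V y i k (fun z j' => ∑ q ∈ {()}, c * delta j z j') x j' =
        c * mon f U V y i k (delta j) x j' := by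
    intro N y i k x c
    induction N generalizing x with
    | zero => simp [mon]
    | succ N ih =>
      intro j'
      have := lop_sum (f := f) (U := U + y 0) (V := V + y 0) {()} (fun _ => c)
        (fun _ => mon f U V (Fin.tail y) (Fin.tail i) (Fin.tail k) (delta j)) (i 0) (k 0) x j'
      rw [Finset.sum_singleton] at this
      refine (lop_congr fun _ _ => ?_).trans this
      rw [Finset.sum_singleton]
      exact ih ..
  rw [h2, h3, reflOp] at h
  -- For balanced sequences the gauge factor occurs on both sides at the same `x` and `j`, so it
  -- cancels from the diagonal entry.
  refine mul_left_cancel₀ (reflCoeff_ne_zero hx j) ?_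
  rw [monCoeff, h, monCoeff]
  ring

end Reflection

end EllipticSl2

namespace EllipticSl2

/-! ### Exchange relations for traces -/

section Exchange

variable {f : ℂ → ℂ} {U V U' V' x : ℂ}

theorem Regular.swap (hx : Regular f U V U' V' x) : Regular f U V' U' V x := fun n => by
  obtain ⟨h1, h2, h3, h4⟩ := hx n
  refine ⟨h1, h3, h2, ?_⟩
  convert h4 using 2
  ring

theorem Regular.locRegular_left (hx : Regular f U V U' V' x) (b : ℕ) :
    LocRegular f (V - U) (x + (V' - U') - 2 * b) := by
  intro n
  obtain ⟨-, h1, -, h2⟩ := hx (n - 2 * b)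
  push_cast at h1 h2
  refine ⟨?_, ?_⟩
  · convert h1 using 2; ring
  · convert h2 using 2; ring

theorem Regular.locRegular_right (hx : Regular f U V U' V' x) : LocRegular f (V' - U') x :=
  fun n => ⟨(hx n).1, (hx n).2.1⟩

theorem continuousAt_mon (hf : IsBracket f) (hx : LocRegular f (V - U) x) {N : ℕ}
    (y : Fin N → ℂ) (i k : Fin N → ℤˣ) (Φ : ℂ → ℕ → ℂ) (j : ℕ) :
    ContinuousAt (fun U => mon f U V y i k Φ x j) U := by
  induction N generalizing x j with
  | zero => exact continuousAt_const
  | succ N ih =>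
    have h := fun j' => ih (hx.add_int (k 0)) (Fin.tail y) (Fin.tail i) (Fin.tail k) j'
    have hc := hf.continuous
    simp only [mon, lop, locPP, locPM, locMP, locMM, add_sub_add_right_eq_sub]
    split_ifs with h1 h2 h2
    · rw [h2] at h
      simp only [Units.val_one, Int.cast_one] at h
      refine ContinuousAt.mul (ContinuousAt.div ?_ ?_ (mul_ne_zero ?_ ?_)) (h j)
      · fun_prop
      · fun_prop
      · exact hx.left 0 (by simp)
      · exact hx.right (-2 * j + 1) (by push_cast; ring)
    · cases j with
      | zero => exact continuousAt_const
      | succ j =>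
        have h2' := (Int.units_eq_one_or (k 0)).resolve_left h2
        rw [h2'] at h
        simp only [Units.val_neg, Units.val_one, Int.cast_neg, Int.cast_one,
          ← sub_eq_add_neg] at h
        simp only [predFun_succ]
        refine ContinuousAt.mul (ContinuousAt.mul (ContinuousAt.div ?_ ?_ ?_) ?_) (h j)
        · fun_prop
        · fun_prop
        · exact hx.right (-2 * j - 1) (by push_cast; ring)
        · fun_prop
    · rw [h2] at h
      simp only [Units.val_one, Int.cast_one] at h
      refine ContinuousAt.mul (ContinuousAt.neg (ContinuousAt.div ?_ ?_ ?_)) (h _)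
      · fun_prop
      · fun_prop
      · exact hx.left 0 (by simp)
    · have h2' := (Int.units_eq_one_or (k 0)).resolve_left h2
      rw [h2'] at h
      simp only [Units.val_neg, Units.val_one, Int.cast_neg, Int.cast_one, ← sub_eq_add_neg] at h
      refine ContinuousAt.mul ?_ (h _)
      fun_prop

theorem continuousAt_traceProd (hf : IsBracket f) (hx : Regular f U V U' V' x) {N : ℕ}
    (y : Fin N → ℂ) (i j : Fin N → ℤˣ) (m : ℕ) :
    ContinuousAt (fun U => traceProd f U V U' V' y i j m x) U := by
  unfold traceProd
  refine tendsto_finsetSum _ fun p _ => tendsto_finsetSum _ fun k _ => ?_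
  exact ContinuousAt.mul (continuousAt_mon hf (hx.locRegular_left _) ..) continuousAt_const

/-- Traces are invariant under the exchange of `V` and `V'`. -/
theorem traceProd_exchange (hf : IsBracket f) (hx : Regular f U V U' V' x) {N : ℕ}
    (y : Fin N → ℂ) (i j : Fin N → ℤˣ) (hi : ∑ l, (i l : ℤ) = 0) (hj : ∑ l, (j l : ℤ) = 0)
    (m : ℕ) : traceProd f U V U' V' y i j m x = traceProd f U V' U' V y i j m x := by
  -- Invertibility of the exchange operator and one regularity condition fail only for countably
  -- many `U`, while both traces are continuous in `U` at the given point.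
  refine eq_of_eventually_cocountable (g := fun U => traceProd f U V U' V' y i j m x)
    (h := fun U => traceProd f U V' U' V y i j m x)
    (continuousAt_traceProd hf hx ..) (continuousAt_traceProd hf hx.swap ..) ?_
  have h1 : ∀ᶠ U in cocountable, ∀ i : ℕ, f (V - U - i) ≠ 0 :=
    eventually_countable_forall.2 fun i => (hf.eventually_sub_ne (V - i)).mono fun U h => by
      rwa [show V - U - i = V - i - U by ring]
  have h2 : ∀ᶠ U in cocountable, ∀ i : ℕ, f (V' - U - i) ≠ 0 :=
    eventually_countable_forall.2 fun i => (hf.eventually_sub_ne (V' - i)).mono fun U h => by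
      rwa [show V' - U - i = V' - i - U by ring]
  have h3 : ∀ᶠ U in cocountable, ∀ n : ℤ, f (x + (V - U) + (V' - U') + n) ≠ 0 :=
    eventually_countable_forall.2 fun n =>
      (hf.eventually_sub_ne (x + V + (V' - U') + n)).mono fun U h => by
        rwa [show x + (V - U) + (V' - U') + n = x + V + (V' - U') + n - U by ring]
  filter_upwards [h1, h2, h3] with W hW hW' hW''
  exact traceProd_exchange_of_ne_zero hf hW hW'
    (fun n => ⟨(hx n).1, (hx n).2.1, (hx n).2.2.1, hW'' n⟩) y i j hi hj m

/-- Reflect both factors. Transposition reverses their order and turns the intermediate sequence `k`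
into `-k`; the two signs `(-1)^N` cancel, and unbalanced `k` contribute zero on both sides. -/
theorem traceProd_refl (hf : IsBracket f) (hx : Regular f U V U' V' x) {N : ℕ}
    (y : Fin N → ℂ) (i j : Fin N → ℤˣ) (hi : ∑ l, (i l : ℤ) = 0) (hj : ∑ l, (j l : ℤ) = 0)
    (m : ℕ) : traceProd f U V U' V' y i j m x =
      traceProd f (-V' - 2) (-U' - 2) (-V - 2) (-U - 2) (-y) (-j) (-i) m
        (-(x + (V - U) + (V' - U') - 2 * m)) := by
  unfold traceProd
  rw [← Finset.Nat.sum_antidiagonal_swap]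
  refine Finset.sum_congr rfl fun p hp => ?_
  rw [← Equiv.sum_comp (Equiv.neg (Fin N → ℤˣ))]
  refine Finset.sum_congr rfl fun k _ => ?_
  have hp' : (m : ℂ) = p.1 + p.2 := by
    exact_mod_cast (Finset.HasAntidiagonal.mem_antidiagonal.1 hp).symm
  simp only [Prod.fst_swap, Prod.snd_swap, Equiv.neg_apply]
  by_cases hk : ∑ l, (k l : ℤ) = 0
  · have hk' : ∑ l, ((-k) l : ℤ) = 0 := by simpa using hk
    rw [monCoeff_refl hf (hx.locRegular_left _) y i (-k) hi hk',
      monCoeff_refl hf hx.locRegular_right y (-k) j hk' hj, neg_neg, mul_mul_mul_comm, ← mul_pow]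
    rw [show ((-1 : ℂ) * -1) = 1 by norm_num, one_pow, one_mul, mul_comm]
    congr 2 <;> rw [hp'] <;> ring
  · rw [monCoeff_eq_zero y i (-k) (by rw [hi]; simpa [eq_comm] using hk), zero_mul,
      monCoeff_eq_zero (-y) (-j) k (by simpa [hj, eq_comm] using hk), zero_mul]

theorem eventually_regular (hf : IsBracket f) (U V U' V' : ℂ) :
    ∀ᶠ x in cocountable, Regular f U V U' V' x := by
  refine eventually_countable_forall.2 fun n => ?_
  filter_upwards [hf.eventually_add_ne n, hf.eventually_add_ne (V' - U' + n),
    hf.eventually_add_ne (V - U' + n), hf.eventually_add_ne (V - U + (V' - U') + n)]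
    with x h1 h2 h3 h4
  simp only [add_assoc] at *
  exact ⟨h1, h2, h3, h4⟩

/-- Traces are invariant under the exchange of `U` and `U'`. -/
theorem traceProd_exchange' (hf : IsBracket f) (U V U' V' : ℂ) {N : ℕ}
    (y : Fin N → ℂ) (i j : Fin N → ℤˣ) (hi : ∑ l, (i l : ℤ) = 0) (hj : ∑ l, (j l : ℤ) = 0)
    (m : ℕ) : ∀ᶠ x in cocountable,
      traceProd f U V U' V' y i j m x = traceProd f U' V U V' y i j m x := by
  have h := (tendsto_cocountable_of_injective (g := fun x =>
    -(x + (V - U) + (V' - U') - 2 * m)) (fun x y h => by simpa using h)).eventually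
    (eventually_regular hf (-V' - 2) (-U' - 2) (-V - 2) (-U - 2))
  filter_upwards [eventually_regular hf U V U' V', eventually_regular hf U' V U V', h]
    with x h1 h2 h3
  have hi' : ∑ l, ((-i) l : ℤ) = 0 := by simpa using hi
  have hj' : ∑ l, ((-j) l : ℤ) = 0 := by simpa using hj
  -- After reflection the second parameters are `-U' - 2` and `-U - 2`, so exchanging them exchanges
  -- `U` and `U'`.
  rw [traceProd_refl hf h1 y i j hi hj, traceProd_refl hf h2 y i j hi hj,
    traceProd_exchange hf h3 (-y) (-j) (-i) hj' hi']
  congr 2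
  ring

end Exchange

end EllipticSl2

namespace EllipticSl2

/-! ### Meromorphic functions represented off a countable set -/

/-- The function `F` represents the meromorphic function `g` off a countable set. -/
def Mero.IsRep (g : Mero) (F : ℂ → ℂ) : Prop :=
  ∃ (h : ℂ → ℂ) (hm : Meromorphic h), g = Mero.mk h hm ∧ ∀ᶠ x in cocountable, h x = F x

namespace Mero

theorem isRep_mk {h : ℂ → ℂ} {hm : Meromorphic h} : (mk h hm).IsRep h :=
  ⟨h, hm, rfl, Eventually.of_forall fun _ => rfl⟩

namespace IsRep

variable {g g' : Mero} {F F' : ℂ → ℂ}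

theorem congr (h : g.IsRep F) (hF : ∀ᶠ x in cocountable, F x = F' x) : g.IsRep F' := by
  obtain ⟨u, hu, rfl, h⟩ := h
  exact ⟨u, hu, rfl, by filter_upwards [h, hF] with x h1 h2 using h1.trans h2⟩

/-- A nonzero meromorphic function vanishes only on a countable set, so values off a countable set
determine the germ. This transfers pointwise identities to `Mero`. -/
theorem eq_of_eventuallyEq (h : g.IsRep F) (h' : g'.IsRep F')
    (hF : ∀ᶠ x in cocountable, F x = F' x) : g = g' := by
  obtain ⟨u, hu, rfl, h⟩ := h
  obtain ⟨v, hv, rfl, h'⟩ := h'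
  rw [mk_eq_iff]
  rcases meromorphic_zero_or (hu.sub hv) with h0 | h0
  · filter_upwards [h0] with x hx
    exact sub_eq_zero.1 hx
  · have h0' : ∀ᶠ x in cocountable, (u - v) x ≠ 0 := cocountable_le_codiscrete h0
    obtain ⟨x, h1, h2, h3, h4⟩ := (h0'.and (h.and (h'.and hF))).exists
    exact absurd (sub_eq_zero.2 (h2.trans (h4.trans h3.symm))) h1

theorem add (h : g.IsRep F) (h' : g'.IsRep F') : (g + g').IsRep fun x => F x + F' x := by
  obtain ⟨u, hu, rfl, h⟩ := h
  obtain ⟨v, hv, rfl, h'⟩ := h'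
  refine ⟨u + v, hu.add hv, rfl, ?_⟩
  filter_upwards [h, h'] with x h1 h2
  rw [Pi.add_apply, h1, h2]

theorem mul (h : g.IsRep F) (h' : g'.IsRep F') : (g * g').IsRep fun x => F x * F' x := by
  obtain ⟨u, hu, rfl, h⟩ := h
  obtain ⟨v, hv, rfl, h'⟩ := h'
  refine ⟨u * v, hu.mul hv, rfl, ?_⟩
  filter_upwards [h, h'] with x h1 h2
  rw [Pi.mul_apply, h1, h2]

theorem const (c : ℂ) : (Mero.const c).IsRep fun _ => c :=
  isRep_mk (hm := Meromorphic.const c)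

theorem smul (c : ℂ) (h : g.IsRep F) : (c • g).IsRep fun x => c * F x := by
  rw [Algebra.smul_def]
  exact (const c).mul h

theorem zero : (0 : Mero).IsRep fun _ => 0 := by
  simpa using const 0

theorem one : (1 : Mero).IsRep fun _ => 1 := by
  simpa using const 1

theorem sum {ι : Type*} (s : Finset ι) {g : ι → Mero} {F : ι → ℂ → ℂ}
    (h : ∀ q ∈ s, (g q).IsRep (F q)) : (∑ q ∈ s, g q).IsRep fun x => ∑ q ∈ s, F q x := by
  classical
  induction s using Finset.induction_on with
  | empty => simpa using zero
  | insert q s hq ih =>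
    simp only [Finset.sum_insert hq]
    exact (h q (Finset.mem_insert_self _ _)).add
      (ih fun r hr => h r (Finset.mem_insert_of_mem hr))

theorem shift (c : ℂ) (h : g.IsRep F) : (Mero.shift c g).IsRep fun x => F (x + c) := by
  obtain ⟨u, hu, rfl, h⟩ := h
  refine ⟨_, _, shift_mk c u hu, ?_⟩
  exact (tendsto_cocountable_of_injective (add_left_injective c)).eventually h

theorem ne_zero (h : g.IsRep F) (hF : ∀ᶠ x in cocountable, F x ≠ 0) : g ≠ 0 := by
  rintro rfl
  obtain ⟨u, hu, h0, h⟩ := h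
  have h1 := mk_eq_iff.1 ((show mk (fun _ => 0) (Meromorphic.const 0) = mk u hu from h0))
  have h1' : ∀ᶠ x in cocountable, 0 = u x := cocountable_le_codiscrete h1
  obtain ⟨x, h2, h3, h4⟩ := (h1'.and (h.and hF)).exists
  exact h4 (h3 ▸ h2.symm)

end IsRep

end Mero

/-! ### The asymptotic representations in coordinates -/

section Coordinates

/-- The theta function in units of `ħ`. -/
noncomputable def scaledTheta (τ : ℍ) (ħ t : ℂ) : ℂ := theta τ (ħ * t)

theorem isBracket_scaledTheta {τ : ℍ} {ħ : ℂ} (hħ : ħ ≠ 0)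
    (hlat : ∀ k r s : ℤ, (k : ℂ) * ħ = (r : ℂ) + (s : ℂ) * (τ : ℂ) → (k : ℂ) * ħ = 0) :
    IsBracket (scaledTheta τ ħ) where
  odd x := by rw [scaledTheta, mul_neg, theta_neg, scaledTheta]
  threeTerm := by
    intro x y z w
    have := theta_threeTerm τ (ħ * x) (ħ * y) (ħ * z) (ħ * w)
    simpa only [scaledTheta, mul_add, mul_sub] using this
  continuous := (differentiable_theta τ).continuous.comp (continuous_const.mul continuous_id)
  eventually_ne := (tendsto_cocountable_of_injective (mul_right_injective₀ hħ)).eventually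
    (eventually_theta_ne_zero τ)
  -- The zeros of theta are lattice points, and no nonzero multiple of `ħ` is one.
  nat_ne n h := by
    obtain ⟨r, s, hrs⟩ := exists_int_of_theta_eq_zero h
    have := hlat (n + 1) r s (by push_cast; rw [← hrs]; ring)
    simp only [mul_eq_zero, hħ, or_false] at this
    norm_cast at this

variable {τ : ℍ} {ħ : ℂ} (hħ : ħ ≠ 0)
include hħ

theorem isRep_coeffPP (ℓ z : ℂ) (j : ℕ) : (coeffPP τ ħ ℓ z j).IsRep fun x =>
    locPP (scaledTheta τ ħ) (z / ħ) (z / ħ + ℓ) j (x / ħ) := by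
  refine Mero.isRep_mk.congr (Eventually.of_forall fun x => ?_)
  have h := fun w => mul_div_cancel₀ w hħ
  simp only [locPP, scaledTheta]
  rw [show z + (ℓ - j + 1) * ħ = ħ * (z / ħ + ℓ - j + 1) by linear_combination -h z,
    show x + (ℓ - j + 1) * ħ = ħ * (x / ħ + (z / ħ + ℓ - z / ħ) - j + 1) by
      linear_combination -h x,
    show x - j * ħ = ħ * (x / ħ - j) by linear_combination -h x, h x,
    show x + (ℓ - 2 * j + 1) * ħ = ħ * (x / ħ + (z / ħ + ℓ - z / ħ) - 2 * j + 1) by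
      linear_combination -h x]

theorem isRep_coeffPM (ℓ z : ℂ) (j : ℕ) : (coeffPM τ ħ ℓ z j).IsRep fun x =>
    locPM (scaledTheta τ ħ) (z / ħ) (z / ħ + ℓ) j (x / ħ) *
      scaledTheta τ ħ (z / ħ + ℓ - z / ħ - j) := by
  refine Mero.isRep_mk.congr (Eventually.of_forall fun x => ?_)
  have h := fun w => mul_div_cancel₀ w hħ
  simp only [locPM, scaledTheta, div_mul_eq_mul_div]
  rw [show z + x + (ℓ - j) * ħ = ħ * (z / ħ + ℓ + x / ħ - j) by linear_combination -h z - h x,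
    show (ℓ - j) * ħ = ħ * (z / ħ + ℓ - z / ħ - j) by ring,
    show x + (ℓ - 2 * j - 1) * ħ = ħ * (x / ħ + (z / ħ + ℓ - z / ħ) - 2 * j - 1) by
      linear_combination -h x]

theorem isRep_coeffMP (z : ℂ) (j : ℕ) : (coeffMP τ ħ z j).IsRep fun x =>
    locMP (scaledTheta τ ħ) (z / ħ) j (x / ħ) := by
  refine Mero.isRep_mk.congr (Eventually.of_forall fun x => ?_)
  have h := fun w => mul_div_cancel₀ w hħ
  simp only [locMP, scaledTheta]
  rw [show z - x + j * ħ = ħ * (z / ħ - x / ħ + j) by linear_combination -h z + h x, h x,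
    mul_comm (j : ℂ) ħ]

theorem isRep_coeffMM (z : ℂ) (j : ℕ) : (coeffMM τ ħ z j).IsRep fun _ =>
    locMM (scaledTheta τ ħ) (z / ħ) j := by
  refine Mero.isRep_mk.congr (Eventually.of_forall fun x => ?_)
  have h := fun w => mul_div_cancel₀ w hħ
  simp only [locMM, scaledTheta]
  rw [show z + (j + 1) * ħ = ħ * (z / ħ + j + 1) by linear_combination -h z]

theorem isRep_asymL (ℓ z : ℂ) (i k : ℤˣ) {v : ℕ →₀ Mero} {Φ : ℂ → ℕ → ℂ}
    (hv : ∀ j, (v j).IsRep fun x => Φ (x / ħ) j) (j : ℕ) :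
    (asymL τ ħ ℓ z i k v j).IsRep fun x =>
      lop (scaledTheta τ ħ) (z / ħ) (z / ħ + ℓ) i k Φ (x / ħ) j := by
  have hs : ∀ j, (Mero.shift (((k : ℤ) : ℂ) * ħ) (v j)).IsRep
      fun x => Φ (x / ħ + ((k : ℤ) : ℂ)) j := fun j =>
    ((hv j).shift _).congr (Eventually.of_forall fun x => by
      simp only [add_div, mul_div_cancel_right₀ _ hħ])
  have happ : asymL τ ħ ℓ z i k v j = v.sum fun j' g =>
      Mero.shift (((k : ℤ) : ℂ) * ħ) g * asymVec τ ħ ℓ z i k j' j := by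
    rw [asymL_apply, Finsupp.sum, Finsupp.finsetSum_apply]
    rfl
  -- Each component of the image receives a contribution from at most one basis vector.
  have hsingle : ∀ j₀ : ℕ, (∀ j' ≠ j₀, asymVec τ ħ ℓ z i k j' j = 0) →
      asymL τ ħ ℓ z i k v j =
        asymVec τ ħ ℓ z i k j₀ j * Mero.shift (((k : ℤ) : ℂ) * ħ) (v j₀) := by
    intro j₀ h
    rw [happ, Finsupp.sum, Finset.sum_eq_single j₀, mul_comm]
    · intro j' _ hj'
      rw [h j' hj', mul_zero]
    · intro h0
      rw [Finsupp.notMem_support_iff.1 h0, map_zero, zero_mul]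
  rcases Int.units_eq_one_or i with rfl | rfl <;> rcases Int.units_eq_one_or k with rfl | rfl
  · rw [hsingle j fun j' hj' => by simp [asymVec, hj']]
    have := (isRep_coeffPP hħ (τ := τ) ℓ z j).mul (hs j)
    simpa [asymVec] using this
  · cases j with
    | zero =>
      rw [hsingle 0 fun j' hj' => by simp [asymVec]]
      simpa [asymVec] using Mero.IsRep.zero
    | succ j =>
      rw [hsingle j fun j' hj' => by simp [asymVec, hj']]
      have := (isRep_coeffPM hħ (τ := τ) ℓ z j).mul (hs j)
      simpa [asymVec, ← sub_eq_add_neg] using this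
  · rw [hsingle (j + 1) fun j' hj' => by
      cases j' with
      | zero => simp [asymVec]
      | succ j' => simp only [ne_eq, add_left_inj] at hj'; simp [asymVec, hj']]
    have := (isRep_coeffMP hħ (τ := τ) z (j + 1)).mul (hs (j + 1))
    simpa [asymVec] using this
  · rw [hsingle j fun j' hj' => by simp [asymVec, hj']]
    have := (isRep_coeffMM hħ (τ := τ) z j).mul (hs j)
    simpa [asymVec, ← sub_eq_add_neg] using this

theorem isRep_monodromy {N : ℕ} (a : Fin N → ℂ) (ℓ z : ℂ) (i k : Fin N → ℤˣ) {v : ℕ →₀ Mero}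
    {Φ : ℂ → ℕ → ℂ} (hv : ∀ j, (v j).IsRep fun x => Φ (x / ħ) j) (j : ℕ) :
    ((List.ofFn fun l => asymL τ ħ ℓ (z + a l - ħ) (i l) (k l)).prod v j).IsRep fun x =>
      mon (scaledTheta τ ħ) (z / ħ - 1) (z / ħ - 1 + ℓ) (fun l => a l / ħ) i k Φ (x / ħ) j := by
  induction N generalizing j with
  | zero => simpa [mon] using hv j
  | succ N ih =>
    rw [List.ofFn_succ, List.prod_cons, Module.End.mul_apply]
    have := isRep_asymL hħ (τ := τ) ℓ (z + a 0 - ħ) (i 0) (k 0)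
      (fun j => ih (fun l => a l.succ) (fun l => i l.succ) (fun l => k l.succ) j) j
    rw [show (z + a 0 - ħ) / ħ = z / ħ - 1 + a 0 / ħ by field_simp; ring,
      show z / ħ - 1 + a 0 / ħ + ℓ = z / ħ - 1 + ℓ + a 0 / ħ by ring] at this
    exact this

omit hħ in
-- The weight space is the line spanned by `w_m`, so the trace is a diagonal coefficient.
theorem trace_asymWt (ℓ : ℂ) (m : ℕ) (T : Module.End ℂ (ℕ →₀ Mero))
    (hT : IsDiffOp ħ (asymWt ℓ) 0 0 T) :
    LinearMap.trace Mero (asymWt ℓ (ℓ - 2 * m)) (hT.restrict (ℓ - 2 * m)) =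
      T (Finsupp.single m 1) m := by
  have hset : {j : ℕ | ℓ - 2 * j = ℓ - 2 * m} = {m} := by
    ext j
    simp
  have hmem : ∀ v ∈ asymWt ℓ (ℓ - 2 * m), v = v m • Finsupp.single m 1 := by
    intro v hv
    rw [asymWt, hset, Finsupp.mem_supported] at hv
    ext j
    by_cases h : j = m
    · simp [h]
    · have : v j = 0 := by
        by_contra h0
        exact h (by simpa using hv (Finsupp.mem_support_iff.2 h0))
      simp [this, h]
  have hm : Finsupp.single m (1 : Mero) ∈ asymWt ℓ (ℓ - 2 * m) :=
    Finsupp.single_mem_supported _ _ (by simp)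
  have hr : hT.restrict (ℓ - 2 * m) = T (Finsupp.single m 1) m • LinearMap.id := by
    ext1 ⟨v, hv⟩
    apply Subtype.ext
    have h1 : T (Finsupp.single m 1) ∈ asymWt ℓ (ℓ - 2 * m) := by
      have := hT.1 _ _ hm
      rwa [add_zero, sub_zero] at this
    have h2 := hT.2 (v m) (Finsupp.single m 1)
    rw [← hmem v hv, zero_mul, Mero.shift_zero] at h2
    change T v = T (Finsupp.single m 1) m • v
    rw [h2, hmem _ h1, hmem v hv]
    simp [mul_comm]
  have hfin : Module.finrank Mero (asymWt ℓ (ℓ - 2 * m)) = 1 := by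
    rw [asymWt, hset, (Finsupp.supportedEquivFinsupp ({m} : Set ℕ)).finrank_eq,
      Module.finrank_finsupp_self]
    simp
  have hfree : Module.Free Mero (asymWt ℓ (ℓ - 2 * m)) :=
    Module.Free.of_equiv (Finsupp.supportedEquivFinsupp {j : ℕ | ℓ - 2 * j = ℓ - 2 * m}).symm
  have hfin' := asymWt_finite ℓ (ℓ - 2 * m)
  have htr := LinearMap.trace_id Mero (asymWt ℓ (ℓ - 2 * m))
  rw [hfin, Nat.cast_one] at htr
  rw [hr, map_smul]
  exact (congrArg _ htr).trans (mul_one _)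

theorem isRep_traceMatrix {N : ℕ} (a : Fin N → ℂ) (ℓ z : ℂ) (m : ℕ) (i k : BalancedSigns N) :
    ((asymptoticRep τ ħ ℓ).traceMatrix a z (ℓ - 2 * m) i k).IsRep fun x =>
      monCoeff (scaledTheta τ ħ) (z / ħ - 1) (z / ħ - 1 + ℓ) (fun l => a l / ħ) i.1 k.1 m
        (x / ħ) := by
  have h := isRep_monodromy hħ (τ := τ) a ℓ z i.1 k.1 (v := Finsupp.single m 1) (Φ := delta m)
    (fun j => by
      by_cases h : j = m
      · simpa [h, delta] using Mero.IsRep.one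
      · simpa [h, delta] using Mero.IsRep.zero) m
  have h2 : (asymptoticRep τ ħ ℓ).traceMatrix a z (ℓ - 2 * m) i k = _ :=
    trace_asymWt (ħ := ħ) ℓ m _ ((asymptoticRep τ ħ ℓ).monodromy_isDiffOp a z i k)
  rw [h2]
  exact h

omit hħ in
theorem traceMatrix_eq_zero {N : ℕ} (a : Fin N → ℂ) (ℓ z α : ℂ) (h : ∀ m : ℕ, α ≠ ℓ - 2 * m) :
    (asymptoticRep τ ħ ℓ).traceMatrix a z α = 0 := by
  ext i j
  have hbot : (asymptoticRep τ ħ ℓ).wt α = ⊥ := by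
    change asymWt ℓ α = ⊥
    rw [asymWt, Set.eq_empty_of_forall_notMem (s := {j : ℕ | ℓ - 2 * j = α})
      fun j hj => h j hj.symm, Finsupp.supported_empty]
  have : Subsingleton ((asymptoticRep τ ħ ℓ).wt α) := by rw [hbot]; infer_instance
  change LinearMap.trace Mero _ _ = 0
  rw [Subsingleton.elim (IsDiffOp.restrict _ α) 0, map_zero]

end Coordinates

end EllipticSl2

namespace EllipticSl2

/-! ### Formal series supported on a single cone -/

section Cone

open scoped ComplexOrder

/-- The exponents `-2m`. -/
def negTwoHom : ℕ →+ ℂᵒᵈ where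
  toFun m := OrderDual.toDual (-(2 * (m : ℂ)))
  map_zero' := by simp
  map_add' m n := by
    rw [← toDual_add]
    congr 1
    push_cast
    ring

theorem negTwoHom_le (m n : ℕ) : negTwoHom m ≤ negTwoHom n ↔ m ≤ n := by
  change OrderDual.toDual (-(2 * (m : ℂ))) ≤ OrderDual.toDual (-(2 * (n : ℂ))) ↔ _
  rw [OrderDual.toDual_le_toDual, neg_le_neg_iff, Complex.le_def]
  simp

theorem negTwoHom_injective : Function.Injective negTwoHom := fun m n h =>
  le_antisymm ((negTwoHom_le m n).1 h.le) ((negTwoHom_le n m).1 h.ge)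

/-- Substitution of `p^{-2}` into a power series. -/
noncomputable def conePower (E : Type*) [Semiring E] : PowerSeries E →+* HahnSeries ℂᵒᵈ E :=
  (HahnSeries.embDomainRingHom negTwoHom negTwoHom_injective negTwoHom_le).comp
    (RingEquiv.toRingHom HahnSeries.toPowerSeries.symm)

variable {E : Type*} [Ring E]

theorem coeff_conePower (φ : PowerSeries E) (m : ℕ) :
    (conePower E φ).coeff (OrderDual.toDual (-(2 * (m : ℂ)))) = PowerSeries.coeff m φ :=
  HahnSeries.embDomain_coeff (f := ⟨⟨negTwoHom, negTwoHom_injective⟩, negTwoHom_le _ _⟩)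
    (x := HahnSeries.toPowerSeries.symm φ) (a := m)

theorem coeff_conePower_of_ne (φ : PowerSeries E) (α : ℂ) (h : ∀ m : ℕ, α ≠ -(2 * (m : ℂ))) :
    (conePower E φ).coeff (OrderDual.toDual α) = 0 :=
  HahnSeries.embDomain_of_notMem_range
    (f := ⟨⟨negTwoHom, negTwoHom_injective⟩, negTwoHom_le _ _⟩)
    (x := HahnSeries.toPowerSeries.symm φ) (by
      rintro ⟨m, hm⟩
      exact h m (congrArg OrderDual.ofDual hm).symm)

variable (E) in
/-- The central monomial `p^α`. -/
noncomputable def monomial (α : ℂ) : HahnSeries ℂᵒᵈ E := HahnSeries.single (OrderDual.toDual α) 1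

theorem coeff_monomial_mul (α β : ℂ) (x : HahnSeries ℂᵒᵈ E) :
    (monomial E α * x).coeff (OrderDual.toDual β) = x.coeff (OrderDual.toDual (β - α)) := by
  rw [monomial, HahnSeries.coeff_single_mul, one_mul]
  rfl

theorem monomial_mul_comm (α : ℂ) (x : HahnSeries ℂᵒᵈ E) :
    monomial E α * x = x * monomial E α := by
  ext β
  rw [monomial, HahnSeries.coeff_single_mul, HahnSeries.coeff_mul_single, one_mul, mul_one]

theorem monomial_mul_monomial (α β : ℂ) : monomial E α * monomial E β = monomial E (α + β) := by
  rw [monomial, monomial, HahnSeries.single_mul_single, one_mul]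
  rfl

theorem monomial_zero : monomial E 0 = 1 := rfl

theorem monomial_mul_mul (α β : ℂ) (φ ψ : PowerSeries E) :
    monomial E α * conePower E φ * (monomial E β * conePower E ψ) =
      monomial E (α + β) * conePower E (φ * ψ) := by
  rw [map_mul, ← monomial_mul_monomial, mul_assoc, ← mul_assoc (conePower E φ),
    ← monomial_mul_comm, mul_assoc, mul_assoc]

theorem coeff_monomial_mul_conePower (ℓ : ℂ) (φ : PowerSeries E) (m : ℕ) :
    (monomial E ℓ * conePower E φ).coeff (OrderDual.toDual (ℓ - 2 * m)) =
      PowerSeries.coeff m φ := by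
  rw [coeff_monomial_mul, show ℓ - 2 * (m : ℂ) - ℓ = -(2 * m) by ring, coeff_conePower]

theorem coeff_monomial_mul_conePower_of_ne (ℓ α : ℂ) (φ : PowerSeries E)
    (h : ∀ m : ℕ, α ≠ ℓ - 2 * m) :
    (monomial E ℓ * conePower E φ).coeff (OrderDual.toDual α) = 0 := by
  rw [coeff_monomial_mul]
  refine coeff_conePower_of_ne _ _ fun m hm => h m ?_
  linear_combination hm

end Cone

/-! ### Composition and invertibility of the difference operators `T_α A` -/

section Operators

variable {ħ : ℂ} {N : ℕ}

/-- The difference operator `T_α A`. -/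
noncomputable def diffOp (ħ : ℂ) {N : ℕ} (α : ℂ)
    (A : Matrix (BalancedSigns N) (BalancedSigns N) Mero) : Module.End ℂ (SpinSpace N) :=
  shiftOp ħ N α * (Matrix.toLin' A).restrictScalars ℂ

theorem diffOp_apply (α : ℂ) (A : Matrix (BalancedSigns N) (BalancedSigns N) Mero)
    (v : SpinSpace N) (i : BalancedSigns N) :
    diffOp ħ α A v i = Mero.shift (-α * ħ) (∑ j, A i j * v j) := rfl

theorem diffOp_mul (α β : ℂ) (A B : Matrix (BalancedSigns N) (BalancedSigns N) Mero) :
    diffOp ħ α A * diffOp ħ β B = diffOp ħ (α + β) (A.map (Mero.shift (β * ħ)) * B) := by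
  refine LinearMap.ext fun v => funext fun i => ?_
  simp only [Module.End.mul_apply, diffOp_apply, Matrix.mul_apply, Matrix.map_apply]
  have h : ∀ g : Mero, Mero.shift (-β * ħ) (Mero.shift (β * ħ) g) = g := fun g => by
    rw [Mero.shift_shift, show -β * ħ + β * ħ = 0 by ring, Mero.shift_zero]
  rw [show -(α + β) * ħ = -α * ħ + -β * ħ by ring, ← Mero.shift_shift]
  congr 1
  simp only [Finset.sum_mul, map_sum, Finset.mul_sum, map_mul, h]
  rw [Finset.sum_comm]
  simp only [mul_assoc]

theorem diffOp_zero_one : diffOp ħ (N := N) 0 1 = 1 := by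
  refine LinearMap.ext fun v => funext fun i => ?_
  simp [diffOp_apply, Matrix.one_apply, Mero.shift_zero]

theorem diffOp_sum {ι : Type*} (s : Finset ι) (α : ℂ)
    (A : ι → Matrix (BalancedSigns N) (BalancedSigns N) Mero) :
    diffOp ħ α (∑ q ∈ s, A q) = ∑ q ∈ s, diffOp ħ α (A q) := by
  refine LinearMap.ext fun v => funext fun i => ?_
  simp only [LinearMap.sum_apply, Finset.sum_apply, diffOp_apply, Matrix.sum_apply, Finset.sum_mul]
  rw [Finset.sum_comm, map_sum]

theorem isUnit_diffOp (α : ℂ) {A : Matrix (BalancedSigns N) (BalancedSigns N) Mero}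
    (hA : A.det ≠ 0) : IsUnit (diffOp ħ α A) := by
  have hA' : IsUnit A.det := isUnit_iff_ne_zero.2 hA
  have h1 : IsUnit (diffOp ħ α (1 : Matrix (BalancedSigns N) (BalancedSigns N) Mero)) := by
    refine ⟨⟨diffOp ħ α 1, diffOp ħ (-α) 1, ?_, ?_⟩, rfl⟩ <;>
      rw [diffOp_mul, Matrix.map_one _ (map_zero _) (map_one _), Matrix.one_mul] <;>
      simp [diffOp_zero_one]
  have h2 : IsUnit (diffOp ħ 0 A) := by
    have hm : ∀ M : Matrix (BalancedSigns N) (BalancedSigns N) Mero,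
        M.map (Mero.shift (0 * ħ)) = M := fun M => by
      ext i j
      simp [Mero.shift_zero]
    refine ⟨⟨diffOp ħ 0 A, diffOp ħ 0 A⁻¹, ?_, ?_⟩, rfl⟩
    · rw [diffOp_mul, hm, Matrix.mul_nonsing_inv _ hA', add_zero, diffOp_zero_one]
    · rw [diffOp_mul, hm, Matrix.nonsing_inv_mul _ hA', add_zero, diffOp_zero_one]
  have h3 := h1.mul h2
  rwa [diffOp_mul, Matrix.map_one _ (map_zero _) (map_one _), Matrix.one_mul, add_zero] at h3

end Operators

/-! ### Products of transfer matrices and their exchange relations -/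

section Transfer

open scoped ComplexOrder

variable {ħ : ℂ} {N : ℕ} (τ : ℍ) (a : Fin N → ℂ)

/-- The coefficients of a transfer matrix. -/
noncomputable def transferCoeff (ħ : ℂ) (ℓ z : ℂ) : PowerSeries (Module.End ℂ (SpinSpace N)) :=
  PowerSeries.mk fun m => diffOp ħ (ℓ - 2 * m) ((asymptoticRep τ ħ ℓ).traceMatrix a z (ℓ - 2 * m))

/-- All weights lie in the single cone `ℓ - 2ℕ`. Since `p^ℓ` is central, products and inverses
reduce to those of power series in `p^{-2}`. -/
theorem asymTransfer_val (ℓ z : ℂ) :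
    (asymTransfer τ ħ a ℓ z : HahnSeries ℂᵒᵈ (Module.End ℂ (SpinSpace N))) =
      monomial _ ℓ * conePower _ (transferCoeff τ a ħ ℓ z) := by
  ext1
  funext α
  obtain ⟨α, rfl⟩ := OrderDual.toDual.surjective α
  change diffOp ħ α ((asymptoticRep τ ħ ℓ).traceMatrix a z α) = _
  by_cases h : ∃ m : ℕ, α = ℓ - 2 * m
  · obtain ⟨m, rfl⟩ := h
    rw [coeff_monomial_mul_conePower, transferCoeff, PowerSeries.coeff_mk]
  · push Not at h
    rw [coeff_monomial_mul_conePower_of_ne _ _ _ h, traceMatrix_eq_zero a ℓ z α h]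
    refine LinearMap.ext fun v => funext fun i => ?_
    simp [diffOp_apply]

/-- The matrix coefficients of a product of transfer matrices. -/
noncomputable def transferProd (ħ : ℂ) (ℓ z ℓ' z' : ℂ) (m : ℕ) :
    Matrix (BalancedSigns N) (BalancedSigns N) Mero :=
  ∑ p ∈ Finset.HasAntidiagonal.antidiagonal m,
    ((asymptoticRep τ ħ ℓ).traceMatrix a z (ℓ - 2 * (p.1 : ℕ))).map
        (Mero.shift ((ℓ' - 2 * (p.2 : ℕ)) * ħ)) *
      (asymptoticRep τ ħ ℓ').traceMatrix a z' (ℓ' - 2 * (p.2 : ℕ))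

theorem transferCoeff_mul (ℓ z ℓ' z' : ℂ) :
    transferCoeff τ a ħ ℓ z * transferCoeff τ a ħ ℓ' z' =
      PowerSeries.mk fun m => diffOp ħ (ℓ + ℓ' - 2 * m) (transferProd τ a ħ ℓ z ℓ' z' m) := by
  ext1 m
  rw [PowerSeries.coeff_mul, PowerSeries.coeff_mk, transferProd, diffOp_sum]
  refine Finset.sum_congr rfl fun p hp => ?_
  rw [transferCoeff, transferCoeff, PowerSeries.coeff_mk, PowerSeries.coeff_mk, diffOp_mul,
    ← Finset.HasAntidiagonal.mem_antidiagonal.1 hp]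
  congr 1
  push_cast
  ring

theorem asymTransfer_mul_eq {ℓ₁ z₁ ℓ₂ z₂ ℓ₃ z₃ ℓ₄ z₄ : ℂ} (h : ℓ₁ + ℓ₂ = ℓ₃ + ℓ₄)
    (hm : ∀ m, transferProd τ a ħ ℓ₁ z₁ ℓ₂ z₂ m = transferProd τ a ħ ℓ₃ z₃ ℓ₄ z₄ m) :
    asymTransfer τ ħ a ℓ₁ z₁ * asymTransfer τ ħ a ℓ₂ z₂ =
      asymTransfer τ ħ a ℓ₃ z₃ * asymTransfer τ ħ a ℓ₄ z₄ := by
  apply Subtype.ext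
  simp only [MulMemClass.coe_mul, asymTransfer_val, monomial_mul_mul, transferCoeff_mul, h, hm]

variable {τ}

/-- Commuting `T_β` to the left shifts the first matrix by the weight `β` of the second factor,
which is the dynamical shift in the tensor product. The offset `-1` in the parameters comes from the
argument `z + a_l - ħ`. -/
theorem isRep_transferProd (hħ : ħ ≠ 0) (ℓ z ℓ' z' : ℂ) (m : ℕ) (i j : BalancedSigns N) :
    (transferProd τ a ħ ℓ z ℓ' z' m i j).IsRep fun x =>
      traceProd (scaledTheta τ ħ) (z / ħ - 1) (z / ħ - 1 + ℓ) (z' / ħ - 1) (z' / ħ - 1 + ℓ')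
        (fun l => a l / ħ) i.1 j.1 m (x / ħ) := by
  have h : (transferProd τ a ħ ℓ z ℓ' z' m i j).IsRep fun x =>
      ∑ p ∈ Finset.HasAntidiagonal.antidiagonal m, ∑ k : BalancedSigns N,
        monCoeff (scaledTheta τ ħ) (z / ħ - 1) (z / ħ - 1 + ℓ) (fun l => a l / ħ) i.1 k.1 p.1
          ((x + (ℓ' - 2 * (p.2 : ℕ)) * ħ) / ħ) *
        monCoeff (scaledTheta τ ħ) (z' / ħ - 1) (z' / ħ - 1 + ℓ') (fun l => a l / ħ) k.1 j.1 p.2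
          (x / ħ) := by
    simp only [transferProd, Matrix.sum_apply, Matrix.mul_apply, Matrix.map_apply]
    exact Mero.IsRep.sum _ fun p _ => Mero.IsRep.sum _ fun k _ =>
      ((isRep_traceMatrix hħ a ℓ z p.1 i k).shift _).mul (isRep_traceMatrix hħ a ℓ' z' p.2 k j)
  refine h.congr (Eventually.of_forall fun x => Finset.sum_congr rfl fun p _ => ?_)
  have hx : (x + (ℓ' - 2 * (p.2 : ℕ)) * ħ) / ħ =
      x / ħ + (z' / ħ - 1 + ℓ' - (z' / ħ - 1)) - 2 * (p.2 : ℕ) := by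
    rw [add_div, mul_div_cancel_right₀ _ hħ]
    ring
  rw [hx, ← Finset.sum_subtype (Finset.univ.filter fun k : Fin N → ℤˣ => ∑ l, (k l : ℤ) = 0)
    (by simp) fun k => monCoeff (scaledTheta τ ħ) (z / ħ - 1) (z / ħ - 1 + ℓ) (fun l => a l / ħ)
      i.1 k p.1 (x / ħ + (z' / ħ - 1 + ℓ' - (z' / ħ - 1)) - 2 * (p.2 : ℕ)) *
        monCoeff (scaledTheta τ ħ) (z' / ħ - 1) (z' / ħ - 1 + ℓ') (fun l => a l / ħ) k j.1 p.2
          (x / ħ)]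
  -- The matrix product runs over balanced `k` only, the tensor product trace over all `k`; the
  -- additional terms vanish by weight.
  refine Finset.sum_filter_of_ne fun k _ hk => ?_
  by_contra h0
  exact hk (by rw [monCoeff_eq_zero _ _ _ (by rw [i.2]; exact Ne.symm h0), zero_mul])

theorem transferProd_eq (hħ : ħ ≠ 0) {ℓ₁ z₁ ℓ₂ z₂ ℓ₃ z₃ ℓ₄ z₄ : ℂ} {m : ℕ}
    (h : ∀ i j : BalancedSigns N, ∀ᶠ x in cocountable,
      traceProd (scaledTheta τ ħ) (z₁ / ħ - 1) (z₁ / ħ - 1 + ℓ₁) (z₂ / ħ - 1) (z₂ / ħ - 1 + ℓ₂)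
        (fun l => a l / ħ) i.1 j.1 m x =
      traceProd (scaledTheta τ ħ) (z₃ / ħ - 1) (z₃ / ħ - 1 + ℓ₃) (z₄ / ħ - 1) (z₄ / ħ - 1 + ℓ₄)
        (fun l => a l / ħ) i.1 j.1 m x) :
    transferProd τ a ħ ℓ₁ z₁ ℓ₂ z₂ m = transferProd τ a ħ ℓ₃ z₃ ℓ₄ z₄ m := by
  ext i j
  exact (isRep_transferProd a hħ ℓ₁ z₁ ℓ₂ z₂ m i j).eq_of_eventuallyEq
    (isRep_transferProd a hħ ℓ₃ z₃ ℓ₄ z₄ m i j)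
    ((tendsto_cocountable_of_injective fun _ _ => (div_left_inj' hħ).1).eventually (h i j))

variable (hħ : ħ ≠ 0)
  (hlat : ∀ k r s : ℤ, (k : ℂ) * ħ = (r : ℂ) + (s : ℂ) * (τ : ℂ) → (k : ℂ) * ħ = 0)
include hħ hlat

/-- Exchange of the highest weights of two transfer matrices. -/
theorem asymTransfer_exchange {ℓ₁ z₁ ℓ₂ z₂ ℓ₃ ℓ₄ : ℂ} (h₃ : z₁ + ℓ₃ * ħ = z₂ + ℓ₂ * ħ)
    (h₄ : z₂ + ℓ₄ * ħ = z₁ + ℓ₁ * ħ) :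
    asymTransfer τ ħ a ℓ₁ z₁ * asymTransfer τ ħ a ℓ₂ z₂ =
      asymTransfer τ ħ a ℓ₃ z₁ * asymTransfer τ ħ a ℓ₄ z₂ := by
  have h₃' : z₁ / ħ - 1 + ℓ₃ = z₂ / ħ - 1 + ℓ₂ := by
    field_simp
    linear_combination h₃
  have h₄' : z₂ / ħ - 1 + ℓ₄ = z₁ / ħ - 1 + ℓ₁ := by
    field_simp
    linear_combination h₄
  refine asymTransfer_mul_eq τ a (by linear_combination -h₃' - h₄') fun m =>
    transferProd_eq a hħ fun i j => ?_
  rw [h₃', h₄']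
  exact (eventually_regular (isBracket_scaledTheta hħ hlat) _ _ _ _).mono fun x hx =>
    traceProd_exchange (isBracket_scaledTheta hħ hlat) hx _ _ _ i.2 j.2 m

/-- Exchange of the spectral parameters of two transfer matrices. -/
theorem asymTransfer_exchange' {ℓ₁ z₁ ℓ₂ z₂ ℓ₃ ℓ₄ : ℂ} (h₃ : z₂ + ℓ₃ * ħ = z₁ + ℓ₁ * ħ)
    (h₄ : z₁ + ℓ₄ * ħ = z₂ + ℓ₂ * ħ) :
    asymTransfer τ ħ a ℓ₁ z₁ * asymTransfer τ ħ a ℓ₂ z₂ =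
      asymTransfer τ ħ a ℓ₃ z₂ * asymTransfer τ ħ a ℓ₄ z₁ := by
  have h₃' : z₂ / ħ - 1 + ℓ₃ = z₁ / ħ - 1 + ℓ₁ := by
    field_simp
    linear_combination h₃
  have h₄' : z₁ / ħ - 1 + ℓ₄ = z₂ / ħ - 1 + ℓ₂ := by
    field_simp
    linear_combination h₄
  refine asymTransfer_mul_eq τ a (by linear_combination -h₃' - h₄') fun m =>
    transferProd_eq a hħ fun i j => ?_
  rw [h₃', h₄']
  exact traceProd_exchange' (isBracket_scaledTheta hħ hlat) _ _ _ _ _ _ _ i.2 j.2 m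

end Transfer

end EllipticSl2

namespace EllipticSl2

/-! ### Leading coefficients -/

/-- A permutation preserves the sum of `b`, so if all its entries are nonzero every inequality is an
equality and the permutation is the identity. -/
theorem det_eq_prod_diag {ι R : Type*} [Fintype ι] [DecidableEq ι] [CommRing R]
    (b : ι → ℤ) (M : Matrix ι ι R) (h : ∀ i k, M i k ≠ 0 → b k ≤ b i ∧ (b i = b k → i = k)) :
    M.det = ∏ i, M i i := by
  rw [Matrix.det_apply, Finset.sum_eq_single 1]
  · simp
  · intro σ _ hσ
    by_contra h0
    have hne : ∀ i, M (σ i) i ≠ 0 := fun i hi => h0 <| by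
      have : ∏ i, M (σ i) i = 0 := Finset.prod_eq_zero (Finset.mem_univ i) hi
      rw [this, smul_zero]
    have hs : ∑ i, b (σ i) = ∑ i, b i := Equiv.sum_comp σ b
    have he := (Finset.sum_eq_sum_iff_of_le fun i _ => (h _ _ (hne i)).1).1 hs.symm
    exact hσ (Equiv.ext fun i => (h _ _ (hne i)).2 (he i (Finset.mem_univ i)).symm)
  · simp

section Leading

/-- The sum of all partial sums from the right. -/
def suffixWeight : ∀ {N : ℕ}, (Fin N → ℤˣ) → ℤ
  | 0, _ => 0
  | _ + 1, i => ∑ l, (i l : ℤ) + suffixWeight (Fin.tail i)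

variable {f : ℂ → ℂ} {U V : ℂ}

theorem exists_of_lop_ne_zero {i k : ℤˣ} {Φ : ℂ → ℕ → ℂ} {x : ℂ} {j : ℕ}
    (h : lop f U V i k Φ x j ≠ 0) :
    ∃ j' : ℕ, (2 * j' : ℤ) = 2 * j - i + k ∧ Φ (x + (k : ℤ)) j' ≠ 0 := by
  by_contra! h0
  refine h ?_
  have h1 := lop_sum (f := f) (U := U) (V := V) (∅ : Finset ℕ) (fun _ => 0) (fun _ _ _ => 0) i k x j
  simp only [Finset.sum_empty] at h1
  rw [← h1]
  exact lop_congr fun j' hj' => h0 j' hj'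

/-- Starting from degree `0`, the last sites lead to a degree equal to half the difference of the
suffix sums of `i` and `k`. Degrees are nonnegative, so every suffix sum of `i` dominates that of
`k`; equality of the totals forces equality throughout. -/
theorem suffixWeight_of_mon_ne_zero {N : ℕ} (y : Fin N → ℂ) (i k : Fin N → ℤˣ) (x : ℂ) (j : ℕ)
    (h : mon f U V y i k (delta 0) x j ≠ 0) :
    ∑ l, (i l : ℤ) - ∑ l, (k l : ℤ) = 2 * j ∧ suffixWeight k ≤ suffixWeight i ∧
      (suffixWeight i = suffixWeight k → i = k) := by
  induction N generalizing x j with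
  | zero =>
    refine ⟨?_, le_rfl, fun _ => Subsingleton.elim _ _⟩
    have : j = 0 := by
      by_contra h0
      exact h (by simp [mon, delta, h0])
    simp [this]
  | succ N ih =>
    obtain ⟨j', hj', h'⟩ := exists_of_lop_ne_zero h
    obtain ⟨h1, h2, h3⟩ := ih _ _ _ _ _ h'
    have h4 : ∑ l, (i l : ℤ) - ∑ l, (k l : ℤ) = 2 * j := by
      rw [Fin.sum_univ_succ, Fin.sum_univ_succ]
      simp only [Fin.tail] at h1
      linarith
    refine ⟨h4, ?_, fun h5 => ?_⟩
    · simp only [suffixWeight]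
      omega
    · simp only [suffixWeight] at h5
      have h6 : Fin.tail i = Fin.tail k := h3 (by omega)
      have h7 : i 0 = k 0 := by
        rw [h6] at h1
        refine Units.ext ?_
        have : j = 0 := by rw [h6] at h5; omega
        omega
      rw [← Fin.cons_self_tail i, ← Fin.cons_self_tail k, h6, h7]

/-- For equal sequences the degree stays `0` at every site, and there the `x`-dependent factors of
`L_{++}` cancel. -/
theorem monCoeff_zero_diag {x : ℂ} (hx : LocRegular f (V - U) x) {N : ℕ} (y : Fin N → ℂ)
    (i : Fin N → ℤˣ) : monCoeff f U V y i i 0 x =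
      ∏ l, if i l = 1 then f (V + y l + 1) else f (U + y l + 1) := by
  rw [monCoeff]
  induction N generalizing x with
  | zero => simp [mon, delta]
  | succ N ih =>
    have h : _ = ∏ l : Fin N, if i l.succ = 1 then f (V + y l.succ + 1) else
      f (U + y l.succ + 1) := ih (hx.add_int (i 0)) (Fin.tail y) (Fin.tail i)
    rw [Fin.prod_univ_succ, ← h, mon]
    have n0 : f x ≠ 0 := hx.left 0 (by simp)
    have n1 : f (x + (V - U) + 1) ≠ 0 := hx.right 1 (by simp)
    rcases Int.units_eq_one_or (i 0) with h0 | h0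
    · simp only [h0, lop_pp, locPP, if_true, Units.val_one, Int.cast_one, Nat.cast_zero, mul_zero,
        sub_zero, add_sub_add_right_eq_sub]
      rw [mul_assoc (f (V + y 0 + 1)), mul_comm (f (x + (V - U) + 1)),
        mul_div_assoc, div_self (mul_ne_zero n0 n1), mul_one]
    · simp only [h0, lop_mm, locMM, if_neg (by decide : ¬((-1 : ℤˣ) = 1)), Units.val_neg,
        Units.val_one, Int.cast_neg, Int.cast_one, Nat.cast_zero, add_zero, ← sub_eq_add_neg]

end Leading

/-! ### Invertibility of transfer matrices -/

section Units

variable {ħ : ℂ} {N : ℕ} {τ : ℍ}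

theorem eventually_locRegular {f : ℂ → ℂ} (hf : IsBracket f) (ℓ : ℂ) :
    ∀ᶠ x in cocountable, LocRegular f ℓ x := by
  refine eventually_countable_forall.2 fun n => ?_
  filter_upwards [hf.eventually_add_ne n, hf.eventually_add_ne (ℓ + n)] with x h1 h2
  rw [← add_assoc] at h2
  exact ⟨h1, h2⟩

theorem det_traceMatrix_ne_zero (hħ : ħ ≠ 0)
    (hlat : ∀ k r s : ℤ, (k : ℂ) * ħ = (r : ℂ) + (s : ℂ) * (τ : ℂ) → (k : ℂ) * ħ = 0)
    (a : Fin N → ℂ) (ℓ z : ℂ) (h₁ : ∀ l, theta τ (z + a l) ≠ 0)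
    (h₂ : ∀ l, theta τ (z + ℓ * ħ + a l) ≠ 0) :
    ((asymptoticRep τ ħ ℓ).traceMatrix a z (ℓ - 2 * (0 : ℕ))).det ≠ 0 := by
  rw [det_eq_prod_diag fun i => suffixWeight i.1]
  · refine Finset.prod_ne_zero_iff.2 fun i _ => ?_
    refine (isRep_traceMatrix hħ a ℓ z 0 i i).ne_zero ?_
    have h := (tendsto_cocountable_of_injective fun _ _ => (div_left_inj' hħ).1).eventually
      (eventually_locRegular (isBracket_scaledTheta hħ hlat) (z / ħ - 1 + ℓ - (z / ħ - 1)))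
    filter_upwards [h] with x hx
    rw [monCoeff_zero_diag hx]
    refine Finset.prod_ne_zero_iff.2 fun l _ => ?_
    split_ifs
    · convert h₂ l using 1
      rw [scaledTheta]
      congr 1
      field_simp
      ring
    · convert h₁ l using 1
      rw [scaledTheta]
      congr 1
      field_simp
      ring
  · intro i k hik
    have : ∃ x, monCoeff (scaledTheta τ ħ) (z / ħ - 1) (z / ħ - 1 + ℓ) (fun l => a l / ħ)
        i.1 k.1 0 x ≠ 0 := by
      by_contra! h0
      exact hik ((isRep_traceMatrix hħ a ℓ z 0 i k).eq_of_eventuallyEq Mero.IsRep.zero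
        (Eventually.of_forall fun x => h0 _))
    obtain ⟨x, hx⟩ := this
    obtain ⟨-, h2, h3⟩ := suffixWeight_of_mon_ne_zero _ _ _ _ _ hx
    exact ⟨h2, fun h => Subtype.ext (h3 h)⟩

open scoped ComplexOrder

/-- A power series with semilinear coefficients and invertible leading coefficient has an inverse
with semilinear coefficients. -/
theorem coeff_invOfUnit_smul (ℓ : ℂ) (φ : PowerSeries (Module.End ℂ (SpinSpace N)))
    (u : (Module.End ℂ (SpinSpace N))ˣ) (hu : PowerSeries.constantCoeff φ = u)
    (hφ : ∀ (m : ℕ) (g : Mero) (v : SpinSpace N), PowerSeries.coeff m φ (g • v) =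
      Mero.shift (-(ℓ - 2 * m) * ħ) g • PowerSeries.coeff m φ v)
    (m : ℕ) (g : Mero) (v : SpinSpace N) :
    PowerSeries.coeff m (PowerSeries.invOfUnit φ u) (g • v) =
      Mero.shift (-(-ℓ - 2 * m) * ħ) g • PowerSeries.coeff m (PowerSeries.invOfUnit φ u) v := by
  have hinv : ∀ (g : Mero) (v : SpinSpace N),
      (↑u⁻¹ : Module.End ℂ (SpinSpace N)) (g • v) =
        Mero.shift (ℓ * ħ) g • (↑u⁻¹ : Module.End ℂ (SpinSpace N)) v := by
    intro g v
    have h1 : ∀ w, (u : Module.End ℂ (SpinSpace N)) ((↑u⁻¹ : Module.End ℂ (SpinSpace N)) w) = w :=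
      fun w => by rw [← Module.End.mul_apply, Units.mul_inv, Module.End.one_apply]
    have h2 : ∀ w, (↑u⁻¹ : Module.End ℂ (SpinSpace N)) ((u : Module.End ℂ (SpinSpace N)) w) = w :=
      fun w => by rw [← Module.End.mul_apply, Units.inv_mul, Module.End.one_apply]
    have h3 := hφ 0 (Mero.shift (ℓ * ħ) g) ((↑u⁻¹ : Module.End ℂ (SpinSpace N)) v)
    rw [PowerSeries.coeff_zero_eq_constantCoeff_apply, hu, h1, Mero.shift_shift] at h3
    rw [show -(ℓ - 2 * ((0 : ℕ) : ℂ)) * ħ + ℓ * ħ = 0 by simp, Mero.shift_zero] at h3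
    rw [← h3, h2]
  induction m using Nat.strong_induction_on generalizing g v with
  | _ m ih =>
    rw [PowerSeries.coeff_invOfUnit]
    split_ifs with h0
    · subst h0
      rw [hinv]
      congr 2
      simp
    · simp only [Module.End.mul_apply, LinearMap.neg_apply, LinearMap.sum_apply]
      rw [smul_neg, neg_inj]
      have key : ∀ x ∈ Finset.HasAntidiagonal.antidiagonal m,
          (if x.2 < m then PowerSeries.coeff x.1 φ *
            PowerSeries.coeff x.2 (PowerSeries.invOfUnit φ u) else 0 :
              Module.End ℂ (SpinSpace N)) (g • v) =
          Mero.shift (-(-2 * m) * ħ) g • (if x.2 < m then PowerSeries.coeff x.1 φ *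
            PowerSeries.coeff x.2 (PowerSeries.invOfUnit φ u) else 0 :
              Module.End ℂ (SpinSpace N)) v := by
        intro x hx
        have hx' := Finset.HasAntidiagonal.mem_antidiagonal.1 hx
        split_ifs with h
        · simp only [Module.End.mul_apply]
          rw [ih x.2 h, hφ, Mero.shift_shift, ← hx']
          congr 3
          push_cast
          ring
        · simp
      rw [Finset.sum_congr rfl key, ← Finset.smul_sum, hinv, Mero.shift_shift,
        show ℓ * ħ + -(-2 * m) * ħ = -(-ℓ - 2 * m) * ħ by ring]

/-- The inverse is `p^{-ℓ}` times the formal inverse of the power series. It remains to see that it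
lies in the subalgebra, which is the content of `coeff_invOfUnit_smul`. -/
theorem isUnit_of_val_eq {ℓ : ℂ} {φ : PowerSeries (Module.End ℂ (SpinSpace N))}
    (X : DynSeries ħ N)
    (hX : (X : HahnSeries ℂᵒᵈ (Module.End ℂ (SpinSpace N))) = monomial _ ℓ * conePower _ φ)
    (hu : IsUnit (PowerSeries.coeff 0 φ)) : IsUnit X := by
  obtain ⟨u, hu⟩ := hu
  rw [PowerSeries.coeff_zero_eq_constantCoeff_apply] at hu
  have hφ : ∀ (m : ℕ) (g : Mero) (v : SpinSpace N), PowerSeries.coeff m φ (g • v) =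
      Mero.shift (-(ℓ - 2 * m) * ħ) g • PowerSeries.coeff m φ v := by
    intro m g v
    have := X.2.2 (ℓ - 2 * m) g v
    rwa [hX, coeff_monomial_mul_conePower] at this
  let Y : HahnSeries ℂᵒᵈ (Module.End ℂ (SpinSpace N)) :=
    monomial _ (-ℓ) * conePower _ (PowerSeries.invOfUnit φ u)
  have hY : Y ∈ DynSeries ħ N := by
    refine ⟨⟨{-ℓ}, fun α hα => ?_⟩, fun α g v => ?_⟩
    · by_contra h
      refine hα (coeff_monomial_mul_conePower_of_ne _ _ _ fun m hm => h ?_)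
      exact ⟨-ℓ, by simp, m, hm⟩
    · by_cases h : ∃ m : ℕ, α = -ℓ - 2 * m
      · obtain ⟨m, rfl⟩ := h
        simp only [Y, coeff_monomial_mul_conePower]
        exact coeff_invOfUnit_smul ℓ φ u hu.symm hφ m g v
      · push Not at h
        simp only [Y, coeff_monomial_mul_conePower_of_ne _ _ _ h, LinearMap.zero_apply, smul_zero]
  refine ⟨⟨X, ⟨Y, hY⟩, ?_, ?_⟩, rfl⟩
  · apply Subtype.ext
    change (X : HahnSeries ℂᵒᵈ (Module.End ℂ (SpinSpace N))) * Y = 1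
    rw [hX, monomial_mul_mul, PowerSeries.mul_invOfUnit _ _ hu.symm, add_neg_cancel, monomial_zero,
      map_one, one_mul]
  · apply Subtype.ext
    change Y * (X : HahnSeries ℂᵒᵈ (Module.End ℂ (SpinSpace N))) = 1
    rw [hX, monomial_mul_mul, PowerSeries.invOfUnit_mul _ _ hu.symm, neg_add_cancel, monomial_zero,
      map_one, one_mul]

theorem isUnit_asymTransfer (hħ : ħ ≠ 0)
    (hlat : ∀ k r s : ℤ, (k : ℂ) * ħ = (r : ℂ) + (s : ℂ) * (τ : ℂ) → (k : ℂ) * ħ = 0)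
    (a : Fin N → ℂ) (ℓ z : ℂ) (h₁ : ∀ l, theta τ (z + a l) ≠ 0)
    (h₂ : ∀ l, theta τ (z + ℓ * ħ + a l) ≠ 0) : IsUnit (asymTransfer τ ħ a ℓ z) := by
  refine isUnit_of_val_eq _ (asymTransfer_val τ a ℓ z) ?_
  rw [transferCoeff, PowerSeries.coeff_mk]
  exact isUnit_diffOp _ (det_traceMatrix_ne_zero hħ hlat a ℓ z h₁ h₂)

end Units

/-! ### Quasi-periodicity -/

section Periodicity

variable {f e : ℂ → ℂ} {U V δ : ℂ}

/-- Both `L_{+k}` have two brackets containing `V` in the numerator and one in the denominator, with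
arguments satisfying `s + t - r = V + 1`. The operators `L_{-k}` do not involve `V`. The hypothesis
`hadd` is what an exponential of an affine function satisfies. -/
theorem lop_add_period (hf : ∀ t, f (t + δ) = e t * f t) (he : ∀ t, e t ≠ 0)
    (hadd : ∀ s t r, e s * e t = e (s + t - r) * e r) (i k : ℤˣ) (Φ : ℂ → ℕ → ℂ) (x : ℂ) (j : ℕ) :
    lop f U (V + δ) i k Φ x j = (if i = 1 then e (V + 1) else 1) * lop f U V i k Φ x j := by
  have key : ∀ s t r c d : ℂ, s + t - r = V + 1 → f (s + δ) * f (t + δ) * c / (d * f (r + δ)) =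
      e (V + 1) * (f s * f t * c / (d * f r)) := by
    intro s t r c d h
    have h1 := hadd s t r
    have h2 := he r
    rw [hf, hf, hf, show e s * f s * (e t * f t) * c = e s * e t * (f s * f t * c) by ring, h1, h,
      show d * (e r * f r) = e r * (d * f r) by ring, mul_right_comm, mul_comm _ (e r),
      mul_div_mul_left _ _ h2, mul_div_assoc]
  rcases Int.units_eq_one_or i with rfl | rfl <;> rcases Int.units_eq_one_or k with rfl | rfl
  · simp only [lop_pp, locPP, if_true]
    rw [← mul_assoc, ← key _ _ _ _ _ (by ring :
      (V - j + 1) + (x + (V - U) - j + 1) - (x + (V - U) - 2 * j + 1) = V + 1)]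
    ring_nf
  · cases j with
    | zero => simp
    | succ j =>
      simp only [lop_pm, locPM, predFun_succ, if_true, div_mul_eq_mul_div]
      have h := key (V + x - j) (V - U - j) (x + (V - U) - 2 * j - 1) (Φ (x - 1) j) 1 (by ring)
      rw [one_mul, one_mul] at h
      rw [← h]
      ring_nf
  · simp
  · simp

/-- With equal inhomogeneities every plus sign of `i` contributes the same factor, and a balanced
`i` of length `2n` has `n` of them. -/
theorem monCoeff_add_period (hf : ∀ t, f (t + δ) = e t * f t) (he : ∀ t, e t ≠ 0)
    (hadd : ∀ s t r, e s * e t = e (s + t - r) * e r) {n : ℕ} (y : ℂ) (i k : BalancedSigns (2 * n))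
    (j : ℕ) (x : ℂ) : monCoeff f U (V + δ) (fun _ => y) i.1 k.1 j x =
      e (V + y + 1) ^ n * monCoeff f U V (fun _ => y) i.1 k.1 j x := by
  have h : ∀ {N : ℕ} (i k : Fin N → ℤˣ) (Φ : ℂ → ℕ → ℂ) (x : ℂ) (j : ℕ),
      mon f U (V + δ) (fun _ => y) i k Φ x j =
        (∏ l, if i l = 1 then e (V + y + 1) else 1) * mon f U V (fun _ => y) i k Φ x j := by
    intro N
    induction N with
    | zero => intros; simp [mon]
    | succ N ih =>
      intro i k Φ x j
      simp only [mon]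
      rw [show V + δ + y = V + y + δ by ring, lop_add_period hf he hadd, Fin.prod_univ_succ,
        mul_assoc]
      congr 1
      have h1 := lop_sum (f := f) (U := U + y) (V := V + y) {()}
        (fun _ => ∏ l, if Fin.tail i l = 1 then e (V + y + 1) else 1)
        (fun _ => mon f U V (fun _ => y) (Fin.tail i) (Fin.tail k) Φ) (i 0) (k 0) x j
      simp only [Finset.sum_singleton] at h1
      exact (lop_congr fun _ _ => ih ..).trans h1
  rw [monCoeff, h, monCoeff]
  congr 1
  rw [Finset.prod_ite, Finset.prod_const_one, mul_one, Finset.prod_const]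
  congr 1
  have h1 := i.2
  have h2 : ∀ l, ((i.1 l : ℤˣ) : ℤ) = 2 * (if i.1 l = 1 then 1 else 0) - 1 := fun l => by
    rcases Int.units_eq_one_or (i.1 l) with h | h <;> simp [h]
  simp only [h2, Finset.sum_sub_distrib, ← Finset.mul_sum, Finset.sum_boole] at h1
  simp at h1
  omega

end Periodicity

end EllipticSl2

namespace EllipticSl2

/-! ### Quasi-periodicity of the normalised Q-operator -/

section Normalised

open scoped ComplexOrder

variable {ħ : ℂ} {N : ℕ}

theorem pT_val (α : ℂ) : (pT ħ N α : HahnSeries ℂᵒᵈ (Module.End ℂ (SpinSpace N))) =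
    monomial _ α * conePower _ (PowerSeries.C (shiftOp ħ N α)) := by
  ext1
  funext β
  obtain ⟨β, rfl⟩ := OrderDual.toDual.surjective β
  change (if β = α then shiftOp ħ N α else 0) = _
  by_cases h : ∃ m : ℕ, β = α - 2 * m
  · obtain ⟨m, rfl⟩ := h
    rw [coeff_monomial_mul_conePower, PowerSeries.coeff_C]
    simp
  · push Not at h
    rw [coeff_monomial_mul_conePower_of_ne _ _ _ h, if_neg fun h0 => h 0 (by simp [h0])]

theorem shiftOp_eq_diffOp (α : ℂ) : shiftOp ħ N α = diffOp ħ α 1 := by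
  refine LinearMap.ext fun v => funext fun i => ?_
  rw [diffOp_apply]
  simp [shiftOp, Matrix.one_apply]

theorem diffOp_const_smul (α c : ℂ) (A : Matrix (BalancedSigns N) (BalancedSigns N) Mero) :
    diffOp ħ α (c • A) = c • diffOp ħ α A := by
  refine LinearMap.ext fun v => funext fun i => ?_
  simp only [diffOp_apply, LinearMap.smul_apply, Pi.smul_apply, Matrix.smul_apply, smul_mul_assoc,
    ← Finset.smul_sum, map_smul]

/-- The normalisation removes `z/ħ` from both exponents and shifts, so `z` enters only through the
trace matrices. -/
theorem baxterQNorm_val (τ : ℍ) (a : Fin N → ℂ) (z : ℂ) :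
    (baxterQNorm τ ħ a z : HahnSeries ℂᵒᵈ (Module.End ℂ (SpinSpace N))) =
      monomial _ 0 * conePower _ (PowerSeries.mk fun m => diffOp ħ (-(2 * m))
        ((asymptoticRep τ ħ (z / ħ)).traceMatrix a 0 (z / ħ - 2 * m))) := by
  rw [baxterQNorm, baxterQ, MulMemClass.coe_mul, pT_val, asymTransfer_val, monomial_mul_mul,
    neg_add_cancel]
  congr 2
  ext1 m
  rw [PowerSeries.coeff_C_mul, transferCoeff, PowerSeries.coeff_mk, PowerSeries.coeff_mk,
    shiftOp_eq_diffOp, diffOp_mul, Matrix.map_one _ (map_zero _) (map_one _), Matrix.one_mul]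
  congr 1
  ring

theorem baxterQNorm_add {τ : ℍ} {n : ℕ} (hħ : ħ ≠ 0) (a : Fin (2 * n) → ℂ) {b : ℂ}
    (ha : ∀ l, a l = b) {w : ℂ} {e : ℂ → ℂ} (hf : ∀ t, theta τ (t + w) = e t * theta τ t)
    (he : ∀ t, e t ≠ 0) (hadd : ∀ s t r, e s * e t = e (s + t - r) * e r) (z : ℂ) :
    baxterQNorm τ ħ a (z + w) = e (z + b) ^ n • baxterQNorm τ ħ a z := by
  obtain rfl : a = fun _ => b := funext ha
  have htr : ∀ m : ℕ,
      (asymptoticRep τ ħ ((z + w) / ħ)).traceMatrix (fun _ : Fin (2 * n) => b) 0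
        ((z + w) / ħ - 2 * m) = e (z + b) ^ n •
      (asymptoticRep τ ħ (z / ħ)).traceMatrix (fun _ : Fin (2 * n) => b) 0 (z / ħ - 2 * m) := by
    intro m
    ext i k
    refine (isRep_traceMatrix hħ _ _ _ m i k).eq_of_eventuallyEq
      ((isRep_traceMatrix hħ _ _ _ m i k).smul _) (Eventually.of_forall fun x => ?_)
    -- The spectral parameter of the Q-operator is `0`, so `U` stays fixed and replacing `z` by `z +
    -- w` moves only `V`, by `w/ħ`.
    have := monCoeff_add_period (f := scaledTheta τ ħ) (δ := w / ħ) (e := fun t => e (ħ * t))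
      (U := 0 / ħ - 1) (V := 0 / ħ - 1 + z / ħ)
      (fun t => by rw [scaledTheta, mul_add, mul_div_cancel₀ _ hħ, hf, scaledTheta])
      (fun t => he _) (fun s t r => by rw [hadd _ _ (ħ * r)]; congr 2; ring) (b / ħ) i k m (x / ħ)
    rw [add_div, ← add_assoc, this]
    congr 3
    field_simp
    ring
  apply Subtype.ext
  change (baxterQNorm τ ħ _ (z + w)).1 = e (z + b) ^ n • (baxterQNorm τ ħ _ z).1
  rw [baxterQNorm_val, baxterQNorm_val]
  ext1
  funext β
  obtain ⟨β, rfl⟩ := OrderDual.toDual.surjective β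
  rw [HahnSeries.coeff_smul]
  by_cases h : ∃ m : ℕ, β = 0 - 2 * m
  · obtain ⟨m, rfl⟩ := h
    rw [coeff_monomial_mul_conePower, coeff_monomial_mul_conePower, PowerSeries.coeff_mk,
      PowerSeries.coeff_mk, htr, diffOp_const_smul]
  · push Not at h
    rw [coeff_monomial_mul_conePower_of_ne _ _ _ h, coeff_monomial_mul_conePower_of_ne _ _ _ h,
      smul_zero]

end Normalised

theorem theta_ne_zero {τ : ℍ} {z : ℂ} (h : ∀ r s : ℤ, z ≠ r + s * (τ : ℂ)) : theta τ z ≠ 0 :=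
  fun h0 => by
    obtain ⟨r, s, hrs⟩ := exists_int_of_theta_eq_zero h0
    exact h r s hrs

end EllipticSl2

theorem mainTheorem2 (τ : UpperHalfPlane) (ħ : ℂ) (hħ : ħ ≠ 0)
    (hlat : ∀ k r s : ℤ, (k : ℂ) * ħ = (r : ℂ) + (s : ℂ) * (τ : ℂ) → (k : ℂ) * ħ = 0)
    (n : ℕ) (hn : 0 < n) (a : Fin (2 * n) → ℂ)
    (ha : ∀ (l : Fin (2 * n)) (r s : ℤ), a l ≠ (r : ℂ) + (s : ℂ) * (τ : ℂ)) :
    (∀ ℓ z : ℂ,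
      Commute (asymTransfer τ ħ a ℓ z) (asymTransfer τ ħ a 0 z) ∧
      Commute (baxterQ τ ħ a (z + ℓ * ħ)) (baxterQ τ ħ a z) ∧
      asymTransfer τ ħ a ℓ z * baxterQ τ ħ a z =
        baxterQ τ ħ a (z + ℓ * ħ) * asymTransfer τ ħ a 0 z ∧
      ((∀ (l : Fin (2 * n)) (r s : ℤ), z + a l ≠ (r : ℂ) + (s : ℂ) * (τ : ℂ)) →
        ∃ t₀ q : (DynSeries ħ (2 * n))ˣ,
          (t₀ : DynSeries ħ (2 * n)) = asymTransfer τ ħ a 0 z ∧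
          (q : DynSeries ħ (2 * n)) = baxterQ τ ħ a z ∧
          asymTransfer τ ħ a ℓ z * (↑t₀⁻¹ : DynSeries ħ (2 * n)) =
            baxterQ τ ħ a (z + ℓ * ħ) * (↑q⁻¹ : DynSeries ħ (2 * n)))) ∧
    (∀ b : ℂ, (∀ l : Fin (2 * n), a l = b) → ∀ z : ℂ,
      baxterQNorm τ ħ a (z + 1) = ((-1 : ℂ) ^ n) • baxterQNorm τ ħ a z ∧
      baxterQNorm τ ħ a (z + (τ : ℂ)) =
        ((-1 : ℂ) ^ n * Complex.exp (-((n : ℂ) * (Real.pi : ℂ) * Complex.I *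
          ((τ : ℂ) + 2 * z + 2 * b)))) • baxterQNorm τ ħ a z) := by
  have hmul : ∀ ℓ z : ℂ, asymTransfer τ ħ a ℓ z * baxterQ τ ħ a z =
      baxterQ τ ħ a (z + ℓ * ħ) * asymTransfer τ ħ a 0 z := fun ℓ z =>
    -- In multiples of `ħ`, the labels `(z, z + ℓħ)` and `(0, z)` become `(0, z + ℓħ)` and `(z, z)`
    -- when the first parameters are exchanged.
    asymTransfer_exchange' a hħ hlat (by field_simp; ring) (by field_simp; ring)
  refine ⟨fun ℓ z => ⟨asymTransfer_exchange a hħ hlat rfl rfl,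
    asymTransfer_exchange a hħ hlat rfl rfl, hmul ℓ z, fun hz => ?_⟩, fun b hb z => ⟨?_, ?_⟩⟩
  · have hz' : ∀ l, theta τ (z + a l) ≠ 0 := fun l => theta_ne_zero (hz l)
    obtain ⟨t₀, ht₀⟩ := isUnit_asymTransfer hħ hlat a 0 z hz' (by simpa using hz')
    -- For the label `(0, z)` the diagonal entries of the leading coefficient involve both `θ(a_l)`
    -- and `θ(z + a_l)`.
    obtain ⟨q, hq⟩ := isUnit_asymTransfer hħ hlat a (z / ħ) 0
      (by simpa using fun l => theta_ne_zero (ha l))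
      (by simpa [div_mul_cancel₀ _ hħ] using hz')
    refine ⟨t₀, q, ht₀, hq, ?_⟩
    have h₁ := hmul ℓ z
    -- The case `ℓ = 0` of the exchange relation says that `t₀` and `q` commute, which is needed to
    -- form the two quotients.
    have h₂ := hmul 0 z
    rw [zero_mul, add_zero] at h₂
    have hq' : (q : DynSeries ħ (2 * n)) = baxterQ τ ħ a z := hq
    rw [← ht₀, ← hq'] at h₁ h₂
    have h₃ : (↑q⁻¹ : DynSeries ħ (2 * n)) * t₀ = t₀ * (↑q⁻¹ : DynSeries ħ (2 * n)) :=
      (show Commute (q : DynSeries ħ (2 * n)) t₀ from h₂.symm).units_inv_left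
    rw [Units.mul_inv_eq_iff_eq_mul, mul_assoc, h₃, ← mul_assoc, ← h₁, Units.mul_inv_cancel_right]
  · exact baxterQNorm_add hħ a hb (w := 1) (e := fun _ => -1)
      (fun t => by rw [theta_add_one]; ring) (fun _ => by norm_num) (fun _ _ _ => rfl) z
  · have := baxterQNorm_add hħ a hb (w := τ)
      (e := fun t => -Complex.exp (-(Complex.I * Real.pi * (τ + 2 * t))))
      (fun t => by rw [theta_add_tau]) (fun _ => neg_ne_zero.2 (Complex.exp_ne_zero _))
      (fun s t r => by
        rw [neg_mul_neg, neg_mul_neg, ← Complex.exp_add, ← Complex.exp_add]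
        congr 1
        ring) z
    rw [this, neg_pow, ← Complex.exp_nat_mul]
    congr 3
    ring
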